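/- **Setting.** Let $N\ge 0$, $\eta\in\mathbb C\setminus\{0\}$, and let $\xi_1,\dots,\xi_N\in\mathbb C$ satisfy $\xi_j\notin\{0,\pm\eta\}$ and $\xi_j\pm\xi_k\notin\{0,\pm\eta\}$ for $j\neq k$. On $\mathcal H=(\mathbb C^2)^{\otimes N}$ let $|0\rangle$ be the all-spins-up vector, $E_n^{ij}$ the elementary matrix acting on site $n$, and $$M(u)=R_{0N}(u-\xi_N-\tfrac\eta2)\cdots R_{01}(u-\xi_1-\tfrac\eta2),\qquad R(u)=\begin{pmatrix}u+\eta&0&0&0\\0&u&\eta&0\\0&\eta&u&0\\0&0&0&u+\eta\end{pmatrix},$$ $\hat M(u)=(-1)^N\sigma_0^yM^{t_0}(-u)\sigma_0^y$. For $\bar\zeta_+\neq0$ and $\bar{\mathsf b}_+\in\mathbb C$ put $\bar K_+(u)=1+\frac{u+\eta/2}{\bar\zeta_+}(\sigma^z+\bar{\mathsf b}_+\sigma^+)$, define $\bar{\mathcal U}_+$ by $\bar{\mathcal U}_+^{t_0}=M^{t_0}\bar K_+^{t_0}\hat M^{t_0}$, and let $\bar{\mathcal B}_+(u)$ be its upper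 right entry in the auxiliary space. For a finite family $x$ let $\bar{\mathcal B}_+(x)$ be the product of the $\bar{\mathcal B}_+(x_i)$ (in increasing order of the indices; these operators commute). Let $$Q_m(\kappa)=\prod_{a=1}^m(E_a^{11}+\kappa E_a^{22}),\qquad 0\le m\le N,\ \kappa\in\mathbb C .$$ **Notation.** $\xi^{(0)}_a=\xi_a+\eta/2$, $I_k=\{1,\dots,k\}$, $a(u)=\prod_{n=1}^N(u-\xi_n+\frac\eta2)$, $d(u)=\prod_{n=1}^N(u-\xi_n-\frac\eta2)$, $f(x|y)=\frac{x-y+\eta}{x-y}$, $\tau(x|y)=a(x)f(y|x)$, $r(x|y)=\frac{\eta}{(x-y)(x-y+\eta)}$. A function ($a$, $f$, $\tau$) of families means the product over all elements for a function of one variable and over all pairs for a function of two variables (so $\tau(x|y)=\prod_ia(x_i)\prod_{i,k}f(y_k|x_i)$). For $|\gamma_+|=|\alpha_+|=n$, $x=(\xi^{(0)}_k)_{k\in\gamma_+}$, and a family $y=(y_j)_{j\in\alpha_+}$, set $$\bar S_n^\kappa(x|y)=\frac{\prod_{k\in\gamma_+,\,j\in\alpha_+}(x_k-y_j+\eta)}{\prod_{a>b\in\gamma_+}(x_a-x_b)\prod_{a>b\in\alpha_+}(y_b-y_a)}\det_{j\in\alpha_+,\,k\in\gamma_+}\!\Big[r(x_k|y_j)-\kappa\,r(y_j|x_k)\prod_{l\in\alpha_+\setminus\{j\}}\frac{f(y_l|y_j)}{f(y_j|y_l)}\prod_{l\in\gamma_+}\frac{f(y_j|x_l)}{f(x_l|y_j)}\Big]$$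 (rows and columns in increasing order), $$R_n^\kappa(\xi_{\gamma_+}|\xi_{\gamma_-}|y|z)=\frac{\tau(y|z)\,\tau(\xi^{(0)}_{\gamma_-}|\xi^{(0)}_{\gamma_+})}{\tau(\xi^{(0)}_{\gamma_+\cup\gamma_-}|y)\,f(z|\xi^{(0)}_{\gamma_+})}\,\bar S_n^\kappa(\xi^{(0)}_{\gamma_+}|y),$$ $$H_\sigma(x)=\prod_jd(-\sigma_jx_j)\frac{2x_j+\eta}{2x_j}\big(x_j+\sigma_j(\bar\zeta_+-\tfrac\eta2)\big)\prod_{r<s}\frac{\sigma_sx_s+\sigma_rx_r-\eta}{\sigma_sx_s+\sigma_rx_r},$$ $$\mathcal R_n^\kappa(\xi_{\gamma_+}|\xi_{\gamma_-}|\mu_{\alpha_+}|\mu_{\alpha_-})=\sum_{\sigma\in\{\pm1\}^{\alpha_+}}\frac{H_\sigma(\mu_{\alpha_+})}{H_{(1,\dots,1)}(\xi^{(0)}_{\gamma_+})}\,R_n^\kappa\big(\xi_{\gamma_+}|\xi_{\gamma_-}|(\sigma_j\mu_j)_{j\in\alpha_+}\big|\mu_{\alpha_-}\cup(-\mu_{\alpha_-})\big).$$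 **Proposition.** (1) Let $0\le m\le N$, $M\ge0$, $\kappa\in\mathbb C$, and $\mu_1,\dots,\mu_M\in\mathbb C$. Assume $2\xi_a+\eta\neq0$ and $\xi_a+\bar\zeta_+\neq0$ for $a\le m$; $\mu_j\neq0$; $\mu_j\pm\mu_k\notin\{0,\pm\eta\}$ for $j\ne k$; and $\pm\mu_j\notin\{\xi_a^{(0)},\ \xi_a^{(0)}-\eta,\ \xi_a^{(0)}+\eta\}$ for all $j$ and all $a\le m$ (so that no denominator above vanishes). Then $$Q_m(\kappa)\,\bar{\mathcal B}_+(\mu_{I_M})|0\rangle=\sum_{n=0}^{\min(m,M)}\ \sum_{\substack{I_M=\alpha_+\sqcup\alpha_-,\ I_m=\gamma_+\sqcup\gamma_-\\|\gamma_+|=|\alpha_+|=n}}\mathcal R_n^\kappa(\xi_{\gamma_+}|\xi_{\gamma_-}|\mu_{\alpha_+}|\mu_{\alpha_-})\ \bar{\mathcal B}_+(\mu_{\alpha_-}\cup\xi^{(0)}_{\gamma_+})|0\rangle .$$ (2) For $1\le m\le N$, $$\sigma_m^z=1+2\big[\partial_\kappa Q_{m-1}(\kappa)-\partial_\kappa Q_m(\kappa)\big]_{\kappa=1}.$$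 -/

import Mathlib

noncomputable section

namespace OpenXXX

/-- Operators on the space of states of a chain of `N` spins 1/2, in the spin basis
`s : Fin N → Fin 2`; the value `0` is "up" (first basis vector), the value `1` is "down". -/
abbrev SpinOp (N : ℕ) := Matrix (Fin N → Fin 2) (Fin N → Fin 2) ℂ

/-- The operator acting as the `2 × 2` matrix `X` on site `n` and as the identity elsewhere. -/
def siteOp {N : ℕ} (n : Fin N) (X : Matrix (Fin 2) (Fin 2) ℂ) : SpinOp N :=
  Matrix.of fun s t => if ∀ k, k ≠ n → s k = t k then X (s n) (t n) else 0

/-- The rational six-vertex matrix `R(u)`, with diagonal `(u + η, u, u, u + η)` and the two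
off-diagonal entries `η`. -/
def Rmat (η u : ℂ) : Matrix (Fin 2 × Fin 2) (Fin 2 × Fin 2) ℂ :=
  Matrix.of fun p q =>
    if p = q then (if p.1 = p.2 then u + η else u)
    else if p = q.swap then η else 0

/-- `2 × 2` matrices in the auxiliary space with entries acting on the chain. -/
abbrev AuxOp (N : ℕ) := Matrix (Fin 2) (Fin 2) (SpinOp N)

/-- A scalar matrix acting on the auxiliary space only. -/
def auxScalar (N : ℕ) (K : Matrix (Fin 2) (Fin 2) ℂ) : AuxOp N :=
  K.map (algebraMap ℂ (SpinOp N))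

/-- `R_{0n}(u)`, where `0` is the auxiliary space. -/
def Lax {N : ℕ} (η u : ℂ) (n : Fin N) : AuxOp N :=
  Matrix.of fun i j => siteOp n (Matrix.of fun s t => Rmat η u (i, s) (j, t))

/-- Bulk monodromy matrix
`M(u) = R_{0N}(u - ξ_N - η/2) ⋯ R_{01}(u - ξ_1 - η/2) = (A(u), B(u); C(u), D(u))`. -/
def monodromy {N : ℕ} (η : ℂ) (ξ : Fin N → ℂ) (u : ℂ) : AuxOp N :=
  (List.ofFn fun n : Fin N => Lax η (u - ξ n - η / 2) n).reverse.prod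

/-- The Pauli matrix `σ^y`. -/
def pauliY : Matrix (Fin 2) (Fin 2) ℂ := !![0, -Complex.I; Complex.I, 0]

/-- The Pauli matrix `σ^z`. -/
def pauliZ : Matrix (Fin 2) (Fin 2) ℂ := !![1, 0; 0, -1]

/-- `M̂(u) = (-1)^N σ_0^y M^{t_0}(-u) σ_0^y`. -/
def monodromyHat {N : ℕ} (η : ℂ) (ξ : Fin N → ℂ) (u : ℂ) : AuxOp N :=
  (-1 : ℂ) ^ N •
    (auxScalar N pauliY * (monodromy η ξ (-u)).transpose * auxScalar N pauliY)

/-- The upper triangular boundary matrix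
`K̄₊(u) = 1 + ((u + η/2) / ζ) (σ^z + b σ^+)`. -/
def Kplus (η ζ b u : ℂ) : Matrix (Fin 2) (Fin 2) ℂ :=
  1 + ((u + η / 2) / ζ) • (pauliZ + b • !![0, 1; 0, 0])

/-- Boundary monodromy matrix `Ū₊(u)`, defined by `Ū₊^{t_0} = M^{t_0} K̄₊^{t_0} M̂^{t_0}`. -/
def Uplus {N : ℕ} (η : ℂ) (ξ : Fin N → ℂ) (ζ b u : ℂ) : AuxOp N :=
  ((monodromy η ξ u).transpose * (auxScalar N (Kplus η ζ b u)).transpose *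
    (monodromyHat η ξ u).transpose).transpose

/-- The operator `B̄₊(u)`, the upper right entry of `Ū₊(u)`. -/
def Bplus {N : ℕ} (η : ℂ) (ξ : Fin N → ℂ) (ζ b u : ℂ) : SpinOp N :=
  Uplus η ξ ζ b u 0 1

/-- The reference state `|0⟩`, all spins up. -/
def refState (N : ℕ) : (Fin N → Fin 2) → ℂ := Pi.single (fun _ => 0) 1

/-- The boundary state `∏ B̄₊(x) |0⟩`, the product running over the list `l`
(the operators `B̄₊` commute, so that the order is immaterial). -/
def boundaryState {N : ℕ} (η : ℂ) (ξ : Fin N → ℂ) (ζ b : ℂ) (l : List ℂ) :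
    (Fin N → Fin 2) → ℂ :=
  (l.map (Bplus η ξ ζ b)).prod.mulVec (refState N)

/-- The quasi-local operator `Q_m(κ) = ∏_{a ≤ m} (E_a^{11} + κ E_a^{22})`. -/
def Qop {N : ℕ} (m : ℕ) (hm : m ≤ N) (κ : ℂ) : SpinOp N :=
  (List.ofFn fun a : Fin m => siteOp (Fin.castLE hm a) !![1, 0; 0, κ]).prod

/-- The entrywise derivative of `κ ↦ Q_m(κ)` at `κ = 1`; all the entries are polynomial in `κ`. -/
def QopDeriv {N : ℕ} (m : ℕ) (hm : m ≤ N) : SpinOp N :=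
  Matrix.of fun s t => deriv (fun κ : ℂ => Qop m hm κ s t) 1

/-- `a(u) = ∏_n (u - ξ_n + η/2)`. -/
def aFun {N : ℕ} (η : ℂ) (ξ : Fin N → ℂ) (u : ℂ) : ℂ := ∏ n, (u - ξ n + η / 2)

/-- `d(u) = ∏_n (u - ξ_n - η/2)`. -/
def dFun {N : ℕ} (η : ℂ) (ξ : Fin N → ℂ) (u : ℂ) : ℂ := ∏ n, (u - ξ n - η / 2)

/-- `f(x|y) = (x - y + η) / (x - y)`. -/
def fFun (η x y : ℂ) : ℂ := (x - y + η) / (x - y)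

/-- `r(x|y) = η / ((x - y)(x - y + η))`. -/
def rFun (η x y : ℂ) : ℂ := η / ((x - y) * (x - y + η))

/-- `f(x|y)` for families: the product of `f(x_i|y_k)` over all pairs. -/
def fProd {ι ι' : Type} [Fintype ι] [Fintype ι'] (η : ℂ) (x : ι → ℂ) (y : ι' → ℂ) : ℂ :=
  ∏ i, ∏ k, fFun η (x i) (y k)

/-- `τ(x|y) = a(x) f(y|x)` for families, as a product over all elements and all pairs. -/
def tau {N : ℕ} {ι ι' : Type} [Fintype ι] [Fintype ι'] (η : ℂ) (ξ : Fin N → ℂ)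
    (x : ι → ℂ) (y : ι' → ℂ) : ℂ :=
  (∏ i, aFun η ξ (x i)) * fProd η y x

/-- The value `±1` of a sign. -/
def sgn (ε : ℤˣ) : ℂ := ((ε : ℤ) : ℂ)

/-- The boundary-bulk coefficient `H_σ(x)` of a family `x` with signs `σ`. -/
def Hcoef {N n : ℕ} (η : ℂ) (ξ : Fin N → ℂ) (ζ : ℂ) (σ : Fin n → ℤˣ) (x : Fin n → ℂ) : ℂ :=
  (∏ j, dFun η ξ (-(sgn (σ j) * x j)) * ((2 * x j + η) / (2 * x j)) *
      (x j + sgn (σ j) * (ζ - η / 2))) *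
    ∏ s, ∏ r ∈ Finset.Iio s,
      (sgn (σ s) * x s + sgn (σ r) * x r - η) / (sgn (σ s) * x s + sgn (σ r) * x r)

/-- The matrix `M̄^κ_{jk}` for `x = ξ^{(0)}_{γ₊}` (columns) and `y = μ_{α₊}` (rows). -/
def Mmat {n : ℕ} (η κ : ℂ) (x y : Fin n → ℂ) : Matrix (Fin n) (Fin n) ℂ :=
  Matrix.of fun j k =>
    rFun η (x k) (y j) -
      κ * rFun η (y j) (x k) *
        ((∏ l ∈ Finset.univ.erase j, fFun η (y l) (y j)) /
          (∏ l ∈ Finset.univ.erase j, fFun η (y j) (y l))) *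
        ((∏ l, fFun η (y j) (x l)) / (∏ l, fFun η (x l) (y j)))

/-- `S̄_n^κ`, for `x = ξ^{(0)}_{γ₊}` and `y = μ_{α₊}`, both listed in increasing order of the
index. -/
def Sbar {n : ℕ} (η κ : ℂ) (x y : Fin n → ℂ) : ℂ :=
  (∏ i, ∏ j, (x i - y j + η)) /
    ((∏ i, ∏ j ∈ Finset.Iio i, (x i - x j)) * (∏ i, ∏ j ∈ Finset.Iio i, (y j - y i))) *
    (Mmat η κ x y).det

/-- `R_n^κ(ξ_{γ₊}|ξ_{γ₋}|μ_{α₊}|μ_{α₋})`; the first two arguments are the values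
`x₊ = ξ^{(0)}_{γ₊}` and `x₋ = ξ^{(0)}_{γ₋}`. -/
def Rcoef {N n : ℕ} {ι ι' : Type} [Fintype ι] [Fintype ι'] (η κ : ℂ) (ξ : Fin N → ℂ)
    (xp : Fin n → ℂ) (xm : ι → ℂ) (yp : Fin n → ℂ) (ym : ι' → ℂ) : ℂ :=
  (tau η ξ yp ym * tau η ξ xm xp) / (tau η ξ (Sum.elim xp xm) yp * fProd η ym xp) *
    Sbar η κ xp yp

/-- `ξ_a^{(0)} = ξ_a + η/2` for a site `a` among the first `m`. -/
def xi0 {N m : ℕ} (hm : m ≤ N) (η : ℂ) (ξ : Fin N → ℂ) (a : Fin m) : ℂ :=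
  ξ (Fin.castLE hm a) + η / 2

/-- The boundary coefficient `𝓡_n^κ(ξ_{γ₊}|ξ_{γ₋}|μ_{α₊}|μ_{α₋})`, where `α₊ = α`, `γ₊ = γ`, and
`α₋`, `γ₋` are their complements in `{1, …, M}` and `{1, …, m}`:
the sum over the signs `σ` of `α₊` of
`H_σ(μ_{α₊}) / H(ξ^{(0)}_{γ₊}) * R_n^κ(ξ_{γ₊}|ξ_{γ₋}|σ μ_{α₊}|± μ_{α₋})`. -/
def calR {N M m n : ℕ} (hm : m ≤ N) (η ζ κ : ℂ) (ξ : Fin N → ℂ) (μ : Fin M → ℂ)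
    (α : {s : Finset (Fin M) // s.card = n}) (γ : {s : Finset (Fin m) // s.card = n}) : ℂ :=
  let y : Fin n → ℂ := fun i => μ (α.1.orderEmbOfFin α.2 i)
  let x : Fin n → ℂ := fun i => xi0 hm η ξ (γ.1.orderEmbOfFin γ.2 i)
  ∑ σ : Fin n → ℤˣ,
    Hcoef η ξ ζ σ y / Hcoef η ξ ζ (fun _ => 1) x *
      Rcoef η κ ξ x (fun a : {a // a ∉ γ.1} => xi0 hm η ξ a.1)
        (fun i => sgn (σ i) * y i)
        (fun p : {j // j ∉ α.1} × ℤˣ => sgn p.2 * μ p.1.1)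

/-- The boundary state `B̄₊(μ_{α₋} ∪ ξ^{(0)}_{γ₊})|0⟩`. -/
def newState {N M m : ℕ} (hm : m ≤ N) (η ζ b : ℂ) (ξ : Fin N → ℂ) (μ : Fin M → ℂ)
    (α : Finset (Fin M)) (γ : Finset (Fin m)) : (Fin N → Fin 2) → ℂ :=
  boundaryState η ξ ζ b
    (((αᶜ).sort (· ≤ ·)).map μ ++ (γ.sort (· ≤ ·)).map (xi0 hm η ξ))

/-- Generic inhomogeneities: `ξ_j, ξ_j ± ξ_k ∉ {0, -η, η}` for `j ≠ k`. -/
def GenericInhom {N : ℕ} (η : ℂ) (ξ : Fin N → ℂ) : Prop :=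
  (∀ j, ξ j ∉ ({0, -η, η} : Set ℂ)) ∧
  ∀ j k, j ≠ k → ξ j - ξ k ∉ ({0, -η, η} : Set ℂ) ∧ ξ j + ξ k ∉ ({0, -η, η} : Set ℂ)

/-- Generic spectral parameters: `μ_j ≠ 0`, `μ_j ± μ_k ∉ {0, -η, η}` for `j ≠ k`, and
`± μ_j` avoids `ξ_a^{(0)}`, `ξ_a^{(1)} = ξ_a^{(0)} - η` and `ξ_a^{(0)} + η` for the sites
`a ≤ m`. -/
def GenericSpectral {N M m : ℕ} (hm : m ≤ N) (η : ℂ) (ξ : Fin N → ℂ) (μ : Fin M → ℂ) : Prop :=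
  (∀ j, μ j ≠ 0) ∧
  (∀ j k, j ≠ k → μ j - μ k ∉ ({0, -η, η} : Set ℂ) ∧ μ j + μ k ∉ ({0, -η, η} : Set ℂ)) ∧
  ∀ j, ∀ a : Fin m, ∀ ε : ℤˣ, sgn ε * μ j ∉
    ({xi0 hm η ξ a, xi0 hm η ξ a - η, xi0 hm η ξ a + η} : Set ℂ)

end OpenXXX

end

/-! The boundary problem is reduced to a bulk one, and the bulk one to the block of the first `m`
sites, where everything can be expanded over explicit states.

On that block, write `X` for the set of the `m` points ξ^(0). The creation operator B of the block
is a polynomial in its argument of degree below `m`, hence determined by interpolation at any `m`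
nodes, and fusion gives B(x - η) B(x) = 0 for x in `X`. If B(K) has already been applied with K
inside `X`, interpolate the next factor at the nodes X \ K together with K - η: the latter nodes
contribute nothing, and each of the former adds one element to K. Iterating (`opProd_expansion`)
expands every off-shell state of the block over the states B(U)|0⟩ with U inside `X`. The
coefficients satisfy the pole recursion `SS_insert` of an Izergin-type determinant.

On a block state with parameters Y the operator Q acts as κ^|Y|. The claim for the block therefore
compares two expansions over B(U)|0⟩, and the required identity is the case (ν, l, k) = (0, 1, κ) of
the composition law `SS_convolution` for a two-parameter deformation of the determinant. That law is
proved by comparing polynomials in one inhomogeneity. At a spectral parameter the two residues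
telescope, (ν - l) + (l - k) = ν - k, and at another inhomogeneity both sides vanish.

For the full chain, `coproduct` splits an off-shell state over the two blocks. Points of `X` are
zeros of the D-eigenvalue of the first block, so new parameters can only go to that block, and
`bulk_action` follows from `core_action`.

For the boundary, replacing B by B + (b/2) D, a twist compatible with the exchange relations,
absorbs the off-diagonal boundary term. A boundary state is then a weighted sum, over all sign
choices, of twisted bulk states (`boundaryState_eq`): in each step the unwanted terms of k and -k
cancel. Acting termwise and choosing the affected parameters before their signs gives
`Qop_signedState`. The opposite of a point of `X` has weight zero, so the new parameters carry no
sign sum, and the remaining weights depend on the untouched parameters only through the symmetric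
set ±μ.

The second claim is separate: Q_m(κ) is diagonal, and its derivative at κ = 1 counts the down spins
among the first `m` sites. -/

noncomputable section

namespace OpenXXX

open Finset

/-! ### Exchange relations of monodromy matrices. -/

section RTT

variable {A : Type*} [Ring A] [Algebra ℂ A]

/-- The Yang–Baxter (RTT) relation for the rational `R`-matrix, in components. -/
def RTT (η : ℂ) (T : ℂ → Matrix (Fin 2) (Fin 2) A) : Prop :=
  ∀ (u v : ℂ) (i j k l : Fin 2),
    (u - v) • (T u i j * T v k l) + η • (T u k j * T v i l) =
      (u - v) • (T v k l * T u i j) + η • (T v k j * T u i l)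

theorem RTT.mul {η : ℂ} {L M : ℂ → Matrix (Fin 2) (Fin 2) A} (hL : RTT η L) (hM : RTT η M)
    (hc : ∀ u v i j k l, Commute (L u i j) (M v k l)) : RTT η (fun u => L u * M u) := by
  intro u v i j k l
  have key : ∀ u v i a j k b l, L u i a * M u a j * (L v k b * M v b l) =
      L u i a * L v k b * (M u a j * M v b l) := by
    intro u v i a j k b l
    rw [mul_assoc, ← mul_assoc (M u a j), ← (hc v u k b a j).eq, mul_assoc, mul_assoc]
  have h1 : ∀ a b, _ := fun a b => congrArg (· * (M u a j * M v b l)) (hL u v i a k b)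
  have h2 : ∀ a b, _ := fun a b => congrArg (L v k b * L u i a * ·) (hM u v a j b l)
  simp only [add_mul, mul_add, smul_mul_assoc, mul_smul_comm] at h1 h2
  simp only [Matrix.mul_apply, Fin.sum_univ_two, add_mul, mul_add, key]
  linear_combination (norm := module) h1 0 0 + h1 0 1 + h1 1 0 + h1 1 1 + h2 0 0 + h2 0 1 +
    h2 1 0 + h2 1 1

theorem RTT.const (η : ℂ) (G : Matrix (Fin 2) (Fin 2) ℂ) :
    RTT η (fun _ => G.map (algebraMap ℂ A)) := by
  intro u v i j k l
  simp only [Matrix.map_apply, ← map_mul]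
  rw [mul_comm (G i j), mul_comm (G k j) (G i l)]

theorem RTT.map {η : ℂ} {T : ℂ → Matrix (Fin 2) (Fin 2) A} (h : RTT η T)
    {A' : Type*} [Ring A'] [Algebra ℂ A'] (φ : A →ₐ[ℂ] A') : RTT η (fun u => (T u).map φ) := by
  intro u v i j k l
  simpa using congrArg φ (h u v i j k l)

variable {η : ℂ} {T : ℂ → Matrix (Fin 2) (Fin 2) A}

/-- With equal index pairs the relation reads (u - v + η)[T(u), T(v)] = 0. The relation with u and v
exchanged has the factor v - u + η; the two factors add up to 2η, so they cannot both vanish. -/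
theorem RTT.commute_self (h : RTT η T) (hη : η ≠ 0) (i j : Fin 2) (u v : ℂ) :
    Commute (T u i j) (T v i j) := by
  have h1 := h u v i j i j
  have h2 := h v u i j i j
  by_cases huv : u - v + η = 0
  · have h3 : ((v - u) + η) • (T v i j * T u i j) = ((v - u) + η) • (T u i j * T v i j) := by
      linear_combination (norm := module) h2
    have : (v - u) + η ≠ 0 := by
      intro h0
      apply hη
      linear_combination (1/2) * huv + (1/2) * h0
    exact (smul_right_injective A this h3).symm
  · have h3 : ((u - v) + η) • (T u i j * T v i j) = ((u - v) + η) • (T v i j * T u i j) := by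
      linear_combination (norm := module) h1
    exact smul_right_injective A huv h3

theorem RTT.D_mul_B (h : RTT η T) {u v : ℂ} (huv : u ≠ v) :
    T u 1 1 * T v 0 1 =
      (1 + η / (u - v)) • (T v 0 1 * T u 1 1) - (η / (u - v)) • (T u 0 1 * T v 1 1) := by
  have h1 := h u v 1 1 0 1
  have h0 : u - v ≠ 0 := sub_ne_zero.mpr huv
  apply smul_right_injective A h0
  simp only [smul_sub, smul_smul, mul_add, mul_div_cancel₀ _ h0]
  linear_combination (norm := module) h1

/-- One instance of the exchange relation leaves A(v) B(u), in the wrong order, on the right; the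
instance with u and v exchanged eliminates it. The combination is compared after multiplication by
(u - v)², so that nothing is divided by u - v ± η, which may vanish. The result is the relation of D
with η replaced by -η. -/
theorem RTT.A_mul_B (h : RTT η T) {u v : ℂ} (huv : u ≠ v) :
    T u 0 0 * T v 0 1 =
      (1 + -η / (u - v)) • (T v 0 1 * T u 0 0) - (-η / (u - v)) • (T u 0 1 * T v 0 0) := by
  have h1 := h u v 0 0 0 1
  have h2 := h v u 0 0 0 1
  have h0 : u - v ≠ 0 := sub_ne_zero.mpr huv
  have e : 1 + -η / (u - v) = (u - v - η) / (u - v) := by field_simp; ring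
  rw [e]
  apply smul_right_injective A (mul_ne_zero h0 h0)
  have e1 : (u - v) * (u - v) * ((u - v - η) / (u - v)) = (u - v) * (u - v - η) := by
    field_simp
  have e2 : (u - v) * (u - v) * (-η / (u - v)) = -((u - v) * η) := by
    field_simp
  simp only [smul_sub, smul_smul, e1, e2]
  linear_combination (norm := module) (u - v - η) • h1 - η • h2

end RTT

/-! ### Off-shell states and the wanted and unwanted terms of the algebraic Bethe ansatz. -/

section Families

variable {V : Type*} [AddCommGroup V] [Module ℂ V]

/-- The product of a commuting family of operators over a finite set of parameters. -/
def opProd (B : ℂ → Module.End ℂ V) (hB : ∀ u v, Commute (B u) (B v)) (Y : Finset ℂ) :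
    Module.End ℂ V :=
  Y.noncommProd B fun _ _ _ _ _ => hB _ _

variable {B : ℂ → Module.End ℂ V} (hB : ∀ u v, Commute (B u) (B v))

@[simp] theorem opProd_empty : opProd B hB ∅ = 1 := Finset.noncommProd_empty _ _

theorem opProd_insert {u : ℂ} {Y : Finset ℂ} (hu : u ∉ Y) :
    opProd B hB (insert u Y) = B u * opProd B hB Y :=
  Finset.noncommProd_insert_of_notMem _ _ _ _ hu

theorem opProd_union {Y Z : Finset ℂ} (h : Disjoint Y Z) :
    opProd B hB (Y ∪ Z) = opProd B hB Y * opProd B hB Z :=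
  Finset.noncommProd_union_of_disjoint h _ _

theorem commute_opProd {X : Module.End ℂ V} (hX : ∀ u, Commute X (B u)) (Y : Finset ℂ) :
    Commute X (opProd B hB Y) :=
  Finset.noncommProd_commute _ _ _ _ fun u _ => hX u

/-- The action of an operator with exchange relation of parameter `c` on an off-shell state. -/
theorem exchange_opProd {O : ℂ → Module.End ℂ V} {c : ℂ}
    (hO : ∀ u v, u ≠ v → O u * B v =
      (1 + c / (u - v)) • (B v * O u) - (c / (u - v)) • (B u * O v))
    {v0 : V} {o : ℂ → ℂ} (ho : ∀ u, O u v0 = o u • v0) (Y : Finset ℂ) :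
    ∀ u ∉ Y, O u (opProd B hB Y v0) =
      (o u * ∏ y ∈ Y, (1 + c / (u - y))) • opProd B hB Y v0 -
      ∑ k ∈ Y, (o k * (c / (u - k)) * ∏ y ∈ Y.erase k, (1 + c / (k - y))) •
        B u (opProd B hB (Y.erase k) v0) := by
  induction Y using Finset.induction_on with
  | empty => intro u _; simp [ho]
  | insert w Y hw ih =>
    intro u hu
    rw [Finset.mem_insert, not_or] at hu
    obtain ⟨huw, huY⟩ := hu
    have e1 : O u (opProd B hB (insert w Y) v0) =
        (1 + c / (u - w)) • B w (O u (opProd B hB Y v0)) -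
          (c / (u - w)) • B u (O w (opProd B hB Y v0)) := by
      rw [opProd_insert hB hw]
      have := congrArg (fun X : Module.End ℂ V => X (opProd B hB Y v0)) (hO u w huw)
      simpa using this
    rw [e1, ih u huY, ih w hw, Finset.prod_insert hw, Finset.sum_insert hw,
      Finset.erase_insert hw, opProd_insert hB hw]
    have e2 : ∀ k ∈ Y, (o k * (c / (u - k)) * ∏ y ∈ (insert w Y).erase k, (1 + c / (k - y))) •
        B u (opProd B hB ((insert w Y).erase k) v0) =
        (o k * ((1 + c / (u - w)) * (c / (u - k)) - (c / (u - w)) * (c / (w - k))) *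
          ∏ y ∈ Y.erase k, (1 + c / (k - y))) • B w (B u (opProd B hB (Y.erase k) v0)) := by
      intro k hk
      have hkw : k ≠ w := fun h => hw (h ▸ hk)
      have huk : u ≠ k := fun h => huY (h ▸ hk)
      rw [Finset.erase_insert_of_ne hkw.symm,
        Finset.prod_insert (by simp [hw]), opProd_insert hB (by simp [hw])]
      have : B u ((B w * opProd B hB (Y.erase k)) v0) =
          B w (B u (opProd B hB (Y.erase k) v0)) := by
        have := congrArg (fun X : Module.End ℂ V => X (opProd B hB (Y.erase k) v0)) (hB u w).eq
        simpa using this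
      rw [this]
      congr 1
      have h1 := sub_ne_zero.mpr huk
      have h2 := sub_ne_zero.mpr huw
      have h3 := sub_ne_zero.mpr hkw
      have h4 := sub_ne_zero.mpr hkw.symm
      -- The unwanted term in which k is replaced by u arises in two ways, directly and through w;
      -- this partial-fraction identity merges them into one product.
      have : c / (u - k) * (1 + c / (k - w)) =
          (1 + c / (u - w)) * (c / (u - k)) - (c / (u - w)) * (c / (w - k)) := by
        field_simp
        ring
      rw [← this]; ring
    rw [Finset.sum_congr rfl e2]
    have e3 : ∀ x y : ℂ, ∀ z : V, B x (B y z) = B y (B x z) := by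
      intro x y z
      have := congrArg (fun X : Module.End ℂ V => X z) (hB x y).eq
      simpa using this
    simp only [map_sub, map_sum, map_smul, smul_sub, Finset.smul_sum, smul_smul,
      Module.End.mul_apply, e3 u w]
    have e4 : ∀ k ∈ Y, (o k * ((1 + c / (u - w)) * (c / (u - k)) - (c / (u - w)) * (c / (w - k))) *
          ∏ y ∈ Y.erase k, (1 + c / (k - y))) • B w (B u (opProd B hB (Y.erase k) v0)) =
        ((1 + c / (u - w)) * (o k * (c / (u - k)) * ∏ y ∈ Y.erase k, (1 + c / (k - y)))) •
            B w (B u (opProd B hB (Y.erase k) v0)) -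
          ((c / (u - w)) * (o k * (c / (w - k)) * ∏ y ∈ Y.erase k, (1 + c / (k - y)))) •
            B w (B u (opProd B hB (Y.erase k) v0)) := by
      intro k _
      rw [← sub_smul]; congr 1; ring
    rw [Finset.sum_congr rfl e4, Finset.sum_sub_distrib]
    module

end Families

/-! ### Splitting an off-shell state over two blocks of sites. -/

section Coproduct

theorem sum_powerset_sdiff_comm {α M : Type*} [DecidableEq α] [AddCommMonoid M] (Y : Finset α)
    (g : Finset α → α → M) :
    ∑ S ∈ Y.powerset, ∑ k ∈ Y \ S, g S k = ∑ S ∈ Y.powerset, ∑ k ∈ S, g (S.erase k) k := by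
  rw [Finset.sum_sigma', Finset.sum_sigma']
  refine Finset.sum_bij' (fun p _ => ⟨insert p.2 p.1, p.2⟩) (fun p _ => ⟨p.1.erase p.2, p.2⟩)
    ?_ ?_ ?_ ?_ ?_
  · rintro ⟨S, k⟩ h
    simp only [mem_sigma, mem_powerset, mem_sdiff] at h
    simpa [Finset.insert_subset_iff] using ⟨h.2.1, h.1⟩
  · rintro ⟨S, k⟩ h
    simp only [mem_sigma, mem_powerset] at h
    simpa using ⟨(erase_subset _ _).trans h.1, h.1 h.2⟩
  · rintro ⟨S, k⟩ h
    simp only [mem_sigma, mem_powerset, mem_sdiff] at h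
    simp [erase_insert h.2.2]
  · rintro ⟨S, k⟩ h
    simp only [mem_sigma, mem_powerset] at h
    simp [insert_erase h.2]
  · rintro ⟨S, k⟩ h
    simp only [mem_sigma, mem_powerset, mem_sdiff] at h
    simp [erase_insert h.2.2]

variable {V : Type*} [AddCommGroup V] [Module ℂ V]

theorem fFun_eq {η u v : ℂ} (h : u ≠ v) : fFun η u v = 1 + η / (u - v) := by
  have := sub_ne_zero.mpr h
  rw [fFun]; field_simp

theorem fFun_eq' {η u v : ℂ} (h : u ≠ v) : fFun η v u = 1 + -η / (u - v) := by
  have := sub_ne_zero.mpr h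
  have := sub_ne_zero.mpr h.symm
  rw [fFun]; field_simp; ring

/-- `f(S|T)` for finite sets of parameters. -/
def fS (η : ℂ) (S T : Finset ℂ) : ℂ := ∏ s ∈ S, ∏ t ∈ T, fFun η s t

theorem fS_insert_left {η u : ℂ} {S : Finset ℂ} (T : Finset ℂ) (hu : u ∉ S) :
    fS η (insert u S) T = fS η {u} T * fS η S T := by
  simp [fS, Finset.prod_insert hu]

theorem fS_insert_right {η u : ℂ} (S : Finset ℂ) {T : Finset ℂ} (hu : u ∉ T) :
    fS η S (insert u T) = fS η S {u} * fS η S T := by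
  simp [fS, Finset.prod_insert hu, Finset.prod_mul_distrib]

theorem fS_union_left {η : ℂ} {S S' : Finset ℂ} (T : Finset ℂ) (h : Disjoint S S') :
    fS η (S ∪ S') T = fS η S T * fS η S' T := by
  simp [fS, Finset.prod_union h]

theorem fS_union_right {η : ℂ} (T : Finset ℂ) {S S' : Finset ℂ} (h : Disjoint S S') :
    fS η T (S ∪ S') = fS η T S * fS η T S' := by
  simp [fS, Finset.prod_union h, Finset.prod_mul_distrib]

@[simp] theorem fS_empty_left (η : ℂ) (T : Finset ℂ) : fS η ∅ T = 1 := by simp [fS]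

@[simp] theorem fS_empty_right (η : ℂ) (T : Finset ℂ) : fS η T ∅ = 1 := by simp [fS]

theorem prod_fFun_left {η u : ℂ} {Y : Finset ℂ} (hu : u ∉ Y) :
    ∏ y ∈ Y, (1 + η / (u - y)) = fS η {u} Y := by
  simp only [fS, prod_singleton]
  exact prod_congr rfl fun y hy => (fFun_eq (ne_of_mem_of_not_mem hy hu).symm).symm

theorem prod_fFun_right {η u : ℂ} {Y : Finset ℂ} (hu : u ∉ Y) :
    ∏ y ∈ Y, (1 + -η / (u - y)) = fS η Y {u} := by
  simp only [fS, prod_singleton]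
  exact prod_congr rfl fun y hy => (fFun_eq' (ne_of_mem_of_not_mem hy hu).symm).symm

variable {η : ℂ} {T T1 T2 : ℂ → Matrix (Fin 2) (Fin 2) (Module.End ℂ V)} {v0 : V}

theorem RTT.D_opProd (h : RTT η T) (hB : ∀ u v, Commute (T u 0 1) (T v 0 1)) {d : ℂ → ℂ}
    (hd : ∀ u, T u 1 1 v0 = d u • v0) (Y : Finset ℂ) (u : ℂ) (hu : u ∉ Y) :
    T u 1 1 (opProd (fun u => T u 0 1) hB Y v0) =
      (d u * fS η {u} Y) • opProd (fun u => T u 0 1) hB Y v0 -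
      ∑ k ∈ Y, (d k * (η / (u - k)) * fS η {k} (Y.erase k)) •
        T u 0 1 (opProd (fun u => T u 0 1) hB (Y.erase k) v0) := by
  rw [exchange_opProd hB (O := fun u => T u 1 1) (fun u v huv => h.D_mul_B huv) hd Y u hu,
    prod_fFun_left hu]
  congr 1
  refine sum_congr rfl fun k _ => ?_
  rw [prod_fFun_left (by simp)]

theorem RTT.A_opProd (h : RTT η T) (hB : ∀ u v, Commute (T u 0 1) (T v 0 1)) {a : ℂ → ℂ}
    (ha : ∀ u, T u 0 0 v0 = a u • v0) (Y : Finset ℂ) (u : ℂ) (hu : u ∉ Y) :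
    T u 0 0 (opProd (fun u => T u 0 1) hB Y v0) =
      (a u * fS η Y {u}) • opProd (fun u => T u 0 1) hB Y v0 +
      ∑ k ∈ Y, (a k * (η / (u - k)) * fS η (Y.erase k) {k}) •
        T u 0 1 (opProd (fun u => T u 0 1) hB (Y.erase k) v0) := by
  rw [exchange_opProd hB (O := fun u => T u 0 0) (fun u v huv => h.A_mul_B huv) ha Y u hu,
    prod_fFun_right hu, sub_eq_add_neg, ← sum_neg_distrib]
  congr 1
  refine sum_congr rfl fun k _ => ?_
  rw [prod_fFun_right (by simp), ← neg_smul]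
  congr 1; ring

/-- Decomposition of an off-shell state of a two-component monodromy matrix. -/
theorem coproduct (h2 : RTT η T2) (h1 : RTT η T1)
    (hc : ∀ u v i j k l, Commute (T2 u i j) (T1 v k l)) {a2 d1 : ℂ → ℂ}
    (ha : ∀ u, T2 u 0 0 v0 = a2 u • v0) (hd : ∀ u, T1 u 1 1 v0 = d1 u • v0)
    (hB2 : ∀ u v, Commute (T2 u 0 1) (T2 v 0 1)) (hB1 : ∀ u v, Commute (T1 u 0 1) (T1 v 0 1))
    (hB : ∀ u v, Commute ((T2 u * T1 u) 0 1) ((T2 v * T1 v) 0 1)) (Y : Finset ℂ) :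
    opProd (fun u => (T2 u * T1 u) 0 1) hB Y v0 =
      ∑ S ∈ Y.powerset, ((∏ s ∈ S, a2 s) * (∏ t ∈ Y \ S, d1 t) * fS η (Y \ S) S) •
        opProd (fun u => T1 u 0 1) hB1 S (opProd (fun u => T2 u 0 1) hB2 (Y \ S) v0) := by
  have happ : ∀ {X Z : Module.End ℂ V}, Commute X Z → ∀ w, X (Z w) = Z (X w) := by
    intro X Z h w
    exact congrArg (fun X : Module.End ℂ V => X w) h.eq
  set b1 : Finset ℂ → Module.End ℂ V := opProd (fun u => T1 u 0 1) hB1 with hb1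
  set b2 : Finset ℂ → Module.End ℂ V := opProd (fun u => T2 u 0 1) hB2 with hb2
  have c1 : ∀ u i j S, Commute (T2 u i j) (b1 S) := fun u i j S =>
    commute_opProd hB1 (fun v => hc u v i j 0 1) S
  have c2 : ∀ u i j S, Commute (T1 u i j) (b2 S) := fun u i j S =>
    commute_opProd hB2 (fun v => (hc v u 0 1 i j).symm) S
  have c12 : ∀ S S', Commute (b1 S) (b2 S') := fun S S' =>
    commute_opProd hB2 (fun v => (c1 v 0 1 S).symm) S'
  induction Y using Finset.induction_on with
  | empty => simp [b1, b2]
  | insert u Y hu ih =>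
    have step : ∀ S ∈ Y.powerset, ((T2 u * T1 u) 0 1) (b1 S (b2 (Y \ S) v0)) =
        (a2 u * fS η (Y \ S) {u}) • b1 (insert u S) (b2 (Y \ S) v0) +
        (d1 u * fS η {u} S) • b1 S (b2 (insert u (Y \ S)) v0) +
        (∑ k ∈ Y \ S, (a2 k * (η / (u - k)) * fS η ((Y \ S).erase k) {k}) •
            b1 (insert u S) (b2 (insert u ((Y \ S).erase k)) v0) -
          ∑ k ∈ S, (d1 k * (η / (u - k)) * fS η {k} (S.erase k)) •
            b1 (insert u (S.erase k)) (b2 (insert u (Y \ S)) v0)) := by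
      intro S hS
      have hS' := mem_powerset.mp hS
      have huS : u ∉ S := fun h => hu (hS' h)
      have huT : u ∉ Y \ S := fun h => hu (mem_sdiff.mp h).1
      have huS' : ∀ k, u ∉ S.erase k := fun k h => huS (mem_of_mem_erase h)
      have huT' : ∀ k, u ∉ (Y \ S).erase k := fun k h => huT (mem_of_mem_erase h)
      have i1 : ∀ S, u ∉ S → b1 (insert u S) = T1 u 0 1 * b1 S := fun S h => opProd_insert hB1 h
      have i2 : ∀ S, u ∉ S → b2 (insert u S) = T2 u 0 1 * b2 S := fun S h => opProd_insert hB2 h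
      -- The upper right entry of the product is A₂B₁ + B₂D₁. Operators of different blocks commute,
      -- so A₂ and D₁ can be brought to act on the state of their own block.
      have e1 : ((T2 u * T1 u) 0 1) (b1 S (b2 (Y \ S) v0)) =
          T1 u 0 1 (b1 S (T2 u 0 0 (b2 (Y \ S) v0))) +
            b2 (Y \ S) (T2 u 0 1 (T1 u 1 1 (b1 S v0))) := by
        rw [Matrix.mul_apply, Fin.sum_univ_two]
        simp only [LinearMap.add_apply, Module.End.mul_apply]
        rw [happ (hc u u 0 0 0 1), happ (c1 u 0 0 S), happ (c12 S (Y \ S)), happ (c2 u 1 1 (Y \ S)),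
          happ (commute_opProd hB2 (hB2 u) (Y \ S) : Commute (T2 u 0 1) (b2 (Y \ S)))]
      rw [e1, h2.A_opProd hB2 ha _ u huT, h1.D_opProd hB1 hd _ u huS, i1 S huS]
      have e2 : ∀ k, b1 (insert u S) (b2 (insert u ((Y \ S).erase k)) v0) =
          T1 u 0 1 (b1 S (T2 u 0 1 (b2 ((Y \ S).erase k) v0))) := by
        intro k; rw [i1 S huS, i2 _ (huT' k)]; rfl
      have e3 : ∀ k, b1 (insert u (S.erase k)) (b2 (insert u (Y \ S)) v0) =
          b2 (Y \ S) (T2 u 0 1 (T1 u 0 1 (b1 (S.erase k) v0))) := by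
        intro k
        rw [happ (c12 _ _), i1 _ (huS' k), i2 _ huT,
          commute_opProd hB2 (hB2 u) (Y \ S) |> fun h : Commute (T2 u 0 1) (b2 (Y \ S)) => h.eq]
        rfl
      have e4 : b1 S (b2 (insert u (Y \ S)) v0) = b2 (Y \ S) (T2 u 0 1 (b1 S v0)) := by
        rw [happ (c12 _ _), i2 _ huT,
          commute_opProd hB2 (hB2 u) (Y \ S) |> fun h : Commute (T2 u 0 1) (b2 (Y \ S)) => h.eq]
        rfl
      simp only [← i1 S huS, e2, e3, e4, map_add, map_sub, map_sum, map_smul]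
      simp only [i1 S huS, Module.End.mul_apply]
      simp only [hb1, hb2]
      abel
    have i1 := opProd_insert hB hu
    rw [i1, Module.End.mul_apply, ih, map_sum, sum_powerset_insert hu, ← sum_add_distrib]
    simp only [map_smul]
    rw [sum_congr rfl fun S hS => congrArg _ (step S hS)]
    simp only [smul_add, smul_sub, sum_add_distrib, sum_sub_distrib, smul_sum, smul_smul]
    -- An unwanted term of A₂ takes k out of the second block and puts u into both blocks. The same
    -- state comes from an unwanted term of D₁ for the partition with k moved to the first block, so
    -- reindexing makes the two families cancel.
    have cancel := sum_powerset_sdiff_comm Y fun S k =>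
      ((∏ s ∈ S, a2 s) * (∏ t ∈ Y \ S, d1 t) * fS η (Y \ S) S *
        (a2 k * (η / (u - k)) * fS η ((Y \ S).erase k) {k})) •
            b1 (insert u S) (b2 (insert u ((Y \ S).erase k)) v0)
    rw [cancel, sub_eq_zero.mpr, add_zero, add_comm]
    · congr 1
      · refine sum_congr rfl fun S hS => ?_
        have hS' := mem_powerset.mp hS
        have huS : u ∉ S := fun h => hu (hS' h)
        have huT : u ∉ Y \ S := fun h => hu (mem_sdiff.mp h).1
        rw [insert_sdiff_of_notMem _ huS, prod_insert huT, fS_insert_left _ huT]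
        congr 1; ring
      · refine sum_congr rfl fun S hS => ?_
        have hS' := mem_powerset.mp hS
        have huS : u ∉ S := fun h => hu (hS' h)
        have : insert u Y \ insert u S = Y \ S := by
          rw [insert_sdiff_insert, sdiff_insert_of_notMem hu]
        rw [this, prod_insert huS, fS_insert_right _ huS]
        congr 1; ring
    · refine sum_congr rfl fun S hS => sum_congr rfl fun k hk => ?_
      have hS' := mem_powerset.mp hS
      have hkY := hS' hk
      have e1 : Y \ S.erase k = insert k (Y \ S) := by
        rw [sdiff_erase hkY]
      have hkT : k ∉ Y \ S := fun h => (mem_sdiff.mp h).2 hk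
      have e2 : fS η (Y \ S) S = fS η (Y \ S) {k} * fS η (Y \ S) (S.erase k) := by
        rw [← fS_insert_right _ (notMem_erase k S), insert_erase hk]
      have e3 : ∏ s ∈ S, a2 s = a2 k * ∏ s ∈ S.erase k, a2 s := (mul_prod_erase _ _ hk).symm
      rw [e1, erase_insert hkT, prod_insert hkT, fS_insert_left _ hkT, e2, e3]
      congr 1; ring

end Coproduct

/-! ### Polynomial functions with degree bounds and Lagrange interpolation. -/

section PolynomialFunctions

/-- `F` is a polynomial function of degree at most `d`. -/
def IsPoly (d : ℕ) (F : ℂ → ℂ) : Prop :=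
  ∃ p : Polynomial ℂ, p.natDegree ≤ d ∧ ∀ u, F u = p.eval u

namespace IsPoly

theorem const (d : ℕ) (c : ℂ) : IsPoly d fun _ => c :=
  ⟨Polynomial.C c, by simp, by simp⟩

theorem mono {d d' : ℕ} {F : ℂ → ℂ} (h : IsPoly d F) (hd : d ≤ d') : IsPoly d' F := by
  obtain ⟨p, hp, e⟩ := h
  exact ⟨p, hp.trans hd, e⟩

theorem congr {d : ℕ} {F G : ℂ → ℂ} (h : IsPoly d F) (e : ∀ u, G u = F u) : IsPoly d G := by
  rwa [show G = F from funext e]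

theorem id : IsPoly 1 fun u => u := ⟨Polynomial.X, by simp, by simp⟩

theorem add {d : ℕ} {F G : ℂ → ℂ} (hF : IsPoly d F) (hG : IsPoly d G) :
    IsPoly d fun u => F u + G u := by
  obtain ⟨p, hp, e⟩ := hF
  obtain ⟨q, hq, e'⟩ := hG
  exact ⟨p + q, Polynomial.natDegree_add_le_of_degree_le hp hq, by simp [e, e']⟩

theorem sum {ι : Type*} {d : ℕ} (s : Finset ι) {F : ι → ℂ → ℂ} (h : ∀ i ∈ s, IsPoly d (F i)) :
    IsPoly d fun u => ∑ i ∈ s, F i u := by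
  classical
  induction s using Finset.induction_on with
  | empty => simpa using const d 0
  | insert a s ha ih =>
    simp only [sum_insert ha]
    exact (h a (mem_insert_self _ _)).add (ih fun i hi => h i (mem_insert_of_mem hi))

theorem mul {d d' : ℕ} {F G : ℂ → ℂ} (hF : IsPoly d F) (hG : IsPoly d' G) :
    IsPoly (d + d') fun u => F u * G u := by
  obtain ⟨p, hp, e⟩ := hF
  obtain ⟨q, hq, e'⟩ := hG
  exact ⟨p * q, Polynomial.natDegree_mul_le.trans (add_le_add hp hq), by simp [e, e']⟩

theorem const_mul {d : ℕ} {F : ℂ → ℂ} (c : ℂ) (hF : IsPoly d F) : IsPoly d fun u => c * F u := by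
  simpa using (const 0 c).mul hF

theorem mul_const {d : ℕ} {F : ℂ → ℂ} (hF : IsPoly d F) (c : ℂ) : IsPoly d fun u => F u * c := by
  simpa using hF.mul (const 0 c)

theorem prod {ι : Type*} (s : Finset ι) {F : ι → ℂ → ℂ} (h : ∀ i ∈ s, IsPoly 1 (F i)) :
    IsPoly s.card fun u => ∏ i ∈ s, F i u := by
  classical
  induction s using Finset.induction_on with
  | empty => simpa using const 0 1
  | insert a s ha ih =>
    simp only [prod_insert ha, card_insert_of_notMem ha, add_comm s.card]
    exact (h a (mem_insert_self _ _)).mul (ih fun i hi => h i (mem_insert_of_mem hi))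

theorem lagrange {d : ℕ} {P : ℂ → ℂ} (h : IsPoly d P) {S : Finset ℂ} (hd : d < S.card) (t : ℂ) :
    P t = ∑ b ∈ S, P b * ∏ b' ∈ S.erase b, (t - b') / (b - b') := by
  obtain ⟨p, hp, e⟩ := h
  have hdeg : p.degree < S.card :=
    lt_of_le_of_lt Polynomial.degree_le_natDegree (by exact_mod_cast hp.trans_lt hd)
  have h1 := Lagrange.eq_interpolate (s := S) (v := fun x => x) (f := p)
    (fun a _ b _ h => h) hdeg
  have h2 := congrArg (Polynomial.eval t) h1
  rw [Lagrange.interpolate_apply, Polynomial.eval_finsetSum] at h2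
  rw [e, h2]
  refine sum_congr rfl fun b _ => ?_
  rw [Polynomial.eval_mul, Polynomial.eval_C, e, Lagrange.basis, Polynomial.eval_prod]
  congr 1
  refine prod_congr rfl fun b' _ => ?_
  simp [Lagrange.basisDivisor]
  ring

theorem eq_of_eval_eq {d : ℕ} {P Q : ℂ → ℂ} (hP : IsPoly d P) (hQ : IsPoly d Q) {S : Finset ℂ}
    (hd : d < S.card) (h : ∀ b ∈ S, P b = Q b) (t : ℂ) : P t = Q t := by
  rw [hP.lagrange hd, hQ.lagrange hd]
  exact sum_congr rfl fun b hb => by rw [h b hb]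

/-- Lagrange interpolation when the values at the nodes of `A` vanish. -/
theorem lagrange_of_zeros {d : ℕ} {P : ℂ → ℂ} (h : IsPoly d P) {A B : Finset ℂ}
    (hAB : Disjoint A B) (hd : d < A.card + B.card) (h0 : ∀ a ∈ A, P a = 0) (t : ℂ) :
    P t = ∑ b ∈ B, P b * ((∏ a ∈ A, (t - a) / (b - a)) * ∏ b' ∈ B.erase b, (t - b') / (b - b')) := by
  rw [h.lagrange (S := A ∪ B) (by rwa [card_union_of_disjoint hAB]), sum_union hAB,
    sum_eq_zero fun a ha => by rw [h0 a ha, zero_mul], zero_add]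
  refine sum_congr rfl fun b hb => ?_
  have hbA : b ∉ A := fun h => disjoint_left.mp hAB h hb
  rw [erase_union_distrib, erase_eq_of_notMem hbA,
    prod_union (hAB.mono_right (erase_subset _ _))]

end IsPoly

end PolynomialFunctions

/-! ### Determinants divided by Vandermonde products, as functions of finite sets. -/

section NormalizedDeterminant

variable {n : ℕ}

/-- The Vandermonde product of a family. -/
def vdm (x : Fin n → ℂ) : ℂ := ∏ i, ∏ j ∈ Iio i, (x i - x j)

theorem vdm_eq_det (x : Fin n → ℂ) : vdm x = (Matrix.vandermonde x).det := by
  rw [Matrix.det_vandermonde, vdm]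
  exact Finset.prod_comm' (by simp)

theorem vdm_perm (x : Fin n → ℂ) (σ : Equiv.Perm (Fin n)) :
    vdm (x ∘ σ) = (Equiv.Perm.sign σ : ℤ) * vdm x := by
  rw [vdm_eq_det, vdm_eq_det, ← Matrix.det_permute]
  rfl

theorem vdm_cons (t : ℂ) (x : Fin n → ℂ) :
    vdm (Fin.cons t x : Fin (n + 1) → ℂ) = (∏ l, (x l - t)) * vdm x := by
  rw [vdm_eq_det, vdm_eq_det, Matrix.det_vandermonde, Matrix.det_vandermonde, Fin.prod_univ_succ,
    Fin.prod_Ioi_zero]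
  simp [Fin.prod_Ioi_succ]

theorem vdm_succAbove (x : Fin (n + 1) → ℂ) (p : Fin (n + 1)) :
    vdm x = (-1) ^ (p : ℕ) * ((∏ l, (x (p.succAbove l) - x p)) * vdm (x ∘ p.succAbove)) := by
  have e := vdm_cons (x p) (x ∘ p.succAbove)
  simp only [Function.comp_apply] at e
  rw [show x ∘ p.succAbove = fun l => x (p.succAbove l) from rfl] at e ⊢
  rw [← e]
  -- Bringing the entry p to the front is the inverse of a cycle of p + 1 elements, whose sign is
  -- (-1)^p.
  have : (Fin.cons (x p) (fun l => x (p.succAbove l)) : Fin (n + 1) → ℂ) = x ∘ (p.cycleRange.symm) := by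
    funext i
    refine Fin.cases ?_ (fun i => ?_) i
    · simp
    · simp
  rw [this, vdm_perm, Equiv.Perm.sign_symm, Fin.sign_cycleRange]
  push_cast
  rw [← mul_assoc, ← mul_pow]
  simp

theorem vdm_ne_zero {x : Fin n → ℂ} (hx : Function.Injective x) : vdm x ≠ 0 := by
  rw [vdm_eq_det]; exact Matrix.det_vandermonde_ne_zero_iff.mpr hx

/-- The determinant of `ent (y j) (x k)`, divided by the two Vandermonde products. -/
def normDet (ent : ℂ → ℂ → ℂ) (x y : Fin n → ℂ) : ℂ :=
  (Matrix.of fun j k => ent (y j) (x k)).det / (vdm x * vdm (-y))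

/-- A permutation of the rows or of the columns gives the determinant and the corresponding
Vandermonde product the same sign. The quotient therefore depends only on the underlying sets, which
makes induction over finite sets possible. -/
theorem normDet_perm (ent : ℂ → ℂ → ℂ) (x y : Fin n → ℂ) (σ τ : Equiv.Perm (Fin n)) :
    normDet ent (x ∘ σ) (y ∘ τ) = normDet ent x y := by
  have h1 : (Matrix.of fun j k => ent ((y ∘ τ) j) ((x ∘ σ) k)) =
      ((Matrix.of fun j k => ent (y j) (x k)).submatrix τ id).submatrix id σ := rfl
  have h2 : -(y ∘ τ) = (-y) ∘ τ := rfl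
  rw [normDet, normDet, h1, Matrix.det_permute', Matrix.det_permute, h2, vdm_perm, vdm_perm]
  have hs : ∀ σ : Equiv.Perm (Fin n), (((Equiv.Perm.sign σ : ℤˣ) : ℤ) : ℂ) ≠ 0 := by
    intro σ; simp
  rw [show ∀ a b c d e : ℂ, a * (b * c) / (a * d * (b * e)) = (a * b * c) / (a * b * (d * e)) by
    intros; ring]
  exact mul_div_mul_left _ _ (mul_ne_zero (hs σ) (hs τ))

theorem exists_perm_of_image_eq {x x' : Fin n → ℂ} (hx : Function.Injective x)
    (hx' : Function.Injective x') (h : univ.image x = univ.image x') :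
    ∃ σ : Equiv.Perm (Fin n), x' = x ∘ σ := by
  have h' : Set.range x' = Set.range x := by
    have := congrArg (fun s : Finset ℂ => (s : Set ℂ)) h
    simpa using this.symm
  refine ⟨((Equiv.ofInjective x' hx').trans (Equiv.setCongr h')).trans
    (Equiv.ofInjective x hx).symm, ?_⟩
  funext i
  simp [Equiv.apply_ofInjective_symm]

/-- The normalized determinant for finite sets `K` (columns) and `J` (rows) of parameters; it is
zero when they have different cardinalities. -/
def normDetSet (ent : ℂ → ℂ → ℂ) (K J : Finset ℂ) : ℂ := by
  classical exact
  if h : ∃ p : Σ n, (Fin n → ℂ) × (Fin n → ℂ), Function.Injective p.2.1 ∧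
      Function.Injective p.2.2 ∧ univ.image p.2.1 = K ∧ univ.image p.2.2 = J
  then normDet ent h.choose.2.1 h.choose.2.2 else 0

theorem normDetSet_eq (ent : ℂ → ℂ → ℂ) {x y : Fin n → ℂ} (hx : Function.Injective x)
    (hy : Function.Injective y) {K J : Finset ℂ} (hK : univ.image x = K) (hJ : univ.image y = J) :
    normDetSet ent K J = normDet ent x y := by
  have h : ∃ p : Σ n, (Fin n → ℂ) × (Fin n → ℂ), Function.Injective p.2.1 ∧
      Function.Injective p.2.2 ∧ univ.image p.2.1 = K ∧ univ.image p.2.2 = J :=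
    ⟨⟨n, x, y⟩, hx, hy, hK, hJ⟩
  rw [normDetSet, dif_pos h]
  obtain ⟨h1, h2, h3, h4⟩ := h.choose_spec
  generalize h.choose = p at h1 h2 h3 h4
  obtain ⟨n', x', y'⟩ := p
  have hn : n' = n := by
    have := congrArg card (h3.trans hK.symm)
    rw [card_image_of_injective _ h1, card_image_of_injective _ hx] at this
    simpa using this
  subst hn
  obtain ⟨σ, hσ⟩ := exists_perm_of_image_eq hx h1 (hK.trans h3.symm)
  obtain ⟨τ, hτ⟩ := exists_perm_of_image_eq hy h2 (hJ.trans h4.symm)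
  simp only at hσ hτ ⊢
  rw [hσ, hτ, normDet_perm]

theorem normDetSet_of_card_ne (ent : ℂ → ℂ → ℂ) {K J : Finset ℂ} (h : K.card ≠ J.card) :
    normDetSet ent K J = 0 := by
  rw [normDetSet, dif_neg]
  rintro ⟨⟨n, x, y⟩, h1, h2, rfl, rfl⟩
  apply h
  simp [card_image_of_injective _ h1, card_image_of_injective _ h2]

theorem exists_enum (K : Finset ℂ) (h : K.card = n) :
    ∃ x : Fin n → ℂ, Function.Injective x ∧ univ.image x = K := by
  subst h
  refine ⟨fun i => K.equivFin.symm i, fun i j h => K.equivFin.symm.injective (Subtype.ext h), ?_⟩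
  ext a
  simp only [mem_image, mem_univ, true_and]
  constructor
  · rintro ⟨i, rfl⟩; exact (K.equivFin.symm i).2
  · intro ha; exact ⟨K.equivFin ⟨a, ha⟩, by simp⟩

theorem normDetSet_congr {ent ent' : ℂ → ℂ → ℂ} {K J : Finset ℂ}
    (h : ∀ y ∈ J, ∀ x ∈ K, ent y x = ent' y x) : normDetSet ent K J = normDetSet ent' K J := by
  by_cases hc : K.card = J.card
  · obtain ⟨x, hx, hK⟩ := exists_enum K hc
    obtain ⟨y, hy, hJ⟩ := exists_enum J rfl
    rw [normDetSet_eq _ hx hy hK hJ, normDetSet_eq _ hx hy hK hJ, normDet, normDet]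
    congr 2
    ext j k
    exact h _ (hJ ▸ mem_image_of_mem _ (mem_univ j)) _ (hK ▸ mem_image_of_mem _ (mem_univ k))
  · rw [normDetSet_of_card_ne _ hc, normDetSet_of_card_ne _ hc]

theorem normDetSet_row_mul (c : ℂ → ℂ) (ent : ℂ → ℂ → ℂ) (K J : Finset ℂ) :
    normDetSet (fun y x => c y * ent y x) K J = (∏ y ∈ J, c y) * normDetSet ent K J := by
  by_cases hc : K.card = J.card
  · obtain ⟨x, hx, hK⟩ := exists_enum K hc
    obtain ⟨y, hy, hJ⟩ := exists_enum J rfl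
    rw [normDetSet_eq _ hx hy hK hJ, normDetSet_eq _ hx hy hK hJ, normDet, normDet, ← mul_div_assoc]
    congr 1
    have := Matrix.det_mul_column (fun j => c (y j)) (Matrix.of fun j k => ent (y j) (x k))
    have e : ∏ y ∈ univ.image y, c y = ∏ j, c (y j) := prod_image fun _ _ _ _ h => hy h
    rw [hJ] at e
    rw [e, ← this]
    rfl
  · rw [normDetSet_of_card_ne _ hc, normDetSet_of_card_ne _ hc, mul_zero]

theorem normDetSet_swap (ent : ℂ → ℂ → ℂ) (K J : Finset ℂ) :
    normDetSet (fun y x => ent x y) J K = normDetSet ent K J := by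
  by_cases hc : K.card = J.card
  · obtain ⟨x, hx, hK⟩ := exists_enum K hc
    obtain ⟨y, hy, hJ⟩ := exists_enum J rfl
    rw [normDetSet_eq _ hx hy hK hJ, normDetSet_eq _ hy hx hJ hK, normDet, normDet,
      ← Matrix.det_transpose]
    have hv : ∀ z : Fin J.card → ℂ, vdm (-z) = (∏ i : Fin J.card, ∏ _j ∈ Iio i, (-1 : ℂ)) * vdm z := by
      intro z
      rw [vdm, vdm, ← prod_mul_distrib]
      refine prod_congr rfl fun i _ => ?_
      rw [← prod_mul_distrib]
      refine prod_congr rfl fun j _ => ?_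
      simp only [Pi.neg_apply]; ring
    rw [hv x, hv y]
    congr 1
    ring
  · rw [normDetSet_of_card_ne _ hc, normDetSet_of_card_ne _ (Ne.symm hc)]

/-- Sum over the rows of the products of the entries of a column `t` with the complementary
normalized determinants. -/
def colSum (ent : ℂ → ℂ → ℂ) (t : ℂ) (K J : Finset ℂ) : ℂ :=
  ∑ y ∈ J, ent y t * (∏ y' ∈ J.erase y, (y' - y))⁻¹ * normDetSet ent K (J.erase y)

theorem image_succAbove {y : Fin (n + 1) → ℂ} (hy : Function.Injective y) (j : Fin (n + 1)) :
    univ.image (y ∘ j.succAbove) = (univ.image y).erase (y j) := by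
  ext a
  simp only [mem_image, mem_univ, true_and, mem_erase, Function.comp_apply]
  constructor
  · rintro ⟨i, rfl⟩
    exact ⟨fun h => Fin.succAbove_ne j i (hy h), _, rfl⟩
  · rintro ⟨h, i, rfl⟩
    obtain ⟨k, hk⟩ := Fin.exists_succAbove_eq (x := i) (y := j) (fun e => h (by rw [e]))
    exact ⟨k, by rw [hk]⟩

/-- Laplace expansion along the column of t. The alternating sign is absorbed by the Vandermonde
product of the rows; the global (-1)^n remains because that product is taken at -y. The Vandermonde
factors of t itself are left out, so t may coincide with a point of x. -/
theorem colSum_eq_det (ent : ℂ → ℂ → ℂ) (t : ℂ) {x : Fin n → ℂ} {y : Fin (n + 1) → ℂ}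
    (hx : Function.Injective x) (hy : Function.Injective y) :
    colSum ent t (univ.image x) (univ.image y) =
      (-1) ^ n * (Matrix.of fun j k => ent (y j) ((Fin.cons t x : Fin (n + 1) → ℂ) k)).det /
        (vdm x * vdm (-y)) := by
  rw [colSum, sum_image fun _ _ _ _ h => hy h, Matrix.det_succ_column_zero, mul_sum, sum_div]
  refine sum_congr rfl fun j _ => ?_
  have hyj : Function.Injective (y ∘ j.succAbove) := hy.comp Fin.succAbove_right_injective
  rw [normDetSet_eq ent hx hyj rfl (image_succAbove hy j), normDet,
    ← image_succAbove hy j, prod_image fun _ _ _ _ h => hyj h]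
  have h1 := vdm_succAbove (-y) j
  have h2 : ∏ l, ((-y) (j.succAbove l) - (-y) j) = (-1) ^ n * ∏ l, (y (j.succAbove l) - y j) := by
    rw [show ((-1 : ℂ)) ^ n = ∏ _l : Fin n, (-1) by simp, ← prod_mul_distrib]
    refine prod_congr rfl fun l _ => ?_
    simp only [Pi.neg_apply]; ring
  have h3 : (-y) ∘ j.succAbove = -(y ∘ j.succAbove) := rfl
  rw [h2, h3] at h1
  have hP : ∏ l, (y (j.succAbove l) - y j) ≠ 0 :=
    prod_ne_zero_iff.mpr fun l _ => sub_ne_zero.mpr fun h => Fin.succAbove_ne j l (hy h)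
  have hv : vdm (-(y ∘ j.succAbove)) ≠ 0 := vdm_ne_zero (neg_injective.comp hyj)
  have hvx : vdm x ≠ 0 := vdm_ne_zero hx
  rw [h1]
  have hs : ((-1 : ℂ)) ^ n ≠ 0 := pow_ne_zero _ (by norm_num)
  have hs' : ((-1 : ℂ)) ^ (j : ℕ) ≠ 0 := pow_ne_zero _ (by norm_num)
  have hm : (Matrix.of fun a k => ent ((y ∘ j.succAbove) a) (x k)) =
      (Matrix.of fun j k => ent (y j) ((Fin.cons t x : Fin (n + 1) → ℂ) k)).submatrix
        j.succAbove Fin.succ := by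
    ext a b; simp
  simp only [Function.comp_apply] at hm ⊢
  rw [hm, Matrix.of_apply, Fin.cons_zero]
  field_simp

theorem normDetSet_insert (ent : ℂ → ℂ → ℂ) {t : ℂ} {K : Finset ℂ} (ht : t ∉ K) (J : Finset ℂ) :
    normDetSet ent (insert t K) J = (∏ x ∈ K, (t - x))⁻¹ * colSum ent t K J := by
  by_cases hc : (insert t K).card = J.card
  · rw [card_insert_of_notMem ht] at hc
    obtain ⟨x, hx, hK⟩ := exists_enum K rfl
    obtain ⟨y, hy, hJ⟩ := exists_enum J hc.symm
    have hx' : Function.Injective (Fin.cons t x : Fin (K.card + 1) → ℂ) := by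
      rw [Fin.cons_injective_iff]
      refine ⟨?_, hx⟩
      rintro ⟨i, rfl⟩
      exact ht (hK ▸ mem_image_of_mem _ (mem_univ i))
    have hK' : univ.image (Fin.cons t x : Fin (K.card + 1) → ℂ) = insert t K := by
      conv_rhs => rw [← hK]
      ext a
      simp [Fin.exists_fin_succ, eq_comm]
    rw [normDetSet_eq ent hx' hy hK' hJ, normDet, vdm_cons]
    conv_rhs => rw [← hJ]
    rw [show colSum ent t K = colSum ent t (univ.image x) by rw [hK], colSum_eq_det ent t hx hy]
    have h2 : ∏ l, (x l - t) = (-1) ^ K.card * ∏ x ∈ K, (t - x) := by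
      conv_rhs => rw [← hK]
      rw [prod_image fun _ _ _ _ h => hx h, hK,
        show ((-1 : ℂ)) ^ K.card = ∏ _l : Fin K.card, (-1) by simp, ← prod_mul_distrib]
      exact prod_congr rfl fun l _ => by ring
    have hs : ((-1 : ℂ)) ^ K.card * (-1) ^ K.card = 1 := by rw [← mul_pow]; simp
    have hs' : ((-1 : ℂ)) ^ K.card ≠ 0 := pow_ne_zero _ (by norm_num)
    rw [h2, div_eq_mul_inv, div_eq_mul_inv, mul_inv, mul_inv, mul_inv, mul_inv,
      inv_eq_of_mul_eq_one_left hs]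
    ring
  · rw [normDetSet_of_card_ne _ hc, colSum, sum_eq_zero, mul_zero]
    intro y hy
    rw [normDetSet_of_card_ne, mul_zero]
    intro h
    rw [card_erase_of_mem hy] at h
    apply hc
    rw [card_insert_of_notMem ht, h]
    have := card_pos.mpr ⟨y, hy⟩
    omega

theorem colSum_eq_zero (ent : ℂ → ℂ → ℂ) {t t' : ℂ} {K : Finset ℂ} (ht : t' ∈ K) {J : Finset ℂ}
    (h : ∀ y ∈ J, ent y t = ent y t') : colSum ent t K J = 0 := by
  by_cases hc : K.card + 1 = J.card
  · obtain ⟨x, hx, hK⟩ := exists_enum K rfl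
    obtain ⟨y, hy, hJ⟩ := exists_enum J hc.symm
    rw [show colSum ent t K J = colSum ent t (univ.image x) (univ.image y) by rw [hK, hJ],
      colSum_eq_det ent t hx hy]
    rw [← hK] at ht
    obtain ⟨l, -, hl⟩ := mem_image.mp ht
    rw [Matrix.det_zero_of_column_eq (i := 0) (j := l.succ) (Fin.succ_ne_zero l).symm]
    · simp
    · intro k
      simp only [Matrix.of_apply, Fin.cons_zero, Fin.cons_succ, hl]
      exact h _ (hJ ▸ mem_image_of_mem _ (mem_univ k))
  · rw [colSum, sum_eq_zero]
    intro y hy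
    rw [normDetSet_of_card_ne, mul_zero]
    intro h
    rw [card_erase_of_mem hy] at h
    apply hc
    have := card_pos.mpr ⟨y, hy⟩
    omega

/-- Each Laplace expansion peels off one column, which contributes one degree; the Vandermonde
factors do not depend on the variable. -/
theorem IsPoly.normDetSet {ent : ℂ → ℂ → ℂ → ℂ} (K : Finset ℂ) :
    ∀ J : Finset ℂ, (∀ y ∈ J, ∀ x ∈ K, IsPoly 1 fun t => ent t y x) →
      IsPoly K.card fun t => normDetSet (ent t) K J := by
  induction K using Finset.induction_on with
  | empty =>
    intro J _
    exact (IsPoly.const _ (OpenXXX.normDetSet (fun _ _ => 0) ∅ J)).congr fun t =>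
      normDetSet_congr (by simp)
  | insert a K ha ih =>
    intro J h
    simp only [normDetSet_insert _ ha, colSum, card_insert_of_notMem ha]
    refine IsPoly.const_mul _ (IsPoly.sum _ fun y hy => ?_)
    rw [add_comm]
    refine ((h y hy a (mem_insert_self _ _)).mul_const _).mul (ih _ fun y' hy' x hx => ?_)
    exact h y' (mem_of_mem_erase hy') x (mem_insert_of_mem hx)

end NormalizedDeterminant

/-! ### The determinant coefficients: pole expansion and duality. -/

section Coefficients

/-- Genericity of a set `U` of inhomogeneities and a set `Y` of spectral parameters. -/
structure Gen (η : ℂ) (U Y : Finset ℂ) : Prop where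
  ne : ∀ x ∈ U, ∀ y ∈ Y, x ≠ y
  add : ∀ x ∈ U, ∀ y ∈ Y, x - y + η ≠ 0
  add' : ∀ x ∈ U, ∀ y ∈ Y, y - x + η ≠ 0
  left : ∀ x ∈ U, ∀ x' ∈ U, x ≠ x' → x - x' + η ≠ 0
  right : ∀ y ∈ Y, ∀ y' ∈ Y, y ≠ y' → y - y' + η ≠ 0

theorem Gen.mono {η : ℂ} {U Y U' Y' : Finset ℂ} (h : Gen η U Y) (hU : U' ⊆ U) (hY : Y' ⊆ Y) :
    Gen η U' Y' :=
  ⟨fun x hx y hy => h.ne x (hU hx) y (hY hy), fun x hx y hy => h.add x (hU hx) y (hY hy),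
    fun x hx y hy => h.add' x (hU hx) y (hY hy),
    fun x hx y hy => h.left x (hU hx) y (hU hy), fun x hx y hy => h.right x (hY hx) y (hY hy)⟩

theorem Gen.symm {η : ℂ} {U Y : Finset ℂ} (h : Gen η U Y) : Gen η Y U :=
  ⟨fun x hx y hy => (h.ne y hy x hx).symm, fun x hx y hy => h.add' y hy x hx,
    fun x hx y hy => h.add y hy x hx, h.right, h.left⟩

/-- The entry of the matrix of the determinant representation, for a column set `K` and a row
set `J`. -/
def ent (η l k : ℂ) (K J : Finset ℂ) (y x : ℂ) : ℂ :=
  rFun η x y * (l - k * (∏ y' ∈ J.erase y, (y - y' - η) / (y - y' + η)) *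
    ∏ x' ∈ K.erase x, (x' - y - η) / (x' - y + η))

/-- The two-parameter version of `S̄`, for finite sets of parameters. -/
def SS (η l k : ℂ) (K J : Finset ℂ) : ℂ :=
  (∏ x ∈ K, ∏ y ∈ J, (x - y + η)) * normDetSet (ent η l k K J) K J

/-- The coefficient of the residue of `S̄` at a point `y` of `J`. -/
def gS (η l k : ℂ) (K J : Finset ℂ) (y : ℂ) : ℂ :=
  l * (fS η K {y} * fS η {y} (J.erase y)) - k * (fS η (J.erase y) {y} * fS η {y} K)

variable {η : ℂ}

theorem SS_of_card_ne (l k : ℂ) {K J : Finset ℂ} (h : K.card ≠ J.card) : SS η l k K J = 0 := by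
  rw [SS, normDetSet_of_card_ne _ h, mul_zero]

theorem SS_empty (l k : ℂ) (J : Finset ℂ) : SS η l k ∅ J = if J = ∅ then 1 else 0 := by
  split_ifs with h
  · subst h
    have : normDetSet (ent η l k ∅ ∅) ∅ ∅ = 1 := by
      rw [normDetSet_eq (n := 0) _ (x := Fin.elim0) (y := Fin.elim0) (fun i => i.elim0)
        (fun i => i.elim0) (by simp) (by simp)]
      simp [normDet, vdm]
    simp [SS, this]
  · apply SS_of_card_ne
    rw [card_empty]
    exact (card_ne_zero.mpr (nonempty_iff_ne_empty.mpr h)).symm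

theorem fS_right_mul {u : ℂ} {K : Finset ℂ} (hu : u ∉ K) :
    fS η K {u} * ∏ a ∈ K, (u - a) = ∏ a ∈ K, (u - a - η) := by
  simp only [fS, prod_singleton, ← prod_mul_distrib]
  refine prod_congr rfl fun a ha => ?_
  have : a - u ≠ 0 := sub_ne_zero.mpr (ne_of_mem_of_not_mem ha hu)
  rw [fFun]; field_simp; ring

theorem fS_left_mul {u : ℂ} {K : Finset ℂ} (hu : u ∉ K) :
    fS η {u} K * ∏ a ∈ K, (u - a) = ∏ a ∈ K, (u - a + η) := by
  simp only [fS, prod_singleton, ← prod_mul_distrib]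
  refine prod_congr rfl fun a ha => ?_
  have : u - a ≠ 0 := sub_ne_zero.mpr (ne_of_mem_of_not_mem ha hu).symm
  rw [fFun]; field_simp

theorem prod_sub_ne_zero {u : ℂ} {K : Finset ℂ} (hu : u ∉ K) : ∏ a ∈ K, (u - a) ≠ 0 :=
  prod_ne_zero_iff.mpr fun _ ha => sub_ne_zero.mpr (ne_of_mem_of_not_mem ha hu).symm

theorem isPoly_linear (a b : ℂ) : IsPoly 1 fun t => a * t + b :=
  (IsPoly.id.const_mul a).add (IsPoly.const 1 b)

theorem isPoly_sub (a : ℂ) : IsPoly 1 fun t => t - a :=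
  (isPoly_linear 1 (-a)).congr fun t => by ring

theorem isPoly_prod_sub (K : Finset ℂ) : IsPoly K.card fun t => ∏ a ∈ K, (t - a) :=
  IsPoly.prod K fun a _ => isPoly_sub a

theorem gS_eq (l k : ℂ) {K J : Finset ℂ} {y : ℂ} (hyK : y ∉ K)
    (hK : ∀ x ∈ K, x - y + η ≠ 0) (hJ : ∀ y' ∈ J.erase y, y - y' + η ≠ 0) :
    gS η l k K J y = fS η K {y} * fS η {y} (J.erase y) *
      (l - k * (∏ y' ∈ J.erase y, (y - y' - η) / (y - y' + η)) *
        ∏ x' ∈ K, (x' - y - η) / (x' - y + η)) := by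
  have h1 : fS η (J.erase y) {y} =
      fS η {y} (J.erase y) * ∏ y' ∈ J.erase y, (y - y' - η) / (y - y' + η) := by
    simp only [fS, prod_singleton, ← prod_mul_distrib]
    refine prod_congr rfl fun a ha => ?_
    have h0 : y - a ≠ 0 := sub_ne_zero.mpr (ne_of_mem_of_not_mem ha (notMem_erase y J)).symm
    have h0' : a - y ≠ 0 := sub_ne_zero.mpr (ne_of_mem_of_not_mem ha (notMem_erase y J))
    have h2 := hJ a ha
    rw [fFun, fFun]; field_simp; ring
  have h2 : fS η {y} K = fS η K {y} * ∏ x' ∈ K, (x' - y - η) / (x' - y + η) := by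
    simp only [fS, prod_singleton, ← prod_mul_distrib]
    refine prod_congr rfl fun a ha => ?_
    have h0 : y - a ≠ 0 := sub_ne_zero.mpr (ne_of_mem_of_not_mem ha hyK).symm
    have h0' : a - y ≠ 0 := sub_ne_zero.mpr (ne_of_mem_of_not_mem ha hyK)
    have h2 := hK a ha
    rw [fFun, fFun]; field_simp; ring
  rw [gS, h1, h2]; ring

/-- Expansion of `S̄` over its poles in one of the inhomogeneities. -/
theorem SS_insert (hη : η ≠ 0) (l k : ℂ) {K J : Finset ℂ} {t : ℂ} (ht : t ∉ K) (hg : Gen η (insert t K) J) :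
    SS η l k (insert t K) J = ∑ y ∈ J, η / (t - y) * gS η l k K J y * SS η l k K (J.erase y) := by
  by_cases hc : K.card + 1 = J.card
  swap
  · rw [SS_of_card_ne _ _ (by rwa [card_insert_of_notMem ht]), sum_eq_zero]
    intro y hy
    rw [SS_of_card_ne, mul_zero]
    intro h
    rw [card_erase_of_mem hy] at h
    have := card_pos.mpr ⟨y, hy⟩
    omega
  have htJ : ∀ y ∈ J, t - y ≠ 0 := fun y hy => sub_ne_zero.mpr (hg.ne t (mem_insert_self _ _) y hy)
  have htη : ∀ y ∈ J, t - y + η ≠ 0 := fun y hy => hg.add t (mem_insert_self _ _) y hy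
  have hKJ : ∀ x ∈ K, ∀ y ∈ J, x - y ≠ 0 := fun x hx y hy =>
    sub_ne_zero.mpr (hg.ne x (mem_insert_of_mem hx) y hy)
  have hKη : ∀ x ∈ K, ∀ y ∈ J, x - y + η ≠ 0 := fun x hx y hy =>
    hg.add x (mem_insert_of_mem hx) y hy
  have hyK : ∀ y ∈ J, y ∉ K := fun y hy h => hKJ y h y hy (sub_self y)
  set Yf : ℂ → ℂ := fun y => ∏ y' ∈ J.erase y, (y - y' - η) / (y - y' + η) with hYf
  set e : ℂ → ℂ := fun y => l - k * Yf y * ∏ x' ∈ K, (x' - y - η) / (x' - y + η) with he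
  -- Each row y is multiplied by t - y + η, which uses up the factors of t in the prefactor. The
  -- columns of `K` become linear in t, and the column of t reduces to a simple fraction with its
  -- pole at y.
  set E : ℂ → ℂ → ℂ → ℂ := fun t y x => if x ∈ K then rFun η x y * (l * (t - y + η) - k * Yf y *
    (∏ x' ∈ K.erase x, (x' - y - η) / (x' - y + η)) * (t - y - η)) else η * e y / (x - y) with hE
  set P : ℂ → ℂ := fun t => ∑ y ∈ J, e y * (∏ y' ∈ J.erase y, (t - y') / (y' - y)) *
    normDetSet (E t) K (J.erase y) with hP
  have hprod : ∀ (t y : ℂ), ∏ y' ∈ J.erase y, (t - y') / (y' - y) =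
      (∏ y' ∈ J.erase y, (t - y')) * (∏ y' ∈ J.erase y, (y' - y))⁻¹ := by
    intro t y; rw [prod_div_distrib, div_eq_mul_inv]
  have stepA : ∀ t', (∀ y ∈ J, t' - y ≠ 0) → (∀ y ∈ J, E t' y t' = η * e y / (t' - y)) →
      (∏ y ∈ J, (t' - y)) * colSum (E t') t' K J = η * P t' := by
    intro t' h1 h2
    rw [colSum, mul_sum, hP, mul_sum]
    refine sum_congr rfl fun y hy => ?_
    rw [h2 y hy, ← mul_prod_erase _ _ hy, hprod]
    have := h1 y hy
    field_simp
  -- Here |J| = |K| + 1, so the degree 2|K| is below |K| + |J|: the zeros in `K` and the values at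
  -- `J` determine P.
  have hPoly : IsPoly (K.card + K.card) P := by
    refine IsPoly.sum _ fun y hy => IsPoly.mul ?_ (IsPoly.normDetSet K _ fun y' _ x hx => ?_)
    · have h1 : (J.erase y).card = K.card := by rw [card_erase_of_mem hy]; omega
      simp only [hprod, ← h1]
      exact ((isPoly_prod_sub _).mul_const _).const_mul _
    · refine (isPoly_linear (rFun η x y' * (l - k * Yf y' *
        (∏ x' ∈ K.erase x, (x' - y' - η) / (x' - y' + η)))) (rFun η x y' * (l * (- y' + η) -
        k * Yf y' * (∏ x' ∈ K.erase x, (x' - y' - η) / (x' - y' + η)) * (-y' - η)))).congr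
        fun u => ?_
      simp only [hE, if_pos hx]
      ring
  -- At t = a the column of t coincides with the column of a.
  have hzero : ∀ a ∈ K, P a = 0 := by
    intro a ha
    have h1 := stepA a (hKJ a ha) fun y hy => by
      have h0 := hKJ a ha y hy
      have h1 := hKη a ha y hy
      simp only [hE, if_pos ha, he, rFun]
      rw [← mul_prod_erase K _ ha]
      field_simp
    rw [colSum_eq_zero _ ha fun _ _ => rfl, mul_zero] at h1
    exact (mul_eq_zero.mp h1.symm).resolve_left hη
  have hPy : ∀ y ∈ J, P y = e y * (-1) ^ K.card * ((∏ y' ∈ J.erase y, (y - y' + η)) *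
      normDetSet (ent η l k K (J.erase y)) K (J.erase y)) := by
    intro y hy
    rw [hP]
    simp only
    rw [sum_eq_single_of_mem y hy]
    · have h1 : ∏ y' ∈ J.erase y, (y - y') / (y' - y) = (-1) ^ K.card := by
        rw [prod_congr rfl (g := fun _ => (-1 : ℂ)), prod_const, card_erase_of_mem hy]
        · congr 1; omega
        · intro y' hy'
          have : y' - y ≠ 0 := sub_ne_zero.mpr (ne_of_mem_erase hy')
          field_simp; ring
      rw [h1, ← normDetSet_row_mul]
      congr 1
      refine normDetSet_congr fun y' hy' x hx => ?_
      have hy'J := mem_of_mem_erase hy'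
      have hne := ne_of_mem_erase hy'
      have h2 := hg.right y' hy'J y hy hne
      simp only [hE, if_pos hx, ent, hYf]
      -- At t = y the factor of y in the product of row y' turns t - y' - η into t - y' + η. Both
      -- terms of the entry then share the factor y - y' + η, and what is left is the entry for the
      -- smaller row set.
      have h3 : J.erase y' = insert y ((J.erase y).erase y') := by
        rw [erase_right_comm, insert_erase]
        exact mem_erase.mpr ⟨hne.symm, hy⟩
      rw [h3, prod_insert (by simp)]
      field_simp
      ring
    · intro y' hy' hne
      rw [prod_eq_zero (i := y) (mem_erase.mpr ⟨hne.symm, hy⟩) (by simp)]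
      simp
  have stepB : SS η l k (insert t K) J = (∏ x ∈ K, ∏ y ∈ J, (x - y + η)) *
      ((∏ x ∈ K, (t - x))⁻¹ * colSum (E t) t K J) := by
    rw [SS, prod_insert ht, mul_comm (∏ y ∈ J, (t - y + η)), mul_assoc, ← normDetSet_row_mul,
      ← normDetSet_insert _ ht]
    congr 1
    refine normDetSet_congr fun y hy x hx => ?_
    have h0 := htJ y hy
    have h1 := htη y hy
    rcases mem_insert.mp hx with rfl | hx
    · simp only [hE, if_neg ht, ent, erase_insert ht, he, hYf, rFun]
      field_simp
    · have hxt : x ≠ t := fun h => ht (h ▸ hx)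
      simp only [hE, if_pos hx, ent, hYf]
      rw [erase_insert_of_ne hxt.symm, prod_insert (fun h => ht (mem_of_mem_erase h))]
      field_simp
  have hA := stepA t htJ fun y hy => by simp only [hE, if_neg ht]
  have hJ0 : ∏ y ∈ J, (t - y) ≠ 0 := prod_ne_zero_iff.mpr htJ
  have hcol : colSum (E t) t K J = (∏ y ∈ J, (t - y))⁻¹ * (η * P t) := by
    rw [← hA, inv_mul_cancel_left₀ hJ0]
  have hdisj : Disjoint K J := disjoint_left.mpr fun x hx hxJ => hyK x hxJ hx
  rw [stepB, hcol, hPoly.lagrange_of_zeros hdisj (by omega) hzero, mul_sum, mul_sum, mul_sum,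
    mul_sum]
  refine sum_congr rfl fun y hy => ?_
  rw [hPy y hy, gS_eq l k (hyK y hy) (fun x hx => hKη x hx y hy) fun y' hy' =>
    hg.right y hy y' (mem_of_mem_erase hy') (ne_of_mem_erase hy').symm, SS]
  have h1 : ∏ x ∈ K, ∏ y ∈ J, (x - y + η) =
      (∏ x ∈ K, (x - y + η)) * ∏ x ∈ K, ∏ y' ∈ J.erase y, (x - y' + η) := by
    rw [← prod_mul_distrib]
    exact prod_congr rfl fun x _ => (mul_prod_erase _ _ hy).symm
  have h2 : fS η K {y} = (-1) ^ K.card * (∏ x ∈ K, (x - y + η)) * (∏ x ∈ K, (y - x))⁻¹ := by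
    rw [← prod_inv_distrib, ← prod_const, ← prod_mul_distrib, ← prod_mul_distrib, fS]
    refine prod_congr rfl fun x hx => ?_
    have h0 := hKJ x hx y hy
    have h0' : y - x ≠ 0 := by rw [← neg_sub]; exact neg_ne_zero.mpr h0
    rw [prod_singleton, fFun]
    field_simp
    ring
  have h3 : fS η {y} (J.erase y) = (∏ y' ∈ J.erase y, (y - y' + η)) *
      (∏ y' ∈ J.erase y, (y - y'))⁻¹ := by
    rw [← fS_left_mul (notMem_erase y J), mul_inv_cancel_right₀ (prod_sub_ne_zero (notMem_erase y J))]
  rw [h1, h2, h3, prod_div_distrib, prod_div_distrib, ← mul_prod_erase J _ hy]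
  have n1 : ∏ x ∈ K, (t - x) ≠ 0 := prod_sub_ne_zero ht
  have n2 : ∏ x ∈ K, (y - x) ≠ 0 := prod_sub_ne_zero (hyK y hy)
  have n3 : ∏ y' ∈ J.erase y, (y - y') ≠ 0 := prod_sub_ne_zero (notMem_erase y J)
  have n4 : ∏ y' ∈ J.erase y, (t - y') ≠ 0 := prod_sub_ne_zero fun h =>
    htJ t (mem_of_mem_erase h) (sub_self t)
  have n5 := htJ y hy
  simp only [he, hYf]
  field_simp

/-- When l = 0 the entry is a factor depending on the row alone times r(y|x), so the determinant
becomes that of the transposed problem with k = 0. The row factors from pairs inside `Y` multiply to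
one, and the others exchange the prefactors, up to signs with even total exponent. -/
theorem SS_swap {T Y : Finset ℂ} (hg : Gen η T Y) : SS η 0 1 T Y = SS η 1 0 Y T := by
  by_cases hc : T.card = Y.card
  swap
  · rw [SS_of_card_ne _ _ hc, SS_of_card_ne _ _ (Ne.symm hc)]
  have h1 : normDetSet (ent η 0 1 T Y) T Y = normDetSet (fun y x =>
      (-(∏ y' ∈ Y.erase y, (y - y' - η) / (y - y' + η)) *
        ∏ x' ∈ T, (x' - y - η) / (x' - y + η)) * ent η 1 0 Y T x y) T Y := by
    refine normDetSet_congr fun y hy x hx => ?_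
    have n1 := sub_ne_zero.mpr (hg.ne x hx y hy)
    have n1' := sub_ne_zero.mpr (hg.ne x hx y hy).symm
    have n2 := hg.add x hx y hy
    have n3 := hg.add' x hx y hy
    simp only [ent, ← mul_prod_erase T _ hx, rFun]
    field_simp
    ring
  rw [SS, SS, h1, normDetSet_row_mul, normDetSet_swap (ent η 1 0 Y T) Y T, ← mul_assoc]
  congr 1
  have e1 : ∏ y ∈ Y, ∏ y' ∈ Y.erase y, (y - y' - η) / (y - y' + η) = 1 := by
    have hn : ∏ y ∈ Y, ∏ y' ∈ Y.erase y, (y - y' + η) ≠ 0 :=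
      prod_ne_zero_iff.mpr fun y hy => prod_ne_zero_iff.mpr fun y' hy' =>
        hg.right y hy y' (mem_of_mem_erase hy') (ne_of_mem_erase hy').symm
    simp only [prod_div_distrib]
    rw [div_eq_one_iff_eq hn]
    have : ∏ y ∈ Y, ∏ y' ∈ Y.erase y, (y - y' + η) = ∏ y ∈ Y, ∏ y' ∈ Y.erase y, (y' - y + η) :=
      prod_comm' (by simp only [mem_erase]; tauto)
    rw [this]
    have h2 : ∀ y ∈ Y, ∏ y' ∈ Y.erase y, (y - y' - η) =
        (-1) ^ (Y.card - 1) * ∏ y' ∈ Y.erase y, (y' - y + η) := by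
      intro y hy
      rw [← card_erase_of_mem hy, ← prod_const, ← prod_mul_distrib]
      exact prod_congr rfl fun y' _ => by ring
    rw [prod_congr rfl h2, prod_mul_distrib, prod_const, ← pow_mul, mul_comm (Y.card - 1),
      (Nat.even_mul_pred_self Y.card).neg_one_pow, one_mul]
  have e2 : (∏ x ∈ T, ∏ y ∈ Y, (x - y + η)) * ∏ y ∈ Y, ∏ x' ∈ T, (x' - y - η) / (x' - y + η) =
      (-1) ^ (Y.card * Y.card) * ∏ y ∈ Y, ∏ x ∈ T, (y - x + η) := by
    rw [prod_comm, ← prod_mul_distrib, pow_mul, ← prod_const, ← prod_mul_distrib]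
    refine prod_congr rfl fun y hy => ?_
    rw [← hc, ← prod_const, ← prod_mul_distrib, ← prod_mul_distrib]
    refine prod_congr rfl fun x hx => ?_
    have := hg.add x hx y hy
    field_simp
    ring
  have e3 : ∏ y ∈ Y, (-(∏ y' ∈ Y.erase y, (y - y' - η) / (y - y' + η)) *
      ∏ x' ∈ T, (x' - y - η) / (x' - y + η)) =
      (-1) ^ Y.card * ∏ y ∈ Y, ∏ x' ∈ T, (x' - y - η) / (x' - y + η) := by
    rw [prod_mul_distrib, prod_neg, e1, mul_one]
  have e4 : ((-1 : ℂ)) ^ Y.card * (-1) ^ (Y.card * Y.card) = 1 := by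
    rw [← pow_add, Even.neg_one_pow]
    have := Nat.even_mul_succ_self Y.card
    rwa [mul_add_one, add_comm] at this
  rw [e3]
  linear_combination (-1) ^ Y.card * e2 + (∏ y ∈ Y, ∏ x ∈ T, (y - x + η)) * e4

/-- With l = 0 every row is proportional to k; this is the origin of the power of κ with which Q
acts on a block state. -/
theorem SS_zero_left (k : ℂ) (K J : Finset ℂ) : SS η 0 k K J = k ^ J.card * SS η 0 1 K J := by
  have : normDetSet (ent η 0 k K J) K J = k ^ J.card * normDetSet (ent η 0 1 K J) K J := by
    rw [← prod_const, ← normDetSet_row_mul]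
    refine normDetSet_congr fun y _ x _ => ?_
    simp only [ent]; ring
  rw [SS, SS, this]; ring

/-! ### The composition law of the coefficients. -/

section Convolution

/-- Numerator of the expansion of `S̄` over its poles. -/
def numS (η l k : ℂ) (K J : Finset ℂ) (t : ℂ) : ℂ :=
  ∑ y ∈ J, η * (∏ y' ∈ J.erase y, (t - y')) * (gS η l k K J y * SS η l k K (J.erase y))

theorem prod_mul_SS_insert (hη : η ≠ 0) (l k : ℂ) {K J : Finset ℂ} {t : ℂ} (ht : t ∉ K)
    (hg : Gen η (insert t K) J) :
    (∏ y ∈ J, (t - y)) * SS η l k (insert t K) J = numS η l k K J t := by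
  rw [SS_insert hη l k ht hg, mul_sum, numS]
  refine sum_congr rfl fun y hy => ?_
  have : t - y ≠ 0 := sub_ne_zero.mpr (hg.ne t (mem_insert_self _ _) y hy)
  rw [← mul_prod_erase _ _ hy]
  field_simp

theorem numS_at (l k : ℂ) {K J : Finset ℂ} {y : ℂ} (hy : y ∈ J) : numS η l k K J y =
    η * (∏ y' ∈ J.erase y, (y - y')) * (gS η l k K J y * SS η l k K (J.erase y)) := by
  rw [numS, sum_eq_single_of_mem y hy]
  intro y' hy' hne
  rw [prod_eq_zero (i := y) (mem_erase.mpr ⟨hne.symm, hy⟩) (sub_self y)]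
  ring

theorem isPoly_prod_mul_numS (l k : ℂ) (K : Finset ℂ) {J J' : Finset ℂ} {d : ℕ}
    (hd : J.card + J'.card = d + 1) :
    IsPoly d fun t => (∏ y ∈ J', (t - y)) * numS η l k K J t := by
  simp only [numS, mul_sum]
  refine IsPoly.sum _ fun y hy => ?_
  have h1 := (isPoly_prod_sub J').mul (((isPoly_prod_sub (J.erase y)).const_mul η).mul_const
    (gS η l k K J y * SS η l k K (J.erase y)))
  refine h1.mono ?_
  rw [card_erase_of_mem hy]
  have := card_pos.mpr ⟨y, hy⟩
  omega

/-- The function of `t` whose value at a point `t` is, up to an explicit product, the convolution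
sum for the inhomogeneities `insert t U`. -/
def convNum (η l k ν : ℂ) (U Y : Finset ℂ) (t : ℂ) : ℂ :=
  ∑ J ∈ Y.powerset, ∑ K ∈ U.powerset, fS η (Y \ J) J * fS η K (U \ K) *
    ((∏ a ∈ K, (t - a - η)) * (∏ a ∈ U \ K, (t - a)) * SS η l k K J *
        ((∏ y ∈ J, (t - y)) * numS η ν l (U \ K) (Y \ J) t) +
      (∏ a ∈ U \ K, (t - a + η)) * (∏ a ∈ K, (t - a)) * SS η ν l (U \ K) (Y \ J) *
        ((∏ y ∈ Y \ J, (t - y)) * numS η l k K J t))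

theorem isPoly_convNum (l k ν : ℂ) {U Y : Finset ℂ} {d : ℕ} (hd : Y.card = d + 1) :
    IsPoly (U.card + d) (convNum η l k ν U Y) := by
  refine IsPoly.sum _ fun J hJ => IsPoly.sum _ fun K hK => ?_
  rw [mem_powerset] at hJ hK
  have hJc := card_sdiff_add_card_eq_card hJ
  have hKc := card_sdiff_add_card_eq_card hK
  refine (IsPoly.add ?_ ?_).const_mul _
  · have h := (((IsPoly.prod K fun a _ => (isPoly_sub (a + η)).congr (G := fun t => t - a - η) fun t => by ring).mul
      (isPoly_prod_sub (U \ K))).mul_const (SS η l k K J)).mul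
      (isPoly_prod_mul_numS (η := η) (d := d) ν l (U \ K) (J := Y \ J) (J' := J) (by omega))
    exact h.mono (by omega)
  · have h := (((IsPoly.prod (U \ K) fun a _ => (isPoly_sub (a - η)).congr (G := fun t => t - a + η) fun t => by ring).mul
      (isPoly_prod_sub K)).mul_const (SS η ν l (U \ K) (Y \ J))).mul
      (isPoly_prod_mul_numS (η := η) (d := d) l k K (J := J) (J' := Y \ J) (by omega))
    exact h.mono (by omega)

/-- For each partition of `U` and `Y`, the point y belongs to one of the two parts of `insert y Y`,
and only the summand with a pole there survives. Adding the two placements, the contributions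
proportional to l cancel and the residue coefficient for (ν, k) remains, times the convolution with
y removed. -/
theorem convNum_at_right (l k ν : ℂ) {U Y : Finset ℂ} {y : ℂ} (hy : y ∉ Y) (hyU : y ∉ U)
    (ih : ∑ J ∈ Y.powerset, ∑ K ∈ U.powerset, fS η (Y \ J) J * fS η K (U \ K) * SS η l k K J *
      SS η ν l (U \ K) (Y \ J) = SS η ν k U Y) :
    convNum η l k ν U (insert y Y) y = (∏ a ∈ U, (y - a)) * numS η ν k U (insert y Y) y := by
  rw [numS_at _ _ (mem_insert_self y Y), erase_insert hy, ← ih, convNum, sum_powerset_insert hy,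
    ← sum_add_distrib]
  simp only [mul_sum]
  refine sum_congr rfl fun J hJ => ?_
  rw [← sum_add_distrib]
  refine sum_congr rfl fun K hK => ?_
  rw [mem_powerset] at hJ hK
  have hyJ : y ∉ J := fun h => hy (hJ h)
  have hyK : y ∉ K := fun h => hyU (hK h)
  have hyJ' : y ∉ Y \ J := fun h => hy (mem_sdiff.mp h).1
  have hyK' : y ∉ U \ K := fun h => hyU (mem_sdiff.mp h).1
  have e1 : insert y Y \ J = insert y (Y \ J) := insert_sdiff_of_notMem _ hyJ
  have e2 : insert y Y \ insert y J = Y \ J := by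
    rw [insert_sdiff_insert, sdiff_insert_of_notMem hy]
  rw [e1, e2, prod_insert hyJ', prod_insert hyJ, sub_self]
  simp only [zero_mul, mul_zero, add_zero, zero_add]
  rw [numS_at _ _ (mem_insert_self y _),
    numS_at _ _ (mem_insert_self y _), erase_insert hyJ', erase_insert hyJ, gS, gS, gS,
    erase_insert hyJ', erase_insert hyJ, erase_insert hy, ← fS_right_mul hyK, ← fS_left_mul hyK',
    fS_insert_left _ hyJ', fS_insert_right _ hyJ, ← prod_sdiff (f := fun a => y - a) hJ,
    ← prod_sdiff (f := fun a => y - a) hK]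
  have u1 : fS η U {y} = fS η (U \ K) {y} * fS η K {y} := by
    rw [← fS_union_left _ sdiff_disjoint, sdiff_union_of_subset hK]
  have u2 : fS η {y} U = fS η {y} (U \ K) * fS η {y} K := by
    rw [← fS_union_right _ sdiff_disjoint, sdiff_union_of_subset hK]
  have u3 : fS η Y {y} = fS η (Y \ J) {y} * fS η J {y} := by
    rw [← fS_union_left _ sdiff_disjoint, sdiff_union_of_subset hJ]
  have u4 : fS η {y} Y = fS η {y} (Y \ J) * fS η {y} J := by
    rw [← fS_union_right _ sdiff_disjoint, sdiff_union_of_subset hJ]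
  rw [u1, u2, u3, u4]
  ring

/-- The partitions with u in the first part and in the second part are paired. In each, the factor t
- u removes one summand, and the surviving ones agree up to the factors η and -η. -/
theorem convNum_at_left (hη : η ≠ 0) (l k ν : ℂ) {U Y : Finset ℂ} {u : ℂ} (hu : u ∉ U)
    (hg : Gen η (insert u U) Y) : convNum η l k ν (insert u U) Y u = 0 := by
  rw [convNum]
  refine sum_eq_zero fun J hJ => ?_
  rw [sum_powerset_insert hu, ← sum_add_distrib]
  refine sum_eq_zero fun K hK => ?_
  rw [mem_powerset] at hJ hK
  have huK : u ∉ K := fun h => hu (hK h)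
  have huK' : u ∉ U \ K := fun h => hu (mem_sdiff.mp h).1
  have e1 : insert u U \ K = insert u (U \ K) := insert_sdiff_of_notMem _ huK
  have e2 : insert u U \ insert u K = U \ K := by
    rw [insert_sdiff_insert, sdiff_insert_of_notMem hu]
  have g1 : Gen η (insert u K) J := hg.mono (insert_subset_insert _ hK) hJ
  have g2 : Gen η (insert u (U \ K)) (Y \ J) :=
    hg.mono (insert_subset_insert _ sdiff_subset) sdiff_subset
  rw [e1, e2, prod_insert huK', prod_insert huK', prod_insert huK, prod_insert huK, sub_self,
    ← prod_mul_SS_insert hη l k huK g1, ← prod_mul_SS_insert hη ν l huK' g2, fS_insert_left _ huK,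
    fS_insert_right _ huK', ← fS_right_mul huK, ← fS_left_mul huK']
  ring

/-- Composition law of the coefficients `S̄`. -/
theorem SS_convolution (hη : η ≠ 0) (l k ν : ℂ) (U : Finset ℂ) : ∀ Y, Gen η U Y →
    ∑ J ∈ Y.powerset, ∑ K ∈ U.powerset, fS η (Y \ J) J * fS η K (U \ K) * SS η l k K J *
      SS η ν l (U \ K) (Y \ J) = SS η ν k U Y := by
  induction U using Finset.induction_on with
  | empty =>
    intro Y _
    simp only [powerset_empty, sum_singleton, sdiff_self, bot_eq_empty, fS_empty_left, mul_one,
      SS_empty]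
    rw [sum_eq_single_of_mem ∅ (empty_mem_powerset Y) fun J _ hJ => by simp [hJ]]
    simp
  | insert t U ht ih =>
    intro Y hg
    rcases Y.eq_empty_or_nonempty with rfl | hY
    · have h0 : SS η ν k (insert t U) ∅ = 0 :=
        SS_of_card_ne _ _ (by rw [card_insert_of_notMem ht]; simp)
      rw [h0]
      refine sum_eq_zero fun J hJ => sum_eq_zero fun K hK => ?_
      obtain rfl : J = ∅ := by simpa using hJ
      by_cases hK0 : K = ∅
      · rw [SS_of_card_ne ν l, mul_zero]
        subst hK0
        rw [sdiff_empty, card_insert_of_notMem ht]; simp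
      · rw [SS_of_card_ne l k, mul_zero, zero_mul]
        rw [card_empty]; exact card_ne_zero.mpr (nonempty_iff_ne_empty.mpr hK0)
    · obtain ⟨d, hd⟩ : ∃ d, Y.card = d + 1 := ⟨Y.card - 1, by have := hY.card_pos; omega⟩
      have hYU : Disjoint Y U := disjoint_right.mpr fun x hx hxY =>
        hg.ne x (mem_insert_of_mem hx) x hxY rfl
      have key : convNum η l k ν U Y t = (∏ a ∈ U, (t - a)) * numS η ν k U Y t := by
        have hp := (isPoly_prod_mul_numS (η := η) ν k U (J := Y) (J' := ∅) (d := d) (by simpa using hd))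
        simp only [prod_empty, one_mul] at hp
        -- Both sides have degree at most |U| + |Y| - 1 in t, one less than the number of nodes in
        -- `Y ∪ U`.
        refine (isPoly_convNum l k ν hd).eq_of_eval_eq ((isPoly_prod_sub U).mul hp)
          (S := Y ∪ U) (by rw [card_union_of_disjoint hYU]; omega) (fun b hb => ?_) t
        rcases mem_union.mp hb with hb | hb
        · have hbU : b ∉ U := disjoint_left.mp hYU hb
          have h1 := convNum_at_right l k ν (notMem_erase b Y) hbU (ih (Y.erase b)
            (hg.mono (subset_insert _ _) (erase_subset _ _)))
          rwa [insert_erase hb] at h1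
        · rw [prod_eq_zero hb (sub_self b), zero_mul]
          have h1 := convNum_at_left hη l k ν (notMem_erase b U) (Y := Y)
          rw [insert_erase hb] at h1
          exact h1 (hg.mono (subset_insert _ _) subset_rfl)
      have htY : ∏ y ∈ Y, (t - y) ≠ 0 :=
        prod_sub_ne_zero fun h => hg.ne t (mem_insert_self _ _) t h rfl
      have htU : ∏ a ∈ U, (t - a) ≠ 0 := prod_sub_ne_zero ht
      rw [← prod_mul_SS_insert hη ν k ht hg] at key
      apply mul_left_cancel₀ (mul_ne_zero htU htY)
      rw [mul_assoc (∏ a ∈ U, (t - a)) _ (SS η ν k (insert t U) Y), ← key, convNum, mul_sum]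
      refine sum_congr rfl fun J hJ => ?_
      rw [sum_powerset_insert ht, ← sum_add_distrib, mul_sum]
      refine sum_congr rfl fun K hK => ?_
      rw [mem_powerset] at hJ hK
      have htK : t ∉ K := fun h => ht (hK h)
      have htK' : t ∉ U \ K := fun h => ht (mem_sdiff.mp h).1
      have e1 : insert t U \ K = insert t (U \ K) := insert_sdiff_of_notMem _ htK
      have e2 : insert t U \ insert t K = U \ K := by
        rw [insert_sdiff_insert, sdiff_insert_of_notMem ht]
      have g1 : Gen η (insert t K) J := hg.mono (insert_subset_insert _ hK) hJ
      have g2 : Gen η (insert t (U \ K)) (Y \ J) :=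
        hg.mono (insert_subset_insert _ sdiff_subset) sdiff_subset
      rw [e1, e2, ← prod_mul_SS_insert hη l k htK g1, ← prod_mul_SS_insert hη ν l htK' g2,
        fS_insert_left _ htK, fS_insert_right _ htK', ← fS_right_mul htK, ← fS_left_mul htK',
        ← prod_sdiff (f := fun a => t - a) hJ, ← prod_sdiff (f := fun a => t - a) hK]
      ring

end Convolution

end Coefficients

/-! ### Reindexing of sums over subsets. -/

section Reindexing

variable {α M : Type*} [DecidableEq α] [AddCommMonoid M]

theorem sum_powerset_erase (Z : Finset α) (h : α → Finset α → M) :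
    ∑ T ∈ Z.powerset, ∑ a ∈ T, h a (T.erase a) = ∑ a ∈ Z, ∑ T ∈ (Z.erase a).powerset, h a T := by
  rw [Finset.sum_sigma', Finset.sum_sigma']
  refine Finset.sum_bij' (fun p _ => ⟨p.2, p.1.erase p.2⟩) (fun p _ => ⟨insert p.1 p.2, p.1⟩)
    ?_ ?_ ?_ ?_ ?_
  · rintro ⟨S, k⟩ h
    simp only [mem_sigma, mem_powerset] at h ⊢
    exact ⟨h.1 h.2, erase_subset_erase _ h.1⟩
  · rintro ⟨k, S⟩ h
    simp only [mem_sigma, mem_powerset] at h ⊢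
    exact ⟨insert_subset h.1 (h.2.trans (erase_subset _ _)), mem_insert_self _ _⟩
  · rintro ⟨S, k⟩ h
    simp only [mem_sigma, mem_powerset] at h
    simp [insert_erase h.2]
  · rintro ⟨k, S⟩ h
    simp only [mem_sigma, mem_powerset] at h
    have : k ∉ S := fun hk => notMem_erase _ _ (h.2 hk)
    simp [erase_insert this]
  · rintro ⟨S, k⟩ h
    rfl

theorem sum_powerset_powerset_sdiff (X : Finset α) (h : Finset α → Finset α → M) :
    ∑ K ∈ X.powerset, ∑ T ∈ (X \ K).powerset, h K T =
      ∑ U ∈ X.powerset, ∑ K ∈ U.powerset, h K (U \ K) := by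
  rw [Finset.sum_sigma', Finset.sum_sigma']
  refine Finset.sum_bij' (fun p _ => ⟨p.1 ∪ p.2, p.1⟩) (fun p _ => ⟨p.2, p.1 \ p.2⟩)
    ?_ ?_ ?_ ?_ ?_
  · rintro ⟨K, T⟩ h
    simp only [mem_sigma, mem_powerset] at h ⊢
    exact ⟨union_subset h.1 (h.2.trans sdiff_subset), subset_union_left⟩
  · rintro ⟨U, K⟩ h
    simp only [mem_sigma, mem_powerset] at h ⊢
    exact ⟨h.2.trans h.1, sdiff_subset_sdiff h.1 subset_rfl⟩
  · rintro ⟨K, T⟩ h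
    simp only [mem_sigma, mem_powerset] at h
    have : Disjoint T K := disjoint_of_subset_left h.2 sdiff_disjoint
    simp [union_sdiff_cancel_left this.symm]
  · rintro ⟨U, K⟩ h
    simp only [mem_sigma, mem_powerset] at h
    simp [union_sdiff_of_subset h.2]
  · rintro ⟨K, T⟩ h
    simp only [mem_sigma, mem_powerset] at h
    have : Disjoint T K := disjoint_of_subset_left h.2 sdiff_disjoint
    simp [union_sdiff_cancel_left this.symm]

theorem sum_powerset_union_of_subset {Z K : Finset α} (hZK : Disjoint Z K) {F : Finset α → M}
    (hF : ∀ S ⊆ Z ∪ K, ¬ K ⊆ S → F S = 0) :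
    ∑ S ∈ (Z ∪ K).powerset, F S = ∑ S ∈ Z.powerset, F (S ∪ K) := by
  have h1 : ∑ S ∈ (Z ∪ K).powerset, F S = ∑ S ∈ (Z ∪ K).powerset with K ⊆ S, F S := by
    symm
    refine sum_subset (filter_subset _ _) fun S hS hS' => hF S (mem_powerset.mp hS) fun h => ?_
    exact hS' (mem_filter.mpr ⟨hS, h⟩)
  rw [h1]
  refine sum_bij' (fun S _ => S \ K) (fun S _ => S ∪ K) ?_ ?_ ?_ ?_ ?_
  · intro S hS
    simp only [mem_filter, mem_powerset] at hS ⊢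
    exact sdiff_le_iff.mpr (hS.1.trans (union_comm Z K).le)
  · intro S hS
    simp only [mem_filter, mem_powerset] at hS ⊢
    exact ⟨union_subset_union_left hS, subset_union_right⟩
  · intro S hS
    simp only [mem_filter, mem_powerset] at hS
    exact sdiff_union_of_subset hS.2
  · intro S hS
    simp only [mem_powerset] at hS
    exact union_sdiff_cancel_right (hZK.mono_left hS)
  · intro S hS
    simp only [mem_filter, mem_powerset] at hS
    rw [sdiff_union_of_subset hS.2]

end Reindexing

/-! ### Expansion of block states over states at the inhomogeneities. -/

section Core

variable {V : Type*} [AddCommGroup V] [Module ℂ V] {η : ℂ}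

/-- Eigenvalue of `A` on the reference state of a block of sites with parameters `X`. -/
def aX (η : ℂ) (X : Finset ℂ) (u : ℂ) : ℂ := ∏ b ∈ X, (u - b + η)

/-- Eigenvalue of `D` on the reference state of a block of sites with parameters `X`. -/
def dX (X : Finset ℂ) (u : ℂ) : ℂ := ∏ b ∈ X, (u - b)

/-- Lagrange interpolation of an operator valued function at any `n` nodes. -/
def HasLagrange (n : ℕ) (B : ℂ → Module.End ℂ V) : Prop :=
  ∀ S : Finset ℂ, S.card = n → ∀ u, B u = ∑ b ∈ S, (∏ b' ∈ S.erase b, (u - b') / (b - b')) • B b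

theorem aX_ne_zero {X Y : Finset ℂ} (hη : η ≠ 0) (hg : Gen η X Y) {a : ℂ} (ha : a ∈ X) :
    aX η X a ≠ 0 := by
  refine prod_ne_zero_iff.mpr fun b hb => ?_
  by_cases h : a = b
  · simpa [h] using hη
  · exact hg.left a ha b hb h

/-- The left side holds the Lagrange weights at the nodes (X \ K) ∪ (K - η), and the right side the
shape required by the pole recursion of the determinant. Both reduce to products of f once
numerators and denominators are written through `dX` and `aX`. -/
theorem core_coeff (hη : η ≠ 0) {X K Y : Finset ℂ} {u : ℂ} (hK : K ⊆ X) (hu : u ∉ X)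
    (hg : Gen η X Y) {a : ℂ} (ha : a ∈ X \ K) {T : Finset ℂ} (hT : T ⊆ (X \ K).erase a) :
    (∏ b ∈ (X \ K).erase a, (u - b) / (a - b)) * (∏ b ∈ K, (u - b + η) / (a - b + η)) *
      fS η T ((X \ K).erase a \ T) =
    dX X u * fS η {u} K * fS η (insert a T) ((X \ K) \ insert a T) / aX η X a *
      (η / (u - a) * fS η {a} T) := by
  have haX : a ∈ X := (mem_sdiff.mp ha).1
  have haT : a ∉ T := fun h => notMem_erase _ _ (hT h)
  have e1 : (X \ K).erase a \ T = (X \ K) \ insert a T := by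
    rw [erase_eq, sdiff_sdiff_left, sup_eq_union, insert_eq]
  have haR : a ∉ (X \ K).erase a := notMem_erase _ _
  have e2 : fS η {a} ((X \ K) \ insert a T) * fS η {a} T = fS η {a} ((X \ K).erase a) := by
    rw [← e1, ← fS_union_right _ sdiff_disjoint, sdiff_union_of_subset hT]
  have e3 : aX η X a = (∏ b ∈ K, (a - b + η)) * (η * ∏ b ∈ (X \ K).erase a, (a - b + η)) := by
    rw [aX, ← prod_sdiff (f := fun b => a - b + η) hK, ← mul_prod_erase _ _ ha]
    ring
  have e4 : dX X u = (∏ b ∈ K, (u - b)) * ((u - a) * ∏ b ∈ (X \ K).erase a, (u - b)) := by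
    rw [dX, ← prod_sdiff (f := fun b => u - b) hK, ← mul_prod_erase _ _ ha]
    ring
  have hua : u - a ≠ 0 := sub_ne_zero.mpr (ne_of_mem_of_not_mem haX hu).symm
  have n1 : ∏ b ∈ (X \ K).erase a, (a - b) ≠ 0 := prod_sub_ne_zero haR
  have n0 := aX_ne_zero hη hg haX
  rw [e3] at n0
  have n2 := left_ne_zero_of_mul n0
  have n3 := right_ne_zero_of_mul (right_ne_zero_of_mul n0)
  have e5 := fS_left_mul (η := η) haR
  have e6 := fS_left_mul (η := η) (fun h => hu (hK h) : u ∉ K)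
  have n4 : fS η {a} ((X \ K).erase a) ≠ 0 := by
    rw [← e5] at n3; exact left_ne_zero_of_mul n3
  rw [← e1, fS_insert_left _ haT, e1, prod_div_distrib, prod_div_distrib, ← e6, e3, e4, ← e5]
  have e7 : fS η {a} ((X \ K) \ insert a T) * fS η T ((X \ K) \ insert a T) =
      fS η T ((X \ K) \ insert a T) * fS η {a} ((X \ K) \ insert a T) := mul_comm _ _
  field_simp
  rw [← e2]
  ring

variable {B : ℂ → Module.End ℂ V} (hB : ∀ u v, Commute (B u) (B v))

theorem opProd_apply_insert {u : ℂ} {Y : Finset ℂ} (hu : u ∉ Y) (w : V) :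
    opProd B hB (insert u Y) w = B u (opProd B hB Y w) := by
  rw [opProd_insert hB hu]; rfl

theorem apply_opProd_comm (u : ℂ) (Y : Finset ℂ) (w : V) :
    B u (opProd B hB Y w) = opProd B hB Y (B u w) :=
  congrArg (fun X : Module.End ℂ V => X w) (commute_opProd hB (hB u) Y).eq

/-- Expansion of an off-shell state over the states with parameters at the inhomogeneities. -/
theorem opProd_expansion (hη : η ≠ 0) {X : Finset ℂ} (hlag : HasLagrange X.card B)
    (hfus : ∀ x ∈ X, B (x - η) * B x = 0) (v0 : V) (Y : Finset ℂ) : Gen η X Y → ∀ K ⊆ X,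
    opProd B hB Y (opProd B hB K v0) = ∑ T ∈ (X \ K).powerset,
      ((∏ y ∈ Y, dX X y) * fS η Y K * (fS η T ((X \ K) \ T) / (∏ t ∈ T, aX η X t)) *
        SS η 1 0 Y T) • opProd B hB (K ∪ T) v0 := by
  induction Y using Finset.induction_on with
  | empty =>
    intro hg K hK
    rw [sum_eq_single_of_mem ∅ (empty_mem_powerset _) fun T _ hT => by
      rw [SS_empty, if_neg hT, mul_zero, zero_smul]]
    simp [SS_empty]
  | insert u Y hu ih =>
    intro hg K hK
    have hgY : Gen η X Y := hg.mono subset_rfl (subset_insert _ _)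
    have huX : u ∉ X := fun h => hg.ne u h u (mem_insert_self _ _) rfl
    -- Since no two points of `X` differ by η, the shifted copies of `K` are new nodes and the total
    -- number is exactly |X|.
    have hdisj : Disjoint (X \ K) (K.image (· - η)) := by
      rw [disjoint_left]
      intro a ha h
      obtain ⟨b, hb, rfl⟩ := mem_image.mp h
      rw [mem_sdiff] at ha
      refine hg.left _ ha.1 b (hK hb) (fun h => hη ?_) (by ring)
      linear_combination -h
    have hinj : Function.Injective fun z : ℂ => z - η := sub_left_injective
    have hS : ((X \ K) ∪ K.image (· - η)).card = X.card := by
      rw [card_union_of_disjoint hdisj, card_image_of_injective _ hinj,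
        card_sdiff_add_card_eq_card hK]
    -- The nodes b - η with b in `K` are killed by fusion, because B(b) is already present. The
    -- remaining nodes enlarge `K` by one point of `X`.
    rw [opProd_apply_insert hB hu, hlag _ hS u, LinearMap.sum_apply, sum_union hdisj,
      sum_eq_zero (s := K.image (· - η)), add_zero]
    swap
    · intro c hc
      obtain ⟨b, hb, rfl⟩ := mem_image.mp hc
      have : B (b - η) (opProd B hB Y (opProd B hB K v0)) = 0 := by
        rw [apply_opProd_comm, ← insert_erase hb, opProd_apply_insert hB (notMem_erase b K),
          ← Module.End.mul_apply (B (b - η)), hfus b (hK hb)]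
        simp
      rw [LinearMap.smul_apply, this, smul_zero]
    have hRHS : ∀ T ∈ (X \ K).powerset, ((∏ y ∈ insert u Y, dX X y) * fS η (insert u Y) K *
        (fS η T ((X \ K) \ T) / (∏ t ∈ T, aX η X t)) * SS η 1 0 (insert u Y) T) •
          opProd B hB (K ∪ T) v0 =
        ∑ a ∈ T, ((∏ y ∈ insert u Y, dX X y) * fS η (insert u Y) K *
          (fS η (insert a (T.erase a)) ((X \ K) \ insert a (T.erase a)) /
            (aX η X a * ∏ t ∈ T.erase a, aX η X t)) *
          (η / (u - a) * (fS η Y {a} * fS η {a} (T.erase a)) * SS η 1 0 Y (T.erase a))) •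
          opProd B hB (K ∪ insert a (T.erase a)) v0 := by
      intro T hT
      have hTX : T ⊆ X := (mem_powerset.mp hT).trans sdiff_subset
      -- The spectral parameters play the role of columns here, so the recursion removes u together
      -- with one point a of T. As k = 0, only one of the two terms of the residue coefficient is
      -- present.
      rw [SS_insert hη 1 0 hu (hg.mono hTX subset_rfl).symm, mul_sum, sum_smul]
      refine sum_congr rfl fun a ha => ?_
      rw [insert_erase ha, mul_prod_erase _ _ ha, gS]
      simp only [one_mul, zero_mul, sub_zero]
    rw [sum_congr rfl hRHS, sum_powerset_erase (X \ K) fun a T =>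
      ((∏ y ∈ insert u Y, dX X y) * fS η (insert u Y) K *
          (fS η (insert a T) ((X \ K) \ insert a T) / (aX η X a * ∏ t ∈ T, aX η X t)) *
          (η / (u - a) * (fS η Y {a} * fS η {a} T) * SS η 1 0 Y T)) •
          opProd B hB (K ∪ insert a T) v0]
    refine sum_congr rfl fun a ha => ?_
    have haX : a ∈ X := (mem_sdiff.mp ha).1
    have haK : a ∉ K := (mem_sdiff.mp ha).2
    rw [LinearMap.smul_apply, apply_opProd_comm, ← opProd_apply_insert hB haK,
      ih hgY _ (insert_subset haX hK), smul_sum]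
    have e0 : X \ insert a K = (X \ K).erase a := by
      rw [erase_eq, sdiff_sdiff_left, sup_eq_union, insert_eq, union_comm]
    rw [e0]
    refine sum_congr rfl fun T hT => ?_
    have hT' := mem_powerset.mp hT
    rw [smul_smul, show insert a K ∪ T = K ∪ insert a T by
      rw [insert_union, union_insert]]
    congr 1
    have h1 := core_coeff hη hK huX hgY ha hT'
    have haI : a ∉ K.image (· - η) := disjoint_left.mp hdisj ha
    have h2 : ∏ b' ∈ ((X \ K) ∪ K.image (· - η)).erase a, (u - b') / (a - b') =
        (∏ b ∈ (X \ K).erase a, (u - b) / (a - b)) * ∏ b ∈ K, (u - b + η) / (a - b + η) := by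
      rw [erase_union_distrib, erase_eq_of_notMem haI,
        prod_union (hdisj.mono_left (erase_subset _ _)), prod_image fun _ _ _ _ h => hinj h]
      congr 1
      exact prod_congr rfl fun b _ => by rw [← sub_add, ← sub_add]
    rw [h2, prod_insert hu, fS_insert_left _ hu, fS_insert_right _ haK]
    linear_combination (∏ y ∈ Y, dX X y) * (fS η Y {a} * fS η Y K) / (∏ t ∈ T, aX η X t) *
      SS η 1 0 Y T * h1

/-- The coefficient of the action of the quasi-local operator on a bulk state. -/
def Rset (η κ : ℂ) (a : ℂ → ℂ) (X Y J K : Finset ℂ) : ℂ :=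
  (∏ y ∈ J, a y) / (∏ x ∈ K, a x) * (fS η (Y \ J) J * fS η K (X \ K)) /
    (fS η J X * fS η (Y \ J) K) * SS η 1 κ K J

theorem fS_ne_zero_of_gen {X Y J K : Finset ℂ} (hg : Gen η X Y) (hJ : J ⊆ Y) (hK : K ⊆ X) :
    fS η J K ≠ 0 :=
  prod_ne_zero_iff.mpr fun y hy => prod_ne_zero_iff.mpr fun x hx =>
    div_ne_zero (hg.add' x (hK hx) y (hJ hy)) (sub_ne_zero.mpr (hg.ne x (hK hx) y (hJ hy)).symm)

theorem prod_aX_div_fS {X Y J : Finset ℂ} (hg : Gen η X Y) (hJ : J ⊆ Y) :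
    (∏ y ∈ J, aX η X y) = (∏ y ∈ J, dX X y) * fS η J X := by
  rw [fS, ← prod_mul_distrib]
  refine prod_congr rfl fun y hy => ?_
  have hyX : y ∉ X := fun h => hg.ne y h y (hJ hy) rfl
  rw [aX, ← fS_left_mul hyX, dX, fS, prod_singleton, mul_comm]

/-- The left side is the action of Q on a block state. Both sides are expanded over the states with
parameters U inside `X`, and the equality of coefficients is the composition law. -/
theorem core_action (hη : η ≠ 0) (κ : ℂ) {X : Finset ℂ} (hlag : HasLagrange X.card B)
    (hfus : ∀ x ∈ X, B (x - η) * B x = 0) (v0 : V) {Y : Finset ℂ} (hg : Gen η X Y) :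
    κ ^ Y.card • opProd B hB Y v0 = ∑ J ∈ Y.powerset, ∑ K ∈ X.powerset,
      Rset η κ (aX η X) X Y J K • opProd B hB (Y \ J) (opProd B hB K v0) := by
  have h0 := opProd_expansion hB hη hlag hfus v0 Y hg ∅ (empty_subset _)
  simp only [opProd_empty, Module.End.one_apply, sdiff_empty, fS_empty_right, empty_union,
    mul_one] at h0
  rw [h0, smul_sum]
  have step : ∀ J ∈ Y.powerset, ∑ K ∈ X.powerset,
      Rset η κ (aX η X) X Y J K • opProd B hB (Y \ J) (opProd B hB K v0) =
      ∑ U ∈ X.powerset, ∑ K ∈ U.powerset, (((∏ y ∈ Y, dX X y) * (fS η U (X \ U) /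
        ∏ t ∈ U, aX η X t)) * (fS η (Y \ J) J * fS η K (U \ K) * SS η 1 κ K J *
          SS η 0 1 (U \ K) (Y \ J))) • opProd B hB U v0 := by
    intro J hJ
    have hJ' := mem_powerset.mp hJ
    have hgJ : Gen η X (Y \ J) := hg.mono subset_rfl sdiff_subset
    rw [sum_congr rfl fun K hK => by
      rw [opProd_expansion hB hη hlag hfus v0 (Y \ J) hgJ K (mem_powerset.mp hK), smul_sum]]
    rw [sum_powerset_powerset_sdiff X fun K T => Rset η κ (aX η X) X Y J K •
      ((∏ y ∈ Y \ J, dX X y) * fS η (Y \ J) K * (fS η T ((X \ K) \ T) / (∏ t ∈ T, aX η X t)) *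
        SS η 1 0 (Y \ J) T) • opProd B hB (K ∪ T) v0]
    refine sum_congr rfl fun U hU => sum_congr rfl fun K hK => ?_
    rw [mem_powerset] at hU hK
    rw [smul_smul, union_sdiff_of_subset hK, SS_swap (hg.mono (sdiff_subset.trans hU) sdiff_subset)]
    congr 1
    have e1 : (X \ K) \ (U \ K) = X \ U := by
      rw [sdiff_sdiff_sdiff_cancel_right hK]
    have e2 : X \ K = (X \ U) ∪ (U \ K) := by
      rw [← e1, sdiff_union_of_subset (sdiff_subset_sdiff hU subset_rfl)]
    have e3 : Disjoint (X \ U) (U \ K) := disjoint_of_subset_right sdiff_subset sdiff_disjoint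
    have e4 : fS η U (X \ U) = fS η (U \ K) (X \ U) * fS η K (X \ U) := by
      rw [← fS_union_left _ sdiff_disjoint, sdiff_union_of_subset hK]
    rw [e1, e4, Rset, e2, fS_union_right _ e3, prod_aX_div_fS hg hJ', ← prod_sdiff hK,
      ← prod_sdiff (f := dX X) hJ']
    have n1 := fS_ne_zero_of_gen hg hJ' subset_rfl
    have n2 := fS_ne_zero_of_gen hg (sdiff_subset : Y \ J ⊆ Y) (hK.trans hU)
    have n3 : ∏ x ∈ K, aX η X x ≠ 0 :=
      prod_ne_zero_iff.mpr fun x hx => aX_ne_zero hη hg (hU (hK hx))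
    have n4 : ∏ x ∈ U \ K, aX η X x ≠ 0 :=
      prod_ne_zero_iff.mpr fun x hx => aX_ne_zero hη hg (hU (sdiff_subset hx))
    field_simp
  rw [sum_congr rfl step, sum_comm]
  refine sum_congr rfl fun U hU => ?_
  rw [mem_powerset] at hU
  have hgU := hg.mono hU subset_rfl
  simp only [← sum_smul, ← mul_sum]
  -- The expansion supplies the factor with (ν, l) = (0, 1) and `Rset` the one with (1, κ). They
  -- compose to (0, κ), which is κ^|Y| times (0, 1).
  rw [SS_convolution hη 1 κ 0 U Y hgU, SS_zero_left, SS_swap hgU, smul_smul]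
  congr 1
  ring

end Core

/-! ### From the first block to the whole chain. -/

section BulkAction

variable {V : Type*} [AddCommGroup V] [Module ℂ V] {η : ℂ}
  {T1 T2 : ℂ → Matrix (Fin 2) (Fin 2) (Module.End ℂ V)} {v0 : V}

/-- Action of the quasi-local operator `Q`, which counts the excitations of the first block, on
a bulk off-shell state. -/
theorem bulk_action (hη : η ≠ 0) (κ : ℂ) {X : Finset ℂ} (h2 : RTT η T2) (h1 : RTT η T1)
    (hc : ∀ u v i j k l, Commute (T2 u i j) (T1 v k l)) {a2 : ℂ → ℂ}
    (ha : ∀ u, T2 u 0 0 v0 = a2 u • v0) (hd : ∀ u, T1 u 1 1 v0 = dX X u • v0)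
    (ha2 : ∀ x ∈ X, a2 x ≠ 0)
    (hB2 : ∀ u v, Commute (T2 u 0 1) (T2 v 0 1)) (hB1 : ∀ u v, Commute (T1 u 0 1) (T1 v 0 1))
    (hB : ∀ u v, Commute ((T2 u * T1 u) 0 1) ((T2 v * T1 v) 0 1))
    (hlag : HasLagrange X.card fun u => T1 u 0 1)
    (hfus : ∀ x ∈ X, T1 (x - η) 0 1 * T1 x 0 1 = 0)
    {Q : Module.End ℂ V} (hQ1 : ∀ u, Q * T1 u 0 1 = κ • (T1 u 0 1 * Q))
    (hQ2 : ∀ u, Commute Q (T2 u 0 1)) (hQ0 : Q v0 = v0) {Y : Finset ℂ} (hg : Gen η X Y) :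
    Q (opProd (fun u => (T2 u * T1 u) 0 1) hB Y v0) = ∑ J ∈ Y.powerset, ∑ K ∈ X.powerset,
      Rset η κ (fun u => aX η X u * a2 u) X Y J K •
        opProd (fun u => (T2 u * T1 u) 0 1) hB ((Y \ J) ∪ K) v0 := by
  have happ : ∀ {X Z : Module.End ℂ V}, Commute X Z → ∀ w, X (Z w) = Z (X w) := by
    intro X Z h w
    exact congrArg (fun X : Module.End ℂ V => X w) h.eq
  set b1 : Finset ℂ → Module.End ℂ V := opProd (fun u => T1 u 0 1) hB1 with hb1
  set b2 : Finset ℂ → Module.End ℂ V := opProd (fun u => T2 u 0 1) hB2 with hb2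
  have c12 : ∀ S S', Commute (b1 S) (b2 S') := fun S S' =>
    commute_opProd hB2 (fun v => (commute_opProd hB1 (fun u => hc v u 0 1 0 1) S).symm) S'
  have hQb2 : ∀ S, Commute Q (b2 S) := fun S => commute_opProd hB2 hQ2 S
  have hQb1 : ∀ S w, Q (b1 S w) = κ ^ S.card • b1 S (Q w) := by
    intro S
    induction S using Finset.induction_on with
    | empty => intro w; simp [b1]
    | insert u S hu ih =>
      intro w
      rw [hb1, opProd_apply_insert hB1 hu, opProd_apply_insert hB1 hu, card_insert_of_notMem hu]
      have := congrArg (fun X : Module.End ℂ V => X (b1 S w)) (hQ1 u)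
      simp only [Module.End.mul_apply, LinearMap.smul_apply] at this
      rw [← hb1, this, ih, map_smul, smul_smul, pow_succ']
  have hL : Q (opProd (fun u => (T2 u * T1 u) 0 1) hB Y v0) = ∑ S ∈ Y.powerset, ∑ J ∈ S.powerset,
      ∑ K ∈ X.powerset, ((∏ s ∈ S, a2 s) * (∏ t ∈ Y \ S, dX X t) * fS η (Y \ S) S *
        Rset η κ (aX η X) X S J K) • b2 (Y \ S) (b1 (S \ J) (b1 K v0)) := by
    rw [coproduct h2 h1 hc ha hd hB2 hB1 hB, map_sum]
    refine sum_congr rfl fun S hS => ?_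
    rw [mem_powerset] at hS
    -- Q only sees the parameters S placed in the first block and multiplies that state by κ^|S|;
    -- the block identity then rewrites this multiple.
    rw [map_smul, ← hb1, ← hb2, hQb1, happ (hQb2 _), hQ0, happ (c12 _ _), ← map_smul,
      core_action hB1 hη κ hlag hfus v0 (hg.mono subset_rfl hS)]
    simp only [map_sum, map_smul, smul_sum, smul_smul]
    rfl
  have hR : ∀ J ∈ Y.powerset, ∀ K ∈ X.powerset,
      Rset η κ (fun u => aX η X u * a2 u) X Y J K •
        opProd (fun u => (T2 u * T1 u) 0 1) hB ((Y \ J) ∪ K) v0 =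
      ∑ S ∈ (Y \ J).powerset, (Rset η κ (fun u => aX η X u * a2 u) X Y J K *
        ((∏ s ∈ S ∪ K, a2 s) * (∏ t ∈ (Y \ J) \ S, dX X t) *
          fS η ((Y \ J) \ S) (S ∪ K))) • b2 ((Y \ J) \ S) (b1 S (b1 K v0)) := by
    intro J hJ K hK
    rw [mem_powerset] at hJ hK
    have hdisj : Disjoint (Y \ J) K := disjoint_left.mpr fun y hy hyK =>
      hg.ne y (hK hyK) y (mem_sdiff.mp hy).1 rfl
    rw [coproduct h2 h1 hc ha hd hB2 hB1 hB, sum_powerset_union_of_subset hdisj, smul_sum]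
    · refine sum_congr rfl fun S hS => ?_
      rw [mem_powerset] at hS
      have hSK := hdisj.mono_left hS
      have e1 : ((Y \ J) ∪ K) \ (S ∪ K) = (Y \ J) \ S := by
        ext y
        simp only [mem_sdiff, mem_union]
        have : y ∈ K → y ∉ Y \ J := fun h h' => disjoint_left.mp hdisj h' h
        rw [mem_sdiff] at this
        tauto
      rw [e1, smul_smul, ← hb2, happ (c12 (S ∪ K) _), hb1, opProd_union hB1 hSK]
      rfl
    -- A parameter of `K` left to the second block carries the D-eigenvalue of the first block,
    -- which vanishes at every point of `X`.
    · intro S hS hKS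
      obtain ⟨k, hk, hkS⟩ := not_subset.mp hKS
      have h0 : ∏ t ∈ ((Y \ J) ∪ K) \ S, dX X t = 0 :=
        prod_eq_zero (i := k) (mem_sdiff.mpr ⟨mem_union_right _ hk, hkS⟩)
          (prod_eq_zero (hK hk) (sub_self k))
      rw [h0, mul_zero, zero_mul, zero_smul]
  rw [hL, sum_congr rfl fun J hJ => (sum_congr rfl (hR J hJ)).trans sum_comm,
    sum_powerset_powerset_sdiff Y fun J S => ∑ K ∈ X.powerset,
      (Rset η κ (fun u => aX η X u * a2 u) X Y J K * ((∏ s ∈ S ∪ K, a2 s) *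
        (∏ t ∈ (Y \ J) \ S, dX X t) * fS η ((Y \ J) \ S) (S ∪ K))) •
          b2 ((Y \ J) \ S) (b1 S (b1 K v0))]
  refine sum_congr rfl fun S hS => sum_congr rfl fun J hJ => sum_congr rfl fun K hK => ?_
  rw [mem_powerset] at hS hJ hK
  have e1 : (Y \ J) \ (S \ J) = Y \ S := by rw [sdiff_sdiff_sdiff_cancel_right hJ]
  have e2 : Y \ J = (Y \ S) ∪ (S \ J) := by
    rw [← e1, sdiff_union_of_subset (sdiff_subset_sdiff hS subset_rfl)]
  have e3 : Disjoint (Y \ S) (S \ J) := disjoint_of_subset_right sdiff_subset sdiff_disjoint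
  have hdisj : Disjoint (S \ J) K := disjoint_left.mpr fun y hy hyK =>
    hg.ne y (hK hyK) y (hS (mem_sdiff.mp hy).1) rfl
  rw [e1]
  congr 1
  have e4 : fS η (Y \ S) S = fS η (Y \ S) (S \ J) * fS η (Y \ S) J := by
    rw [← fS_union_right _ sdiff_disjoint, sdiff_union_of_subset hJ]
  have n1 := fS_ne_zero_of_gen hg (hJ.trans hS) subset_rfl
  have n2 := fS_ne_zero_of_gen hg (sdiff_subset : Y \ S ⊆ Y) hK
  have n3 := fS_ne_zero_of_gen hg (sdiff_subset.trans hS : S \ J ⊆ Y) hK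
  have n4 : ∏ x ∈ K, aX η X x ≠ 0 :=
    prod_ne_zero_iff.mpr fun x hx => aX_ne_zero hη hg (hK hx)
  have n5 : ∏ x ∈ K, a2 x ≠ 0 := prod_ne_zero_iff.mpr fun x hx => ha2 x (hK hx)
  rw [Rset, Rset, e2, fS_union_left _ e3, fS_union_left _ e3, prod_union hdisj,
    fS_union_right _ hdisj, e4, ← prod_sdiff hJ, prod_mul_distrib, prod_mul_distrib]
  field_simp

end BulkAction

/-! ### Operators on single sites and the entries of the R-matrix. -/

section Sites

variable {N : ℕ}

theorem siteOp_mulVec (n : Fin N) (X : Matrix (Fin 2) (Fin 2) ℂ) (v : (Fin N → Fin 2) → ℂ)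
    (s : Fin N → Fin 2) :
    (siteOp n X).mulVec v s = ∑ a, X (s n) a * v (Function.update s n a) := by
  rw [Matrix.mulVec, dotProduct]
  symm
  refine sum_of_injOn (fun a => Function.update s n a) ?_ (by simp) ?_ ?_
  · intro a _ b _ h
    simpa using congrFun h n
  · intro t _ ht
    rw [siteOp, Matrix.of_apply, if_neg, zero_mul]
    intro h
    refine ht ⟨t n, by simp, ?_⟩
    funext k
    by_cases hk : k = n
    · subst hk; simp
    · simp [hk, h k hk]
  · intro a _
    rw [siteOp, Matrix.of_apply, if_pos]
    · simp
    · intro k hk; simp [hk]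

theorem spinOp_ext {P Q : SpinOp N} (h : ∀ v s, P.mulVec v s = Q.mulVec v s) : P = Q := by
  apply Matrix.toLin'.injective
  refine LinearMap.ext fun v => ?_
  simp only [Matrix.toLin'_apply]
  funext s
  exact h v s

theorem siteOp_mul (n : Fin N) (X Y : Matrix (Fin 2) (Fin 2) ℂ) :
    siteOp n (X * Y) = siteOp n X * siteOp n Y := by
  refine spinOp_ext fun v s => ?_
  rw [← Matrix.mulVec_mulVec]
  simp only [siteOp_mulVec, Fin.sum_univ_two, Matrix.mul_apply, Function.update_idem,
    Function.update_self]
  ring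

theorem siteOp_one (n : Fin N) : siteOp n 1 = (1 : SpinOp N) := by
  refine spinOp_ext fun v s => ?_
  rw [siteOp_mulVec, Matrix.one_mulVec, sum_eq_single (s n)]
  · simp
  · intro a _ ha; simp [Matrix.one_apply_ne ha.symm]
  · simp

/-- The embedding of the operators on one site. -/
def siteHom (n : Fin N) : Matrix (Fin 2) (Fin 2) ℂ →ₐ[ℂ] SpinOp N :=
  AlgHom.ofLinearMap
    { toFun := siteOp n
      map_add' := fun X Y => by
        refine spinOp_ext fun v s => ?_
        rw [Matrix.add_mulVec, Pi.add_apply]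
        simp only [siteOp_mulVec, Fin.sum_univ_two, Matrix.add_apply]
        ring
      map_smul' := fun c X => by
        refine spinOp_ext fun v s => ?_
        rw [Matrix.smul_mulVec, Pi.smul_apply]
        simp only [siteOp_mulVec, Fin.sum_univ_two, Matrix.smul_apply, smul_eq_mul,
          RingHom.id_apply]
        ring }
    (siteOp_one n) (siteOp_mul n)

theorem siteHom_apply (n : Fin N) (X : Matrix (Fin 2) (Fin 2) ℂ) : siteHom n X = siteOp n X := rfl

theorem siteOp_commute {n n' : Fin N} (h : n ≠ n') (X Y : Matrix (Fin 2) (Fin 2) ℂ) :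
    Commute (siteOp n X) (siteOp n' Y) := by
  refine spinOp_ext fun v s => ?_
  rw [← Matrix.mulVec_mulVec, ← Matrix.mulVec_mulVec]
  simp only [siteOp_mulVec, Fin.sum_univ_two, Function.update_of_ne h, Function.update_of_ne h.symm,
    Function.update_comm h]
  ring

theorem siteOp_mulVec_refState (n : Fin N) {X : Matrix (Fin 2) (Fin 2) ℂ} (hX : X 1 0 = 0) :
    (siteOp n X).mulVec (refState N) = X 0 0 • refState N := by
  funext s
  rw [siteOp_mulVec, Pi.smul_apply, smul_eq_mul, Fin.sum_univ_two]
  have h1 : refState N (Function.update s n 1) = 0 := by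
    rw [refState, Pi.single_apply, if_neg]
    intro h
    simpa using congrFun h n
  rw [h1, mul_zero, add_zero]
  have hs : s n = 0 ∨ s n = 1 := by
    generalize s n = a
    fin_cases a <;> simp
  rcases hs with h | h
  · rw [h, ← h, Function.update_eq_self, h]
  · have h2 : refState N s = 0 := by
      rw [refState, Pi.single_apply, if_neg]
      rintro rfl
      simp at h
    rw [h, hX, h2, zero_mul, mul_zero]

/-- The entries of the six-vertex `R`-matrix with respect to its first space. -/
def lam (η u : ℂ) : Matrix (Fin 2) (Fin 2) (Matrix (Fin 2) (Fin 2) ℂ) :=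
  Matrix.of fun i j => Matrix.of fun s t => Rmat η u (i, s) (j, t)

theorem lam_eq (η u : ℂ) : lam η u =
    !![!![u + η, 0; 0, u], !![0, 0; η, 0]; !![0, η; 0, 0], !![u, 0; 0, u + η]] := by
  ext i j s t
  fin_cases i <;> fin_cases j <;> fin_cases s <;> fin_cases t <;> simp [lam, Rmat]

theorem lam_rtt (η c : ℂ) : RTT η fun u => lam η (u - c) := by
  intro u v i j k l
  simp only [lam_eq]
  fin_cases i <;> fin_cases j <;> fin_cases k <;> fin_cases l <;> ext s t <;>
    fin_cases s <;> fin_cases t <;> simp <;> first | ring1 | (left; ring1)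

/-- R(-η) is proportional to the antisymmetrizer and R(0) to the permutation, so the product is
antisymmetric in the two auxiliary column indices. -/
theorem lam_fusion (η : ℂ) (i k a b : Fin 2) :
    lam η (-η) i a * lam η 0 k b + lam η (-η) i b * lam η 0 k a = 0 := by
  simp only [lam_eq]
  fin_cases i <;> fin_cases k <;> fin_cases a <;> fin_cases b <;> ext s t <;>
    fin_cases s <;> fin_cases t <;> simp

theorem Lax_rtt (η c : ℂ) (n : Fin N) : RTT η fun u => Lax η (u - c) n :=
  (lam_rtt η c).map (siteHom n)

end Sites

/-! ### Monodromy matrices of lists of sites: exchange, vacuum, degree and fusion. -/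

section Monodromy

variable {N : ℕ} (η : ℂ) (ξ : Fin N → ℂ)

/-- The monodromy matrix of the sites of a list. -/
def mon (l : List (Fin N)) (u : ℂ) : AuxOp N :=
  (l.map fun n => Lax η (u - ξ n - η / 2) n).reverse.prod

theorem mon_nil (u : ℂ) : mon η ξ [] u = 1 := rfl

theorem mon_cons (n : Fin N) (l : List (Fin N)) (u : ℂ) :
    mon η ξ (n :: l) u = mon η ξ l u * Lax η (u - ξ n - η / 2) n := by
  simp [mon]

theorem mon_append (l l' : List (Fin N)) (u : ℂ) :
    mon η ξ (l ++ l') u = mon η ξ l' u * mon η ξ l u := by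
  simp [mon]

theorem monodromy_eq_mon (u : ℂ) : monodromy η ξ u = mon η ξ (List.finRange N) u := by
  rw [monodromy, mon, List.ofFn_eq_map]

variable {η ξ}

theorem mon_cons_apply (n : Fin N) (l : List (Fin N)) (u : ℂ) (i j : Fin 2) :
    mon η ξ (n :: l) u i j =
      mon η ξ l u i 0 * siteOp n (lam η (u - ξ n - η / 2) 0 j) +
      mon η ξ l u i 1 * siteOp n (lam η (u - ξ n - η / 2) 1 j) := by
  rw [mon_cons, Matrix.mul_apply, Fin.sum_univ_two]
  rfl

theorem mon_commute_siteOp {n : Fin N} {l : List (Fin N)} (h : n ∉ l) (u : ℂ) (i j : Fin 2)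
    (X : Matrix (Fin 2) (Fin 2) ℂ) : Commute (mon η ξ l u i j) (siteOp n X) := by
  induction l generalizing i j with
  | nil =>
    rw [mon_nil]
    by_cases hij : i = j
    · subst hij; rw [Matrix.one_apply_eq]; exact Commute.one_left _
    · rw [Matrix.one_apply_ne hij]; exact Commute.zero_left _
  | cons n' l ih =>
    rw [List.mem_cons, not_or] at h
    rw [mon_cons_apply]
    exact ((ih h.2 i 0).mul_left (siteOp_commute (Ne.symm h.1) _ _)).add_left
      ((ih h.2 i 1).mul_left (siteOp_commute (Ne.symm h.1) _ _))

theorem mon_commute {l l' : List (Fin N)} (h : l.Disjoint l') (u v : ℂ) (i j i' j' : Fin 2) :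
    Commute (mon η ξ l u i j) (mon η ξ l' v i' j') := by
  induction l' generalizing i' j' with
  | nil =>
    rw [mon_nil]
    by_cases hij : i' = j'
    · subst hij; rw [Matrix.one_apply_eq]; exact Commute.one_right _
    · rw [Matrix.one_apply_ne hij]; exact Commute.zero_right _
  | cons n l' ih =>
    rw [List.disjoint_cons_right] at h
    rw [mon_cons_apply]
    exact ((ih h.2 i' 0).mul_right (mon_commute_siteOp h.1 _ _ _ _)).add_right
      ((ih h.2 i' 1).mul_right (mon_commute_siteOp h.1 _ _ _ _))

theorem mon_rtt {l : List (Fin N)} (h : l.Nodup) : RTT η (mon η ξ l) := by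
  induction l with
  | nil =>
    have h1 := RTT.const (A := SpinOp N) η 1
    have e : mon η ξ [] = fun _ => (1 : Matrix (Fin 2) (Fin 2) ℂ).map (algebraMap ℂ (SpinOp N)) := by
      funext u
      rw [mon_nil, Matrix.map_one _ (map_zero _) (map_one _)]
    rw [e]
    exact h1
  | cons n l ih =>
    rw [List.nodup_cons] at h
    have h1 := (ih h.2).mul (Lax_rtt η (ξ n + η / 2) n) fun u v i j k l =>
      mon_commute_siteOp h.1 u i j _
    have e : mon η ξ (n :: l) = fun u => mon η ξ l u * Lax η (u - (ξ n + η / 2)) n :=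
      funext fun u => by rw [mon_cons, sub_sub]
    rw [e]
    exact h1

theorem mon_mulVec_refState (l : List (Fin N)) (h : l.Nodup) (u : ℂ) :
    (mon η ξ l u 0 0).mulVec (refState N) =
        (l.map fun n => u - ξ n + η / 2).prod • refState N ∧
      (mon η ξ l u 1 0).mulVec (refState N) = 0 ∧
      (mon η ξ l u 1 1).mulVec (refState N) =
        (l.map fun n => u - ξ n - η / 2).prod • refState N := by
  induction l with
  | nil => simp [mon_nil]
  | cons n l ih =>
    rw [List.nodup_cons] at h
    obtain ⟨hA, hC, hD⟩ := ih h.2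
    have h00 : (siteOp n (lam η (u - ξ n - η / 2) 0 0)).mulVec (refState N) =
        (u - ξ n + η / 2) • refState N := by
      rw [siteOp_mulVec_refState n (by simp [lam_eq])]
      congr 1
      simp [lam_eq]; ring
    have h10 : (siteOp n (lam η (u - ξ n - η / 2) 1 0)).mulVec (refState N) = 0 := by
      rw [siteOp_mulVec_refState n (by simp [lam_eq])]
      simp [lam_eq]
    have h11 : (siteOp n (lam η (u - ξ n - η / 2) 1 1)).mulVec (refState N) =
        (u - ξ n - η / 2) • refState N := by
      rw [siteOp_mulVec_refState n (by simp [lam_eq])]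
      simp [lam_eq]
    simp only [mon_cons_apply, Matrix.add_mulVec, ← Matrix.mulVec_mulVec, h00, h10, h11,
      Matrix.mulVec_smul, Matrix.mulVec_zero, add_zero, hA, hC, hD, List.map_cons, List.prod_cons,
      smul_smul, smul_zero, true_and]
    -- The off-diagonal operator of the new site does not preserve the reference state; it is moved
    -- to the left so that C meets that state first and annihilates it.
    rw [Matrix.mulVec_mulVec, (mon_commute_siteOp h.1 u 1 0 _).eq, ← Matrix.mulVec_mulVec, hC,
      Matrix.mulVec_zero, zero_add]

/-- An operator valued polynomial function of degree less than `d`. -/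
def IsPolyOp {A : Type*} [Ring A] [Algebra ℂ A] (d : ℕ) (F : ℂ → A) : Prop :=
  ∃ c : ℕ → A, ∀ u, F u = ∑ i ∈ range d, u ^ i • c i

namespace IsPolyOp

variable {A : Type*} [Ring A] [Algebra ℂ A] {d : ℕ} {F G : ℂ → A}

theorem add (hF : IsPolyOp d F) (hG : IsPolyOp d G) : IsPolyOp d fun u => F u + G u := by
  obtain ⟨c, hc⟩ := hF
  obtain ⟨c', hc'⟩ := hG
  exact ⟨fun i => c i + c' i, fun u => by simp [hc, hc', sum_add_distrib]⟩

theorem mul_const (hF : IsPolyOp d F) (P : A) : IsPolyOp d fun u => F u * P := by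
  obtain ⟨c, hc⟩ := hF
  exact ⟨fun i => c i * P, fun u => by simp [hc, sum_mul]⟩

theorem succ (hF : IsPolyOp d F) : IsPolyOp (d + 1) F := by
  obtain ⟨c, hc⟩ := hF
  refine ⟨fun i => if i < d then c i else 0, fun u => ?_⟩
  simp only [hc, sum_range_succ, lt_irrefl, if_false, smul_zero, add_zero]
  exact sum_congr rfl fun i hi => by rw [if_pos (mem_range.mp hi)]

theorem shift (hF : IsPolyOp d F) : IsPolyOp (d + 1) fun u => u • F u := by
  obtain ⟨c, hc⟩ := hF
  refine ⟨fun i => if i = 0 then 0 else c (i - 1), fun u => ?_⟩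
  simp only [hc, sum_range_succ', smul_sum]
  simp [smul_smul, pow_succ']

theorem mul_linear (hF : IsPolyOp d F) (P Q : A) :
    IsPolyOp (d + 1) fun u => F u * (u • P + Q) := by
  have := (hF.mul_const P).shift.add (hF.mul_const Q).succ
  simpa only [mul_add, mul_smul_comm] using this

theorem lagrange (hF : IsPolyOp d F) {S : Finset ℂ} (hS : S.card = d) (u : ℂ) :
    F u = ∑ b ∈ S, (∏ b' ∈ S.erase b, (u - b') / (b - b')) • F b := by
  obtain ⟨c, hc⟩ := hF
  simp only [hc, smul_sum, smul_smul]
  rw [sum_comm]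
  refine sum_congr rfl fun i hi => ?_
  rw [← sum_smul]
  congr 1
  have hp : IsPoly i fun u => u ^ i := ⟨Polynomial.X ^ i, by simp, by simp⟩
  rw [hp.lagrange (S := S) (by rw [hS]; exact mem_range.mp hi) u]
  exact sum_congr rfl fun b _ => mul_comm _ _

end IsPolyOp

theorem siteOp_lam_linear (n : Fin N) (c : ℂ) (i : Fin 2) :
    ∃ P Q : SpinOp N, ∀ u, siteOp n (lam η (u - c) i i) = u • P + Q := by
  refine ⟨siteOp n 1, siteOp n (lam η (-c) i i), fun u => ?_⟩
  simp only [← siteHom_apply, ← map_smul, ← map_add]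
  congr 1
  simp only [lam_eq]
  fin_cases i <;> ext s t <;> fin_cases s <;> fin_cases t <;> simp <;> ring

theorem siteOp_lam_const (n : Fin N) (c : ℂ) {i j : Fin 2} (hij : i ≠ j) (u : ℂ) :
    siteOp n (lam η (u - c) i j) = siteOp n (lam η 0 i j) := by
  congr 1
  simp only [lam_eq]
  fin_cases i <;> fin_cases j <;> simp at hij ⊢

/-- Diagonal entries of a single site are linear in u and off-diagonal ones constant, so A and B
must be treated together. The bound is strict: B has degree less than the number of sites, the
number of nodes used in the interpolation. -/
theorem mon_isPolyOp (l : List (Fin N)) :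
    IsPolyOp (l.length + 1) (fun u => mon η ξ l u 0 0) ∧
      IsPolyOp l.length fun u => mon η ξ l u 0 1 := by
  induction l with
  | nil =>
    simp only [mon_nil]
    exact ⟨⟨fun _ => 1, fun u => by simp⟩, ⟨fun _ => 0, fun u => by simp⟩⟩
  | cons n l ih =>
    obtain ⟨P, Q, h0⟩ := siteOp_lam_linear (η := η) n (ξ n + η / 2) 0
    obtain ⟨P', Q', h1⟩ := siteOp_lam_linear (η := η) n (ξ n + η / 2) 1
    simp only [mon_cons_apply, sub_sub, h0, h1, siteOp_lam_const n _ (zero_ne_one),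
      siteOp_lam_const n _ (one_ne_zero), List.length_cons]
    exact ⟨(ih.1.mul_linear P Q).add (ih.2.mul_const _).succ.succ,
      (ih.1.mul_const _).add (ih.2.mul_linear P' Q')⟩

/-- Antisymmetry in the column indices is created at the site n by the R-matrix and preserved by
each further site. For equal column indices it says that the product vanishes. -/
theorem mon_fusion (hη : η ≠ 0) {l : List (Fin N)} (h : l.Nodup) {n : Fin N} (hn : n ∈ l) (i k a b : Fin 2) :
    mon η ξ l (ξ n + η / 2 - η) i a * mon η ξ l (ξ n + η / 2) k b +
      mon η ξ l (ξ n + η / 2 - η) i b * mon η ξ l (ξ n + η / 2) k a = 0 := by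
  induction l generalizing i k a b with
  | nil => simp at hn
  | cons n' l ih =>
    rw [List.nodup_cons] at h
    set u := ξ n + η / 2 - η with hu
    set v := ξ n + η / 2 with hv
    have huv : u - v = -η := by rw [hu]; ring
    have key : ∀ c d a b, mon η ξ l u i c * siteOp n' (lam η (u - ξ n' - η / 2) c a) *
        (mon η ξ l v k d * siteOp n' (lam η (v - ξ n' - η / 2) d b)) =
        mon η ξ l u i c * mon η ξ l v k d *
          siteOp n' (lam η (u - ξ n' - η / 2) c a * lam η (v - ξ n' - η / 2) d b) := by
      intro c d a b
      rw [siteOp_mul, mul_assoc, ← mul_assoc (siteOp n' _),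
        ← (mon_commute_siteOp h.1 v k d _).eq, mul_assoc, mul_assoc]
    have expand : mon η ξ (n' :: l) u i a * mon η ξ (n' :: l) v k b +
        mon η ξ (n' :: l) u i b * mon η ξ (n' :: l) v k a =
        ∑ c, ∑ d, mon η ξ l u i c * mon η ξ l v k d * siteOp n'
          (lam η (u - ξ n' - η / 2) c a * lam η (v - ξ n' - η / 2) d b +
            lam η (u - ξ n' - η / 2) c b * lam η (v - ξ n' - η / 2) d a) := by
      simp only [← siteHom_apply, map_add, mul_add]
      simp only [siteHom_apply, Fin.sum_univ_two, ← key, mon_cons_apply]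
      noncomm_ring
    rw [expand]
    by_cases hnn : n' = n
    · subst hnn
      have e1 : u - ξ n' - η / 2 = -η := by rw [hu]; ring
      have e2 : v - ξ n' - η / 2 = 0 := by rw [hv]; ring
      refine sum_eq_zero fun c _ => sum_eq_zero fun d _ => ?_
      rw [e1, e2, lam_fusion, ← siteHom_apply, map_zero, mul_zero]
    · have hn' : n ∈ l := (List.mem_cons.mp hn).resolve_left fun h => hnn h.symm
      -- At u - v = -η, adding two instances of the exchange relation shows that the part of the
      -- site operators symmetric in (a, b) is also symmetric in (c, d). Its contraction with the
      -- antisymmetric monodromy of the remaining sites is zero.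
      have hS : ∀ c d : Fin 2, lam η (u - ξ n' - η / 2) c a * lam η (v - ξ n' - η / 2) d b +
          lam η (u - ξ n' - η / 2) c b * lam η (v - ξ n' - η / 2) d a =
          lam η (u - ξ n' - η / 2) d a * lam η (v - ξ n' - η / 2) c b +
          lam η (u - ξ n' - η / 2) d b * lam η (v - ξ n' - η / 2) c a := by
        intro c d
        have h1 := lam_rtt η (ξ n' + η / 2) u v c a d b
        have h2 := lam_rtt η (ξ n' + η / 2) u v c b d a
        simp only [← sub_sub _ (ξ n'), huv] at h1 h2
        apply smul_right_injective _ hη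
        linear_combination (norm := module) -h1 - h2
      have hM := ih h.2 hn'
      have h00 := hM i k 0 0
      have h11 := hM i k 1 1
      have h01 := hM i k 0 1
      have two : ∀ z : SpinOp N, z + z = 0 → z = 0 := by
        intro z hz
        rw [← two_smul ℂ] at hz
        exact (smul_eq_zero.mp hz).resolve_left two_ne_zero
      simp only [Fin.sum_univ_two]
      rw [two _ h00, two _ h11, hS 1 0, zero_mul, zero_mul, zero_add, add_zero, ← add_mul, h01,
        zero_mul]

end Monodromy

/-! ### Action of the quasi-local operator on twisted bulk states. -/

section Bulk

variable {N : ℕ} {η : ℂ} {ξ : Fin N → ℂ}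

theorem opProd_congr {V : Type*} [AddCommGroup V] [Module ℂ V] {B B' : ℂ → Module.End ℂ V}
    (h : B = B') (hB : ∀ u v, Commute (B u) (B v)) (hB' : ∀ u v, Commute (B' u) (B' v))
    (Y : Finset ℂ) : opProd B hB Y = opProd B' hB' Y := by
  subst h; rfl

/-- Operators on the chain as endomorphisms. -/
def toEnd (N : ℕ) : SpinOp N →ₐ[ℂ] Module.End ℂ ((Fin N → Fin 2) → ℂ) :=
  (Matrix.toLinAlgEquiv' (R := ℂ) (n := Fin N → Fin 2)).toAlgHom

theorem toEnd_apply (X : SpinOp N) (v : (Fin N → Fin 2) → ℂ) : toEnd N X v = X.mulVec v :=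
  Matrix.toLinAlgEquiv'_apply X v

/-- The product over a list of sites of the local operators `E^{11} + κ E^{22}`. -/
def diagProd (κ : ℂ) (l : List (Fin N)) : SpinOp N :=
  (l.map fun n => siteOp n !![1, 0; 0, κ]).prod

theorem diagProd_cons (κ : ℂ) (n : Fin N) (l : List (Fin N)) :
    diagProd κ (n :: l) = siteOp n !![1, 0; 0, κ] * diagProd κ l := by
  simp [diagProd]

theorem Qop_eq_diagProd {m : ℕ} (hm : m ≤ N) (κ : ℂ) :
    Qop m hm κ = diagProd κ (List.ofFn (Fin.castLE hm)) := by
  rw [Qop, diagProd, List.map_ofFn]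
  rfl

theorem diagProd_commute_siteOp {n : Fin N} {l : List (Fin N)} (h : n ∉ l) (κ : ℂ)
    (X : Matrix (Fin 2) (Fin 2) ℂ) : Commute (diagProd κ l) (siteOp n X) := by
  induction l with
  | nil => exact Commute.one_left _
  | cons n' l ih =>
    rw [List.mem_cons, not_or] at h
    rw [diagProd_cons]
    exact (siteOp_commute (Ne.symm h.1) _ _).mul_left (ih h.2)

theorem diagProd_commute_mon {l l' : List (Fin N)} (h : l.Disjoint l') (κ u : ℂ) (i j : Fin 2) :
    Commute (diagProd κ l) (mon η ξ l' u i j) := by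
  induction l with
  | nil => exact Commute.one_left _
  | cons n l ih =>
    rw [List.disjoint_cons_left] at h
    rw [diagProd_cons]
    exact (mon_commute_siteOp h.1 u i j _).symm.mul_left (ih h.2)

theorem diagProd_mulVec_refState (κ : ℂ) (l : List (Fin N)) :
    (diagProd κ l).mulVec (refState N) = refState N := by
  induction l with
  | nil => simp [diagProd]
  | cons n l ih =>
    rw [diagProd_cons, ← Matrix.mulVec_mulVec, ih, siteOp_mulVec_refState n (by simp)]
    simp

/-- This is the ice rule. Powers of κ stand on both sides because κ = 0 is allowed and cannot be
divided by. -/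
theorem diag_mul_lam (κ u : ℂ) (i j : Fin 2) :
    κ ^ (i : ℕ) • (!![1, 0; 0, κ] * lam η u i j) = κ ^ (j : ℕ) • (lam η u i j * !![1, 0; 0, κ]) := by
  simp only [lam_eq]
  fin_cases i <;> fin_cases j <;> ext s t <;> fin_cases s <;> fin_cases t <;>
    simp [mul_comm]

/-- Conservation of the number of down spins. -/
theorem diagProd_mul_mon (κ : ℂ) {l : List (Fin N)} (h : l.Nodup) (u : ℂ) (i j : Fin 2) :
    κ ^ (i : ℕ) • (diagProd κ l * mon η ξ l u i j) =
      κ ^ (j : ℕ) • (mon η ξ l u i j * diagProd κ l) := by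
  induction l generalizing i j with
  | nil =>
    rw [mon_nil]
    by_cases hij : i = j
    · subst hij; simp [diagProd]
    · simp [diagProd, Matrix.one_apply_ne hij]
  | cons n l ih =>
    rw [List.nodup_cons] at h
    set D := siteOp n !![1, 0; 0, κ] with hD
    have key : ∀ k, κ ^ (i : ℕ) • (D * diagProd κ l *
        (mon η ξ l u i k * siteOp n (lam η (u - ξ n - η / 2) k j))) =
        κ ^ (j : ℕ) • (mon η ξ l u i k * siteOp n (lam η (u - ξ n - η / 2) k j) *
          (D * diagProd κ l)) := by
      intro k
      set L := siteOp n (lam η (u - ξ n - η / 2) k j) with hL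
      have h1 : κ ^ (k : ℕ) • (D * L) = κ ^ (j : ℕ) • (L * D) := by
        rw [hD, hL, ← siteOp_mul, ← siteOp_mul, ← siteHom_apply, ← siteHom_apply, ← map_smul,
          diag_mul_lam, map_smul]
      calc _ = D * (κ ^ (i : ℕ) • (diagProd κ l * mon η ξ l u i k)) * L := by
            simp only [mul_smul_comm, smul_mul_assoc, mul_assoc]
        _ = κ ^ (k : ℕ) • (D * mon η ξ l u i k * (diagProd κ l * L)) := by
            rw [ih h.2]
            simp only [mul_smul_comm, smul_mul_assoc, mul_assoc]
        _ = mon η ξ l u i k * (κ ^ (k : ℕ) • (D * L)) * diagProd κ l := by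
            rw [← (mon_commute_siteOp h.1 u i k _).eq, (diagProd_commute_siteOp h.1 κ _).eq]
            simp only [mul_smul_comm, smul_mul_assoc, mul_assoc, hD, hL]
        _ = _ := by
            rw [h1]
            simp only [mul_smul_comm, smul_mul_assoc, mul_assoc]
    rw [diagProd_cons, mon_cons_apply, mul_add, add_mul, smul_add, smul_add, key, key]

/-- The monodromy matrix twisted by an upper unitriangular matrix. -/
def twisted (η : ℂ) (ξ : Fin N → ℂ) (ε u : ℂ) :
    Matrix (Fin 2) (Fin 2) (Module.End ℂ ((Fin N → Fin 2) → ℂ)) :=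
  (auxScalar N !![1, ε; 0, 1] * monodromy η ξ u).map (toEnd N)

theorem auxScalar_mul_apply (ε : ℂ) (T : AuxOp N) (j : Fin 2) :
    (auxScalar N !![1, ε; 0, 1] * T) 0 j = T 0 j + ε • T 1 j ∧
      (auxScalar N !![1, ε; 0, 1] * T) 1 j = T 1 j := by
  simp [auxScalar, Matrix.mul_apply, Fin.sum_univ_two, Algebra.smul_def]

theorem auxScalar_mul_rtt (ε : ℂ) {l : List (Fin N)} (h : l.Nodup) :
    RTT η fun u => auxScalar N !![1, ε; 0, 1] * mon η ξ l u :=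
  (RTT.const η !![1, ε; 0, 1]).mul (mon_rtt h) fun _ _ _ _ _ _ => by
    rw [Matrix.map_apply]; exact Algebra.commutes _ _

theorem twisted_rtt (η : ℂ) (ξ : Fin N → ℂ) (ε : ℂ) : RTT η (twisted η ξ ε) := by
  have h := (auxScalar_mul_rtt (η := η) (ξ := ξ) ε (List.nodup_finRange N)).map (toEnd N)
  simp only [← monodromy_eq_mon] at h
  exact h

theorem twisted_comm (hη : η ≠ 0) (ξ : Fin N → ℂ) (ε : ℂ) (u v : ℂ) :
    Commute (twisted η ξ ε u 0 1) (twisted η ξ ε v 0 1) :=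
  (twisted_rtt η ξ ε).commute_self hη 0 1 u v

/-- The off-shell bulk state. -/
def bulkState (hη : η ≠ 0) (ξ : Fin N → ℂ) (ε : ℂ) (Y : Finset ℂ) : (Fin N → Fin 2) → ℂ :=
  opProd (fun u => twisted η ξ ε u 0 1) (twisted_comm hη ξ ε) Y (refState N)

/-- The inhomogeneities of the first `m` sites. -/
def nodes {m : ℕ} (hm : m ≤ N) (η : ℂ) (ξ : Fin N → ℂ) : Finset ℂ := univ.image (xi0 hm η ξ)

theorem GenericInhom.injective (h : GenericInhom η ξ) : Function.Injective ξ := by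
  intro j k hjk
  by_contra hne
  exact (h.2 j k hne).1 (by simp [hjk])

theorem GenericInhom.xi0_injective (h : GenericInhom η ξ) {m : ℕ} (hm : m ≤ N) :
    Function.Injective (xi0 hm η ξ) := fun j k hjk =>
  Fin.castLE_injective hm (h.injective (by simpa [xi0] using hjk))

/-- The action of `Q_m(κ)` on an off-shell bulk state. -/
theorem Qop_bulkState (hη : η ≠ 0) (hξ : GenericInhom η ξ) {m : ℕ} (hm : m ≤ N) (κ ε : ℂ)
    {Y : Finset ℂ} (hg : Gen η (nodes hm η ξ) Y) :
    (Qop m hm κ).mulVec (bulkState hη ξ ε Y) =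
      ∑ J ∈ Y.powerset, ∑ K ∈ (nodes hm η ξ).powerset,
        Rset η κ (aFun η ξ) (nodes hm η ξ) Y J K • bulkState hη ξ ε ((Y \ J) ∪ K) := by
  obtain ⟨k, hk⟩ := Nat.exists_eq_add_of_le hm
  set l1 : List (Fin N) := List.ofFn (Fin.castLE hm) with hl1
  obtain ⟨l2, hl2⟩ : ∃ l2, List.finRange N = l1 ++ l2 := by
    subst hk
    exact ⟨_, by rw [← List.ofFn_id, List.ofFn_add]; rfl⟩
  have hnd : (l1 ++ l2).Nodup := hl2 ▸ List.nodup_finRange N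
  obtain ⟨hnd1, hnd2, hdis⟩ := List.nodup_append'.mp hnd
  set T1 := fun u => (mon η ξ l1 u).map (toEnd N) with hT1
  -- The twist is attached to the leftmost factor, that is, to the second block. The first block
  -- keeps its plain B, whose excitations Q counts, and the twisted entry of the second block still
  -- commutes with Q.
  set T2 := fun u => (auxScalar N !![1, ε; 0, 1] * mon η ξ l2 u).map (toEnd N) with hT2
  have hT : ∀ u, T2 u * T1 u = twisted η ξ ε u := by
    intro u
    rw [hT1, hT2, twisted, monodromy_eq_mon, hl2, mon_append, ← mul_assoc, Matrix.map_mul]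
  have hxi : ∀ n : Fin m, xi0 hm η ξ n = ξ (Fin.castLE hm n) + η / 2 := fun _ => rfl
  have hprod : ∀ F : ℂ → ℂ, ∏ x ∈ nodes hm η ξ, F x = (l1.map fun n => F (ξ n + η / 2)).prod := by
    intro F
    rw [nodes, prod_image fun a _ b _ h => hξ.xi0_injective hm h, hl1, List.map_ofFn, List.prod_ofFn]
    rfl
  have hlen : (nodes hm η ξ).card = l1.length := by
    rw [nodes, card_image_of_injective _ (hξ.xi0_injective hm)]
    simp [hl1]
  have ha : ∀ u, aFun η ξ u = aX η (nodes hm η ξ) u * (l2.map fun n => u - ξ n + η / 2).prod := by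
    intro u
    rw [aX, hprod, aFun, ← List.prod_ofFn, List.ofFn_eq_map, hl2, List.map_append, List.prod_append]
    congr 3
    funext n
    ring
  have hc : ∀ u v i j k l, Commute (T2 u i j) (T1 v k l) := by
    intro u v i j k l
    refine Commute.map ?_ (toEnd N)
    have h0 : ∀ i j, Commute (mon η ξ l2 u i j) (mon η ξ l1 v k l) := fun i j =>
      mon_commute hdis.symm u v i j k l
    fin_cases i
    · refine (congrArg (fun X => Commute X _) (auxScalar_mul_apply ε (mon η ξ l2 u) j).1).mpr ?_
      exact (h0 0 j).add_left ((h0 1 j).smul_left ε)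
    · refine (congrArg (fun X => Commute X _) (auxScalar_mul_apply ε (mon η ξ l2 u) j).2).mpr ?_
      exact h0 1 j
  have h1 : RTT η T1 := (mon_rtt hnd1).map (toEnd N)
  have h2 : RTT η T2 := (auxScalar_mul_rtt ε hnd2).map (toEnd N)
  have key := bulk_action (v0 := refState N) (Q := toEnd N (diagProd κ l1))
    (a2 := fun u => (l2.map fun n => u - ξ n + η / 2).prod) hη κ h2 h1 hc ?_ ?_ ?_
    (h2.commute_self hη 0 1) (h1.commute_self hη 0 1) ((h2.mul h1 hc).commute_self hη 0 1)
    ?_ ?_ ?_ ?_ ?_ hg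
  · rw [toEnd_apply] at key
    have hbs : ∀ S, opProd (fun u => (T2 u * T1 u) 0 1) ((h2.mul h1 hc).commute_self hη 0 1) S
        (refState N) = bulkState hη ξ ε S := by
      intro S
      rw [bulkState]
      congr 1
      exact opProd_congr (funext fun u => by rw [hT]) _ _ S
    simp only [hbs, ← ha] at key
    rw [Qop_eq_diagProd]
    exact key
  · intro u
    obtain ⟨hA, hC, -⟩ := mon_mulVec_refState (η := η) (ξ := ξ) l2 hnd2 u
    rw [hT2]
    simp only [Matrix.map_apply, toEnd_apply]
    rw [(auxScalar_mul_apply ε _ 0).1, Matrix.add_mulVec, Matrix.smul_mulVec, hA, hC, smul_zero,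
      add_zero]
  · intro u
    rw [dX, hprod, hT1]
    simp only [Matrix.map_apply, toEnd_apply, ← sub_sub]
    exact (mon_mulVec_refState l1 hnd1 u).2.2
  · intro x hx
    obtain ⟨n, -, rfl⟩ := mem_image.mp hx
    rw [Ne, List.prod_eq_zero_iff, List.mem_map]
    rintro ⟨k, hk, h0⟩
    have hne : Fin.castLE hm n ≠ k := fun h => hdis (by simp [hl1]) (h ▸ hk)
    refine (hξ.2 _ _ hne).1 ?_
    rw [hxi] at h0
    simp only [Set.mem_insert_iff, Set.mem_singleton_iff]
    right; left
    linear_combination h0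
  · intro S hS u
    have h := (mon_isPolyOp (η := η) (ξ := ξ) l1).2.lagrange (hS.trans hlen) u
    have h' := congrArg (toEnd N) h
    simpa [hT1] using h'
  · intro x hx
    obtain ⟨n, -, rfl⟩ := mem_image.mp hx
    -- Both column indices are 1, so the antisymmetry relation is twice the product of two B
    -- operators.
    have h := mon_fusion (ξ := ξ) hη hnd1 (n := Fin.castLE hm n) (by simp [hl1]) 0 0 1 1
    rw [← two_smul ℂ] at h
    have h' := congrArg (toEnd N) ((smul_eq_zero.mp h).resolve_left two_ne_zero)
    simpa [hT1, hxi] using h'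
  · intro u
    have h := congrArg (toEnd N) (diagProd_mul_mon (η := η) (ξ := ξ) κ hnd1 u 0 1)
    simpa [hT1] using h
  · intro u
    refine Commute.map ?_ (toEnd N)
    rw [(auxScalar_mul_apply ε (mon η ξ l2 u) 1).1]
    exact (diagProd_commute_mon hdis κ u 0 1).add_right
      ((diagProd_commute_mon hdis κ u 1 1).smul_right ε)
  · rw [toEnd_apply, diagProd_mulVec_refState]

end Bulk

/-! ### Sums over the signs of a set of parameters. -/

section Signs

/-- No two elements of `S`, equal or not, add up to zero. -/
def SignFree (S : Finset ℂ) : Prop := ∀ x ∈ S, ∀ y ∈ S, x + y ≠ 0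

theorem SignFree.mono {S S' : Finset ℂ} (h : SignFree S) (hS : S' ⊆ S) : SignFree S' :=
  fun x hx y hy => h x (hS hx) y (hS hy)

/-- `Y` is obtained from `S` by changing signs. -/
def IsSection (S Y : Finset ℂ) : Prop :=
  SignFree Y ∧ (∀ y ∈ Y, y ∈ S ∨ -y ∈ S) ∧ ∀ x ∈ S, x ∈ Y ∨ -x ∈ Y

theorem IsSection.notMem {S Y : Finset ℂ} {u : ℂ} (hY : IsSection S Y) (hu : u ∉ S)
    (h : SignFree (insert u S)) : u ∉ Y ∧ -u ∉ Y := by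
  have hn : -u ∉ S := fun hm => h u (mem_insert_self _ _) (-u) (mem_insert_of_mem hm) (by ring)
  refine ⟨fun hm => ?_, fun hm => ?_⟩
  · rcases hY.2.1 u hm with h1 | h1
    exacts [hu h1, hn h1]
  · rcases hY.2.1 _ hm with h1 | h1
    · exact hn h1
    · exact hu (by simpa using h1)

theorem IsSection.insert_insert {S Y : Finset ℂ} {u v : ℂ} (hY : IsSection S Y) (hu : u ∉ S)
    (h : SignFree (insert u S)) (hv : v = u ∨ v = -u) :
    IsSection (insert u S) (insert v Y) := by
  have h0 : u ≠ 0 := fun h0 => h u (mem_insert_self _ _) u (mem_insert_self _ _) (by simp [h0])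
  have hv0 : v ≠ 0 := by rcases hv with rfl | rfl <;> simpa
  obtain ⟨h1, h2⟩ := hY.notMem hu h
  have hvY : ∀ y ∈ Y, v + y ≠ 0 := by
    intro y hy hvy
    have : y = -v := by linear_combination hvy
    rcases hv with rfl | rfl
    · exact h2 (this ▸ hy)
    · exact h1 (by rwa [this, neg_neg] at hy)
  refine ⟨?_, ?_, ?_⟩
  · intro x hx y hy
    rw [mem_insert] at hx hy
    rcases hx with rfl | hx <;> rcases hy with rfl | hy
    · rw [← two_mul]; exact mul_ne_zero two_ne_zero hv0
    · exact hvY y hy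
    · rw [add_comm]; exact hvY x hx
    · exact hY.1 x hx y hy
  · intro y hy
    rcases mem_insert.mp hy with rfl | hy
    · rcases hv with rfl | rfl
      · exact Or.inl (mem_insert_self _ _)
      · exact Or.inr (by simp)
    · exact (hY.2.1 y hy).imp mem_insert_of_mem mem_insert_of_mem
  · intro x hx
    rcases mem_insert.mp hx with rfl | hx
    · rcases hv with rfl | rfl
      · exact Or.inl (mem_insert_self _ _)
      · exact Or.inr (mem_insert_self _ _)
    · exact (hY.2.2 x hx).imp mem_insert_of_mem mem_insert_of_mem

/-- Change the signs of the elements of `U`. -/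
def signFlip (S U : Finset ℂ) : Finset ℂ := (S \ U) ∪ U.image Neg.neg

variable {V : Type*} [AddCommGroup V]

/-- The sum of a function over all sets obtained from `S` by changing signs. -/
def signSum (S : Finset ℂ) (F : Finset ℂ → V) : V := ∑ U ∈ S.powerset, F (signFlip S U)

@[simp] theorem signSum_empty (F : Finset ℂ → V) : signSum ∅ F = F ∅ := by
  simp [signSum, signFlip]

theorem signSum_insert {S : Finset ℂ} {u : ℂ} (hu : u ∉ S) (F : Finset ℂ → V) :
    signSum (insert u S) F =
      signSum S (fun Y => F (insert u Y)) + signSum S (fun Y => F (insert (-u) Y)) := by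
  rw [signSum, sum_powerset_insert hu, signSum, signSum]
  congr 1
  · refine sum_congr rfl fun U hU => ?_
    have hU' : u ∉ U := fun h => hu (mem_powerset.mp hU h)
    rw [signFlip, insert_sdiff_of_notMem _ hU', insert_union, ← signFlip]
  · refine sum_congr rfl fun U hU => ?_
    rw [signFlip, signFlip, insert_sdiff_insert, sdiff_insert_of_notMem hu, image_insert,
      union_insert]

theorem signSum_add (S : Finset ℂ) (F G : Finset ℂ → V) :
    signSum S (fun Y => F Y + G Y) = signSum S F + signSum S G := sum_add_distrib

theorem signSum_smul [Module ℂ V] (S : Finset ℂ) (c : ℂ) (F : Finset ℂ → V) :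
    signSum S (fun Y => c • F Y) = c • signSum S F := smul_sum.symm

theorem signSum_sum {ι : Type*} (S : Finset ℂ) (s : Finset ι) (F : ι → Finset ℂ → V) :
    signSum S (fun Y => ∑ i ∈ s, F i Y) = ∑ i ∈ s, signSum S (F i) := sum_comm

theorem signSum_smul_const [Module ℂ V] (S : Finset ℂ) (c : Finset ℂ → ℂ) (v : V) :
    signSum S c • v = signSum S fun Y => c Y • v := sum_smul

theorem signSum_map [Module ℂ V] {V' : Type*} [AddCommGroup V'] [Module ℂ V'] (S : Finset ℂ)
    (φ : V →ₗ[ℂ] V') (F : Finset ℂ → V) :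
    φ (signSum S F) = signSum S fun Y => φ (F Y) := map_sum _ _ _

/-- Only genuine sign choices of `S` occur in the sum, so the two functions need to be compared only
where each parameter is present with one of its signs and no two elements add up to zero. -/
theorem signSum_congr {S : Finset ℂ} (hS : SignFree S) {F G : Finset ℂ → V}
    (h : ∀ Y, IsSection S Y → F Y = G Y) : signSum S F = signSum S G := by
  induction S using Finset.induction_on generalizing F G with
  | empty => simpa using h ∅ ⟨by simp [SignFree], by simp, by simp⟩
  | insert u S hu ih =>
    have hS' := hS.mono (subset_insert u S)
    rw [signSum_insert hu, signSum_insert hu]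
    congr 1
    · exact ih hS' fun Y hY => h _ (hY.insert_insert hu hS (Or.inl rfl))
    · exact ih hS' fun Y hY => h _ (hY.insert_insert hu hS (Or.inr rfl))

theorem signSum_union {S S' : Finset ℂ} (hd : Disjoint S S') (F : Finset ℂ → V) :
    signSum (S ∪ S') F = signSum S fun Y => signSum S' fun Y' => F (Y ∪ Y') := by
  induction S using Finset.induction_on generalizing F with
  | empty => simp
  | insert u S hu ih =>
    rw [disjoint_insert_left] at hd
    rw [insert_union, signSum_insert (by simp [hu, hd.1]), signSum_insert hu, ih hd.2, ih hd.2]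
    simp only [insert_union]

/-- Summation over signs of all elements and over a subset: the subset is chosen first. -/
theorem signSum_powerset {S : Finset ℂ} (hS : SignFree S) (F : Finset ℂ → Finset ℂ → V) :
    signSum S (fun Y => ∑ J ∈ Y.powerset, F J (Y \ J)) =
      ∑ α ∈ S.powerset, signSum α fun J => signSum (S \ α) fun Z => F J Z := by
  induction S using Finset.induction_on generalizing F with
  | empty => simp
  | insert u S hu ih =>
    have hS' := hS.mono (subset_insert u S)
    have step : ∀ v, v = u ∨ v = -u →
        signSum S (fun Y => ∑ J ∈ (insert v Y).powerset, F J (insert v Y \ J)) =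
        ∑ α ∈ S.powerset, signSum α fun J => signSum (S \ α) fun Z =>
          F J (insert v Z) + F (insert v J) Z := by
      intro v hv
      rw [← ih hS' fun J Z => F J (insert v Z) + F (insert v J) Z]
      refine signSum_congr hS' fun Y hY => ?_
      have hvY : v ∉ Y := by
        obtain ⟨h1, h2⟩ := hY.notMem hu hS
        rcases hv with rfl | rfl <;> assumption
      rw [sum_powerset_insert hvY, ← sum_add_distrib]
      refine sum_congr rfl fun J hJ => ?_
      have hvJ : v ∉ J := fun h => hvY (mem_powerset.mp hJ h)
      rw [insert_sdiff_of_notMem _ hvJ, insert_sdiff_insert, sdiff_insert_of_notMem hvY]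
    rw [signSum_insert hu, step u (Or.inl rfl), step (-u) (Or.inr rfl), sum_powerset_insert hu,
      ← sum_add_distrib, ← sum_add_distrib]
    refine sum_congr rfl fun α hα => ?_
    have huα : u ∉ α := fun h => hu (mem_powerset.mp hα h)
    rw [insert_sdiff_of_notMem _ huα, insert_sdiff_insert, sdiff_insert_of_notMem hu,
      signSum_insert huα]
    simp only [signSum_insert (show u ∉ S \ α by simp [hu]), signSum_add]
    abel

/-- A sum over signs of terms in which one element is removed vanishes if the two contributions
of each removed element cancel. -/
theorem signSum_cancel {S : Finset ℂ} (hS : SignFree S) {F : ℂ → Finset ℂ → V}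
    (h : ∀ x ∈ S, ∀ Y, IsSection (S.erase x) Y → F x Y + F (-x) Y = 0) :
    signSum S (fun Y => ∑ k ∈ Y, F k (Y.erase k)) = 0 := by
  induction S using Finset.induction_on generalizing F with
  | empty => simp
  | insert u S hu ih =>
    have hS' := hS.mono (subset_insert u S)
    have step : ∀ v, v = u ∨ v = -u →
        signSum S (fun Y => ∑ k ∈ insert v Y, F k ((insert v Y).erase k)) =
        signSum S fun Y => F v Y + ∑ k ∈ Y, F k (insert v (Y.erase k)) := by
      intro v hv
      refine signSum_congr hS' fun Y hY => ?_
      have hvY : v ∉ Y := by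
        obtain ⟨h1, h2⟩ := hY.notMem hu hS
        rcases hv with rfl | rfl <;> assumption
      rw [sum_insert hvY, erase_insert hvY]
      congr 1
      refine sum_congr rfl fun k hk => ?_
      rw [erase_insert_of_ne (ne_of_mem_of_not_mem hk hvY).symm]
    rw [signSum_insert hu, step u (Or.inl rfl), step (-u) (Or.inr rfl), ← signSum_add]
    -- The signs of u are summed first, so that the cancellation for the other elements is inherited
    -- by the smaller set.
    have hF := ih hS' (F := fun k Y => F k (insert u Y) + F k (insert (-u) Y)) ?_
    · rw [← hF]
      refine signSum_congr hS' fun Y hY => ?_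
      have h0 := h u (mem_insert_self _ _) Y (by rwa [erase_insert hu])
      rw [sum_add_distrib]
      linear_combination (norm := abel) h0
    · intro x hx Y hY
      have hxu : x ≠ u := ne_of_mem_of_not_mem hx hu
      have he : (insert u S).erase x = insert u (S.erase x) := erase_insert_of_ne hxu.symm
      have hins : SignFree (insert u (S.erase x)) := he ▸ hS.mono (erase_subset _ _)
      have hu' : u ∉ S.erase x := fun h => hu (mem_of_mem_erase h)
      have h1 := h x (mem_insert_of_mem hx) (insert u Y)
        (he ▸ hY.insert_insert hu' hins (Or.inl rfl))
      have h2 := h x (mem_insert_of_mem hx) (insert (-u) Y)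
        (he ▸ hY.insert_insert hu' hins (Or.inr rfl))
      linear_combination (norm := abel) h1 + h2

end Signs

/-! ### Multiplicative weights of signed sets. -/

section Weight

variable (η : ℂ) (g : ℂ → ℂ)

/-- The product of `(y + z - η) / (y + z)` over pairs. -/
def cS (J Z : Finset ℂ) : ℂ := ∏ y ∈ J, ∏ z ∈ Z, (y + z - η) / (y + z)

/-- The product of `g y` over elements and of `(y + z - η) / (y + z)` over unordered pairs. -/
def weight (Y : Finset ℂ) : ℂ :=
  (∏ y ∈ Y, g y) * ∏ e ∈ Y.powersetCard 2, ((∑ y ∈ e, y) - η) / ∑ y ∈ e, y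

@[simp] theorem weight_empty : weight η g ∅ = 1 := by
  rw [weight, powersetCard_eq_empty.mpr (by simp)]; simp

theorem weight_insert {u : ℂ} {Y : Finset ℂ} (hu : u ∉ Y) :
    weight η g (insert u Y) = g u * cS η {u} Y * weight η g Y := by
  rw [weight, weight, prod_insert hu, powersetCard_succ_insert hu, prod_union]
  · rw [prod_image, powersetCard_one, prod_map]
    · have : ∏ x ∈ Y, ((∑ y ∈ insert u {x}, y) - η) / ∑ y ∈ insert u {x}, y = cS η {u} Y := by
        rw [cS, prod_singleton]
        refine prod_congr rfl fun y hy => ?_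
        rw [sum_pair (ne_of_mem_of_not_mem hy hu).symm]
      simp only [Function.Embedding.coeFn_mk]
      rw [this]
      ring
    · intro e he e' he' hee
      have h1 : u ∉ e := fun h => hu ((mem_powersetCard.mp he).1 h)
      have h2 : u ∉ e' := fun h => hu ((mem_powersetCard.mp he').1 h)
      have := congrArg (fun s => s.erase u) hee
      simpa [erase_insert h1, erase_insert h2] using this
  · rw [disjoint_left]
    intro e he he'
    obtain ⟨e', -, rfl⟩ := mem_image.mp he'
    exact hu ((mem_powersetCard.mp he).1 (mem_insert_self _ _))

theorem cS_insert_left {u : ℂ} {J : Finset ℂ} (Z : Finset ℂ) (hu : u ∉ J) :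
    cS η (insert u J) Z = cS η {u} Z * cS η J Z := by
  simp [cS, prod_insert hu]

theorem cS_union_right (J : Finset ℂ) {Z Z' : Finset ℂ} (h : Disjoint Z Z') :
    cS η J (Z ∪ Z') = cS η J Z * cS η J Z' := by
  simp [cS, prod_union h, prod_mul_distrib]

theorem cS_comm (J Z : Finset ℂ) : cS η J Z = cS η Z J := by
  rw [cS, prod_comm, cS]
  simp only [add_comm]

theorem weight_union {J Z : Finset ℂ} (h : Disjoint J Z) :
    weight η g (J ∪ Z) = weight η g J * weight η g Z * cS η J Z := by
  induction J using Finset.induction_on with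
  | empty => simp [cS]
  | insert u J hu ih =>
    rw [disjoint_insert_left] at h
    rw [insert_union, weight_insert η g (by simp [hu, h.1]), ih h.2, weight_insert η g hu,
      cS_insert_left η Z hu, cS_union_right η _ h.2]
    ring

theorem weight_eq_zero {y : ℂ} {Y : Finset ℂ} (hy : y ∈ Y) (h : g y = 0) : weight η g Y = 0 := by
  rw [weight, prod_eq_zero hy h, zero_mul]

end Weight

/-! ### Boundary states as sums over signs of bulk states. -/

section Boundary

variable {N : ℕ} {η ζ b : ℂ} {ξ : Fin N → ℂ}

theorem Bplus_eq (u : ℂ) : Bplus η ξ ζ b u = (-1 : ℂ) ^ N •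
    ((1 + (u + η / 2) / ζ) • (monodromy η ξ u 0 1 * monodromy η ξ (-u) 1 1) -
      (1 - (u + η / 2) / ζ) • (monodromy η ξ u 1 1 * monodromy η ξ (-u) 0 1) +
      ((u + η / 2) / ζ * b) • (monodromy η ξ u 1 1 * monodromy η ξ (-u) 1 1)) := by
  have hI : (algebraMap ℂ (SpinOp N)) Complex.I * (algebraMap ℂ (SpinOp N)) Complex.I = -1 := by
    rw [← map_mul, Complex.I_mul_I]; simp
  have hcomm : ∀ X : SpinOp N, X * (algebraMap ℂ (SpinOp N)) Complex.I =
      (algebraMap ℂ (SpinOp N)) Complex.I * X := fun X => (Algebra.commutes _ _).symm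
  have h00 : monodromyHat η ξ u 0 0 = (-1 : ℂ) ^ N • monodromy η ξ (-u) 1 1 := by
    simp only [monodromyHat, auxScalar, pauliY, Matrix.smul_apply, Matrix.mul_apply,
      Fin.sum_univ_two, Matrix.map_apply, Matrix.transpose_apply]
    simp [hcomm, ← mul_assoc, hI]
  have h01 : monodromyHat η ξ u 0 1 = -((-1 : ℂ) ^ N • monodromy η ξ (-u) 0 1) := by
    simp only [monodromyHat, auxScalar, pauliY, Matrix.smul_apply, Matrix.mul_apply,
      Fin.sum_univ_two, Matrix.map_apply, Matrix.transpose_apply]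
    simp [hcomm, ← mul_assoc, hI]
  set c := (u + η / 2) / ζ with hc
  rw [Bplus, Uplus, Matrix.transpose_apply, Matrix.mul_apply]
  simp only [Matrix.mul_apply, Fin.sum_univ_two, Matrix.transpose_apply, h00, h01, auxScalar,
    Matrix.map_apply, Kplus, pauliZ, ← hc]
  simp only [Algebra.algebraMap_eq_smul_one]
  simp
  simp only [add_mul, smul_mul_assoc]
  module

/-- The factorised form of the boundary creation operator. -/
theorem toEnd_Bplus (hζ : ζ ≠ 0) {u : ℂ} (hu : u ≠ 0) :
    toEnd N (Bplus η ξ ζ b u) = ((-1 : ℂ) ^ N / ζ * ((2 * u + η) / (2 * u))) •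
      ((u + (ζ - η / 2)) • (twisted η ξ (b / 2) u 0 1 * twisted η ξ (b / 2) (-u) 1 1) +
        (u - (ζ - η / 2)) • (twisted η ξ (b / 2) (-u) 0 1 * twisted η ξ (b / 2) u 1 1)) := by
  have hne : u ≠ -u := fun h => hu (by linear_combination (1 / 2 : ℂ) * h)
  have hDB := (twisted_rtt η ξ (b / 2)).D_mul_B hne
  have h01 : ∀ v, toEnd N (monodromy η ξ v 0 1) =
      twisted η ξ (b / 2) v 0 1 - (b / 2) • twisted η ξ (b / 2) v 1 1 := by
    intro v
    rw [twisted, Matrix.map_apply, Matrix.map_apply, (auxScalar_mul_apply _ _ _).1,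
      (auxScalar_mul_apply _ _ _).2, map_add, map_smul]
    abel
  have h11 : ∀ v, toEnd N (monodromy η ξ v 1 1) = twisted η ξ (b / 2) v 1 1 := by
    intro v
    rw [twisted, Matrix.map_apply, (auxScalar_mul_apply _ _ _).2]
  rw [Bplus_eq]
  simp only [map_smul, map_add, map_sub, map_mul, h01, h11, sub_mul, mul_sub, smul_mul_assoc,
    mul_smul_comm, hDB]
  have hu2 : u - -u ≠ 0 := sub_ne_zero.mpr hne
  -- With c = (u + η/2)/ζ, the coefficient of D(u) D(-u) is -(1 + c) b/2 + (1 - c) b/2 + c b = 0;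
  -- this fixes the twist at b/2.
  match_scalars <;> field_simp <;> ring

theorem twisted_one_one_refState (ε u : ℂ) :
    twisted η ξ ε u 1 1 (refState N) = dFun η ξ u • refState N := by
  rw [twisted, Matrix.map_apply, toEnd_apply, (auxScalar_mul_apply _ _ _).2, monodromy_eq_mon,
    (mon_mulVec_refState _ (List.nodup_finRange N) u).2.2, dFun, ← List.prod_ofFn,
    List.ofFn_eq_map]

/-- The one-particle boundary weight, for a signed parameter. -/
def boundaryFactor (η ζ : ℂ) (ξ : Fin N → ℂ) (y : ℂ) : ℂ :=
  dFun η ξ (-y) * (y + (ζ - η / 2)) / (2 * y)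

/-- The boundary state of a set of parameters, as a sum over signs of bulk states. -/
def signedState (hη : η ≠ 0) (ζ b : ℂ) (ξ : Fin N → ℂ) (S : Finset ℂ) : (Fin N → Fin 2) → ℂ :=
  signSum S fun Y => weight η (boundaryFactor η ζ ξ) Y • bulkState hη ξ (b / 2) Y

theorem twisted_bulkState (hη : η ≠ 0) (ε : ℂ) {v : ℂ} {Y : Finset ℂ} (hv : v ∉ Y)
    (hv' : -v ∉ Y) :
    twisted η ξ ε v 0 1 (twisted η ξ ε (-v) 1 1 (bulkState hη ξ ε Y)) =
      (dFun η ξ (-v) * cS η {v} Y) • bulkState hη ξ ε (insert v Y) +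
      ∑ k ∈ Y, (dFun η ξ k * (η / (v + k)) * fS η {k} (Y.erase k)) •
        twisted η ξ ε v 0 1 (twisted η ξ ε (-v) 0 1 (bulkState hη ξ ε (Y.erase k))) := by
  have hfc : fS η {-v} Y = cS η {v} Y := by
    rw [fS, cS, prod_singleton, prod_singleton]
    refine prod_congr rfl fun y _ => ?_
    rw [fFun, ← neg_div_neg_eq]
    congr 1 <;> ring
  rw [bulkState, (twisted_rtt η ξ ε).D_opProd (twisted_comm hη ξ ε) (twisted_one_one_refState ε) Y
    (-v) hv', map_sub, map_smul, map_sum, hfc, sub_eq_add_neg, ← sum_neg_distrib]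
  congr 1
  · rw [bulkState, opProd_insert _ hv]; rfl
  · refine sum_congr rfl fun k _ => ?_
    rw [map_smul, ← neg_smul, bulkState]
    congr 1
    rw [show -v - k = -(v + k) by ring, div_neg]
    ring

/-- The action of the boundary creation operator on a bulk state. -/
theorem Bplus_bulkState (hη : η ≠ 0) (hζ : ζ ≠ 0) {u : ℂ} (hu : u ≠ 0) {Y : Finset ℂ}
    (h : u ∉ Y) (h' : -u ∉ Y) :
    toEnd N (Bplus η ξ ζ b u) (bulkState hη ξ (b / 2) Y) =
      ((-1 : ℂ) ^ N / ζ * (2 * u + η)) •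
        ((boundaryFactor η ζ ξ u * cS η {u} Y) • bulkState hη ξ (b / 2) (insert u Y) +
          (boundaryFactor η ζ ξ (-u) * cS η {-u} Y) • bulkState hη ξ (b / 2) (insert (-u) Y) +
          (1 / (2 * u)) • ∑ k ∈ Y, (dFun η ξ k * fS η {k} (Y.erase k) * η *
            ((u + (ζ - η / 2)) / (u + k) + (u - (ζ - η / 2)) / (-u + k))) •
            twisted η ξ (b / 2) u 0 1
              (twisted η ξ (b / 2) (-u) 0 1 (bulkState hη ξ (b / 2) (Y.erase k)))) := by
  have h1 := twisted_bulkState (ξ := ξ) hη (b / 2) h h'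
  have h2 := twisted_bulkState (ξ := ξ) hη (b / 2) h' (by rwa [neg_neg])
  rw [neg_neg] at h2
  have hcomm : ∀ w, twisted η ξ (b / 2) (-u) 0 1 (twisted η ξ (b / 2) u 0 1 w) =
      twisted η ξ (b / 2) u 0 1 (twisted η ξ (b / 2) (-u) 0 1 w) := fun w =>
    congrArg (fun X : Module.End ℂ _ => X w) (twisted_comm hη ξ (b / 2) (-u) u).eq
  have hsum : ∀ (w : ℂ → (Fin N → Fin 2) → ℂ) (A B : ℂ),
      ∑ k ∈ Y, (dFun η ξ k * fS η {k} (Y.erase k) * η * (A / (u + k) + B / (-u + k))) • w k =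
        A • (∑ k ∈ Y, (dFun η ξ k * (η / (u + k)) * fS η {k} (Y.erase k)) • w k) +
          B • ∑ k ∈ Y, (dFun η ξ k * (η / (-u + k)) * fS η {k} (Y.erase k)) • w k := by
    intro w A B
    simp only [smul_sum, ← sum_add_distrib, smul_smul, ← add_smul]
    refine sum_congr rfl fun k _ => ?_
    congr 1
    ring
  rw [toEnd_Bplus hζ hu, hsum]
  simp only [LinearMap.smul_apply, LinearMap.add_apply, Module.End.mul_apply, h1, h2, hcomm]
  simp only [boundaryFactor, neg_neg]
  generalize bulkState hη ξ (b / 2) (insert u Y) = Ψ1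
  generalize bulkState hη ξ (b / 2) (insert (-u) Y) = Ψ2
  generalize ∑ k ∈ Y, (dFun η ξ k * (η / (u + k)) * fS η {k} (Y.erase k)) •
    twisted η ξ (b / 2) u 0 1
      (twisted η ξ (b / 2) (-u) 0 1 (bulkState hη ξ (b / 2) (Y.erase k))) = Ψ3
  generalize ∑ k ∈ Y, (dFun η ξ k * (η / (-u + k)) * fS η {k} (Y.erase k)) •
    twisted η ξ (b / 2) u 0 1
      (twisted η ξ (b / 2) (-u) 0 1 (bulkState hη ξ (b / 2) (Y.erase k))) = Ψ4
  match_scalars <;> (field_simp; try ring)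

/-- With z = ζ - η/2 the two summands are the parts of the unwanted terms of x and -x that are not
even in x; their cancellation closes the sign sum. -/
theorem boundary_identity {u x z : ℂ} (hx : x ≠ 0) (h1 : u + x ≠ 0)
    (h2 : u - x ≠ 0) :
    (x + z) / (2 * x) * ((u + z) / (u + x) + (u - z) / (-u + x)) +
      (-x + z) / (2 * -x) * ((u + z) / (u + -x) + (u - z) / (-u + -x)) = 0 := by
  have h3 : -u + x ≠ 0 := fun h => h2 (by linear_combination -h)
  have h4 : u + -x ≠ 0 := fun h => h2 (by linear_combination h)
  have h5 : -u + -x ≠ 0 := fun h => h1 (by linear_combination -h)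
  rw [show -u + x = -(u - x) by ring, show u + -x = u - x by ring,
    show -u + -x = -(u + x) by ring]
  field_simp
  ring

/-- Each y contributes (x² - (y - η)²)/(x² - y²), which is even in x. -/
theorem cS_mul_fS_neg (η x : ℂ) (Y : Finset ℂ) :
    cS η {-x} Y * fS η {-x} Y = cS η {x} Y * fS η {x} Y := by
  simp only [cS, fS, prod_singleton, ← prod_mul_distrib]
  refine prod_congr rfl fun y _ => ?_
  rw [fFun, fFun, div_mul_div_comm, div_mul_div_comm]
  congr 1 <;> ring

/-- The wanted terms of the boundary operator attach u and -u to every bulk state with exactly the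
weight of the enlarged set. The unwanted ones, in which k is removed, cancel between k and -k. -/
theorem Bplus_signedState (hη : η ≠ 0) (hζ : ζ ≠ 0) {u : ℂ} {S : Finset ℂ} (hu : u ∉ S)
    (hS : SignFree (insert u S)) :
    toEnd N (Bplus η ξ ζ b u) (signedState hη ζ b ξ S) =
      ((-1 : ℂ) ^ N / ζ * (2 * u + η)) • signedState hη ζ b ξ (insert u S) := by
  have hS' := hS.mono (subset_insert u S)
  have hu0 : u ≠ 0 := fun h0 => hS u (mem_insert_self _ _) u (mem_insert_self _ _) (by simp [h0])
  set g := boundaryFactor η ζ ξ with hg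
  set F : ℂ → Finset ℂ → (Fin N → Fin 2) → ℂ := fun k Y =>
    (g k * cS η {k} Y * weight η g Y * (1 / (2 * u)) * (dFun η ξ k * fS η {k} Y * η *
      ((u + (ζ - η / 2)) / (u + k) + (u - (ζ - η / 2)) / (-u + k)))) •
      twisted η ξ (b / 2) u 0 1 (twisted η ξ (b / 2) (-u) 0 1 (bulkState hη ξ (b / 2) Y)) with hF
  have hcancel : signSum S (fun Y => ∑ k ∈ Y, F k (Y.erase k)) = 0 := by
    refine signSum_cancel hS' fun x hx Y hY => ?_
    have hx0 : x ≠ 0 := fun h0 => hS' x hx x hx (by simp [h0])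
    have h1 : u + x ≠ 0 := hS u (mem_insert_self _ _) x (mem_insert_of_mem hx)
    have h2 : u - x ≠ 0 := sub_ne_zero.mpr fun h => hu (h ▸ hx)
    simp only [hF]
    rw [← add_smul]
    refine smul_eq_zero_of_left ?_ _
    simp only [hg, boundaryFactor, neg_neg]
    linear_combination (cS η {x} Y * fS η {x} Y * weight η (boundaryFactor η ζ ξ) Y * (1 / (2 * u)) *
      dFun η ξ x * dFun η ξ (-x) * η) * boundary_identity (z := ζ - η / 2) hx0 h1 h2 +
      (dFun η ξ x * (-x + (ζ - η / 2)) / (2 * -x) * weight η (boundaryFactor η ζ ξ) Y *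
        (1 / (2 * u)) * dFun η ξ (-x) * η *
        ((u + (ζ - η / 2)) / (u + -x) + (u - (ζ - η / 2)) / (-u + -x))) * cS_mul_fS_neg η x Y
  rw [signedState, signSum_map, signedState, signSum_insert hu, ← signSum_add, ← signSum_smul]
  have hzero : signSum S (fun Y => ((-1 : ℂ) ^ N / ζ * (2 * u + η)) • ∑ k ∈ Y, F k (Y.erase k)) = 0 := by
    rw [signSum_smul, hcancel, smul_zero]
  symm
  rw [← add_zero (signSum S _), ← hzero, ← signSum_add]
  symm
  refine signSum_congr hS' fun Y hY => ?_
  obtain ⟨h1, h2⟩ := hY.notMem hu hS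
  rw [map_smul, Bplus_bulkState hη hζ hu0 h1 h2, weight_insert η g h1, weight_insert η g h2,
    smul_comm, ← smul_add]
  congr 1
  rw [smul_add, smul_add, smul_smul, smul_smul, smul_smul, smul_sum]
  congr 1
  · congr 2 <;> ring
  · refine sum_congr rfl fun k hk => ?_
    simp only [hF]
    rw [smul_smul, ← insert_erase hk, weight_insert η g (notMem_erase k Y), insert_erase hk]

/-- Boundary off-shell states as combinations of bulk off-shell states. -/
theorem boundaryState_eq (hη : η ≠ 0) (hζ : ζ ≠ 0) {l : List ℂ} (hl : l.Nodup)
    (hS : SignFree l.toFinset) :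
    boundaryState η ξ ζ b l = (((-1 : ℂ) ^ N / ζ) ^ l.length * ∏ x ∈ l.toFinset, (2 * x + η)) •
      signedState hη ζ b ξ l.toFinset := by
  induction l with
  | nil => simp [boundaryState, signedState, bulkState]
  | cons u l ih =>
    rw [List.nodup_cons] at hl
    have hu : u ∉ l.toFinset := by simpa using hl.1
    rw [List.toFinset_cons] at hS ⊢
    have h1 := ih hl.2 (hS.mono (subset_insert _ _))
    rw [boundaryState] at h1 ⊢
    rw [List.map_cons, List.prod_cons, ← Matrix.mulVec_mulVec, h1, ← toEnd_apply, map_smul,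
      Bplus_signedState hη hζ hu hS, smul_smul, prod_insert hu, List.length_cons]
    congr 1
    ring

end Boundary

/-! ### Action of the quasi-local operator on boundary states. -/

section BoundaryAction

variable {N : ℕ} {η ζ b : ℂ} {ξ : Fin N → ℂ}

/-- A set together with the opposites of its elements. -/
def plusMinus (S : Finset ℂ) : Finset ℂ := S ∪ S.image Neg.neg

theorem mem_plusMinus {S : Finset ℂ} {y : ℂ} : y ∈ plusMinus S ↔ y ∈ S ∨ -y ∈ S := by
  simp only [plusMinus, mem_union, mem_image]
  refine or_congr_right ⟨?_, fun h => ⟨-y, h, neg_neg y⟩⟩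
  rintro ⟨x, hx, rfl⟩
  rwa [neg_neg]

theorem IsSection.plusMinus_eq {S Y : Finset ℂ} (h : IsSection S Y) :
    plusMinus Y = plusMinus S := by
  ext y
  rw [mem_plusMinus, mem_plusMinus]
  constructor
  · rintro (hy | hy)
    · exact h.2.1 y hy
    · simpa [or_comm] using h.2.1 _ hy
  · rintro (hy | hy)
    · exact h.2.2 y hy
    · simpa [or_comm] using h.2.2 _ hy

theorem SignFree.disjoint_neg {S : Finset ℂ} (h : SignFree S) : Disjoint S (S.image Neg.neg) := by
  rw [disjoint_left]
  intro x hx hx'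
  obtain ⟨y, hy, rfl⟩ := mem_image.mp hx'
  exact h _ hx y hy (neg_add_cancel y)

/-- Replacing z by -z turns f(z|y) into the pair factor (z + y - η)/(z + y). Hence f times the pair
weights no longer depends on the signs chosen. -/
theorem SignFree.fS_plusMinus {S : Finset ℂ} (h : SignFree S) (η : ℂ) (J : Finset ℂ) :
    fS η (plusMinus S) J = fS η S J * cS η S J := by
  rw [plusMinus, fS_union_left _ h.disjoint_neg]
  congr 1
  rw [fS, prod_image neg_injective.injOn, cS]
  refine prod_congr rfl fun z _ => prod_congr rfl fun y _ => ?_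
  rw [fFun, ← neg_div_neg_eq]
  congr 1 <;> ring

theorem signSum_eq_self {V : Type*} [AddCommGroup V] {K : Finset ℂ} {F : Finset ℂ → V}
    (h : ∀ k ∈ K, ∀ Y, -k ∈ Y → F Y = 0) : signSum K F = F K := by
  rw [signSum, sum_eq_single_of_mem ∅ (empty_mem_powerset K)]
  · simp [signFlip]
  · intro U hU hne
    obtain ⟨k, hk⟩ := nonempty_iff_ne_empty.mpr hne
    exact h k (mem_powerset.mp hU hk) _ (mem_union_right _ (mem_image_of_mem _ hk))

/-- The bulk coefficient, for signed parameters `J` of which `D` are the opposite ones. -/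
def Rpair (η κ : ℂ) (a : ℂ → ℂ) (X D J K : Finset ℂ) : ℂ :=
  (∏ y ∈ J, a y) / (∏ x ∈ K, a x) * (fS η D J * fS η K (X \ K)) / (fS η J X * fS η D K) *
    SS η 1 κ K J

/-- The boundary coefficient as a function of sets. -/
def Rsigned (η ζ κ : ℂ) (ξ : Fin N → ℂ) (X S α K : Finset ℂ) : ℂ :=
  signSum α fun J => weight η (boundaryFactor η ζ ξ) J / weight η (boundaryFactor η ζ ξ) K *
    Rpair η κ (aFun η ξ) X (plusMinus (S \ α)) J K

/-- The bulk formula is applied to every sign choice; then the subset α of affected parameters is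
chosen first, its signs next, and the signs of the rest last. The coefficient must not depend on
these last signs, so that they rebuild a boundary state. -/
theorem Qop_signedState (hη : η ≠ 0) (hξ : GenericInhom η ξ) {m : ℕ} (hm : m ≤ N) (κ : ℂ)
    {S : Finset ℂ} (hS : SignFree S)
    (hX : ∀ x ∈ nodes hm η ξ, ∀ x' ∈ nodes hm η ξ, x ≠ x' → x - x' + η ≠ 0)
    (hXS : ∀ x ∈ nodes hm η ξ, ∀ y ∈ plusMinus S, x ≠ y ∧ x - y + η ≠ 0 ∧ y - x + η ≠ 0)
    (hSS : ∀ y ∈ plusMinus S, ∀ y' ∈ plusMinus S, y ≠ y' → y + y' ≠ 0 → y - y' + η ≠ 0)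
    (hg : ∀ x ∈ nodes hm η ξ, boundaryFactor η ζ ξ (-x) = 0)
    (hw : ∀ K ⊆ nodes hm η ξ, weight η (boundaryFactor η ζ ξ) K ≠ 0) :
    (Qop m hm κ).mulVec (signedState hη ζ b ξ S) =
      ∑ α ∈ S.powerset, ∑ K ∈ (nodes hm η ξ).powerset,
        Rsigned η ζ κ ξ (nodes hm η ξ) S α K • signedState hη ζ b ξ ((S \ α) ∪ K) := by
  set X := nodes hm η ξ with hXdef
  set W := weight η (boundaryFactor η ζ ξ) with hW
  have hmem : ∀ {α : Finset ℂ}, α ⊆ S → ∀ {Y : Finset ℂ}, IsSection α Y → Y ⊆ plusMinus S := by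
    intro α hα Y hY y hy
    exact mem_plusMinus.mpr ((hY.2.1 y hy).imp (fun h => hα h) (fun h => hα h))
  have hgen : ∀ Y, IsSection S Y → Gen η X Y := by
    intro Y hY
    have hYS := hmem subset_rfl hY
    exact ⟨fun x hx y hy => (hXS x hx y (hYS hy)).1, fun x hx y hy => (hXS x hx y (hYS hy)).2.1,
      fun x hx y hy => (hXS x hx y (hYS hy)).2.2, hX,
      fun y hy y' hy' hne => hSS y (hYS hy) y' (hYS hy') hne (hY.1 y hy y' hy')⟩
  set F : Finset ℂ → Finset ℂ → (Fin N → Fin 2) → ℂ := fun J Z => ∑ K ∈ X.powerset,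
    (W J * W Z * cS η J Z * Rpair η κ (aFun η ξ) X Z J K) • bulkState hη ξ (b / 2) (Z ∪ K) with hF
  have hQ : (Qop m hm κ).mulVec (signedState hη ζ b ξ S) =
      signSum S fun Y => ∑ J ∈ Y.powerset, F J (Y \ J) := by
    rw [← toEnd_apply, signedState, signSum_map]
    refine signSum_congr hS fun Y hY => ?_
    rw [map_smul, toEnd_apply, Qop_bulkState hη hξ hm κ (b / 2) (hgen Y hY), smul_sum]
    refine sum_congr rfl fun J hJ => ?_
    rw [smul_sum, hF]
    refine sum_congr rfl fun K _ => ?_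
    rw [smul_smul]
    congr 1
    have h1 := weight_union η (boundaryFactor η ζ ξ) (disjoint_sdiff (s := J) (t := Y))
    rw [union_sdiff_of_subset (mem_powerset.mp hJ)] at h1
    rw [h1]
    rfl
  rw [hQ, signSum_powerset hS]
  refine sum_congr rfl fun α hα => ?_
  have hαS := mem_powerset.mp hα
  simp only [hF]
  rw [signSum_congr (hS.mono hαS) fun J _ => signSum_sum _ _ _, signSum_sum]
  refine sum_congr rfl fun K hK => ?_
  have hKX := mem_powerset.mp hK
  have hdisj : ∀ D ⊆ plusMinus S, Disjoint D K := by
    intro D hD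
    rw [disjoint_left]
    exact fun y hy hy' => (hXS y (hKX hy') y (hD hy)).1 rfl
  have hsub : S \ α ⊆ plusMinus S := sdiff_subset.trans subset_union_left
  -- A sign change at a point of `K` gives weight zero, so the sum over signs extends over the
  -- untouched parameters only.
  have hstate : signedState hη ζ b ξ ((S \ α) ∪ K) =
      signSum (S \ α) fun Z => W (Z ∪ K) • bulkState hη ξ (b / 2) (Z ∪ K) := by
    rw [signedState, signSum_union (hdisj _ hsub)]
    refine signSum_congr (hS.mono sdiff_subset) fun Z _ => signSum_eq_self fun k hk Y hY => ?_
    rw [weight_eq_zero η _ (mem_union_right Z hY) (hg k (hKX hk)), zero_smul]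
  rw [hstate, Rsigned, signSum_smul_const]
  refine signSum_congr (hS.mono hαS) fun J _ => ?_
  rw [← signSum_smul]
  refine signSum_congr (hS.mono sdiff_subset) fun Z hZ => ?_
  have hZS : Z ⊆ plusMinus S := hmem sdiff_subset hZ
  rw [smul_smul]
  congr 1
  -- The weights between Z and J, and between Z and `K`, combine with f(Z|J) and f(Z|K) into f of
  -- the symmetric set, which is the same for every choice of signs Z.
  rw [hW, weight_union η _ (hdisj Z hZS), ← hW, ← hZ.plusMinus_eq, Rpair, Rpair,
    hZ.1.fS_plusMinus, hZ.1.fS_plusMinus, cS_comm η J Z]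
  have hWK : W K ≠ 0 := hw K hKX
  have hcS : cS η Z K ≠ 0 := by
    refine prod_ne_zero_iff.mpr fun z hz => prod_ne_zero_iff.mpr fun k hk => ?_
    have hz' : -z ∈ plusMinus S := by
      have := mem_plusMinus.mp (hZS hz)
      rw [mem_plusMinus, neg_neg]
      exact this.symm
    obtain ⟨h1, -, h2⟩ := hXS k (hKX hk) (-z) hz'
    refine div_ne_zero (fun h => h2 (by linear_combination -h)) fun h => h1 (by linear_combination h)
  generalize fS η Z K = A
  generalize cS η Z K = C at *
  field_simp

end BoundaryAction

/-! ### Translation between indexed families and finite sets. -/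

section Families

theorem image_univ_succ {n : ℕ} (v : Fin (n + 1) → ℂ) :
    univ.image v = insert (v 0) (univ.image fun i : Fin n => v i.succ) := by
  ext a
  simp [Fin.exists_fin_succ, eq_comm]

theorem image_univ_castSucc {n : ℕ} (v : Fin (n + 1) → ℂ) :
    univ.image v = insert (v (Fin.last n)) (univ.image fun i : Fin n => v i.castSucc) := by
  ext a
  simp [Fin.exists_fin_succ', eq_comm, or_comm]

theorem sgn_one : sgn 1 = 1 := by simp [sgn]

theorem sgn_neg_one : sgn (-1) = -1 := by simp [sgn]

theorem sum_units_int {V : Type*} [AddCommMonoid V] (F : ℤˣ → V) :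
    ∑ ε : ℤˣ, F ε = F 1 + F (-1) := by
  rw [show (univ : Finset ℤˣ) = {1, -1} from rfl, sum_pair (by decide)]

theorem sum_signs {V : Type*} [AddCommGroup V] {n : ℕ} {y : Fin n → ℂ}
    (hy : Function.Injective y) (F : Finset ℂ → V) :
    ∑ σ : Fin n → ℤˣ, F (univ.image fun i => sgn (σ i) * y i) = signSum (univ.image y) F := by
  induction n generalizing F with
  | zero => simp
  | succ n ih =>
    have h0 : y 0 ∉ univ.image fun i : Fin n => y i.succ := by
      simp only [mem_image, mem_univ, true_and, not_exists]
      exact fun i h => Fin.succ_ne_zero i (hy h)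
    have hs : Function.Injective fun i : Fin n => y i.succ := hy.comp (Fin.succ_injective n)
    rw [← (Fin.consEquiv fun _ => ℤˣ).sum_comp, Fintype.sum_prod_type, sum_units_int,
      image_univ_succ y, signSum_insert h0, ← ih hs, ← ih hs]
    congr 1 <;> refine sum_congr rfl fun σ _ => ?_ <;> rw [image_univ_succ] <;>
      simp [Fin.consEquiv, sgn_one, sgn_neg_one]

theorem weight_image (η : ℂ) (g : ℂ → ℂ) {n : ℕ} {v : Fin n → ℂ} (hv : Function.Injective v) :
    weight η g (univ.image v) =
      (∏ j, g (v j)) * ∏ s, ∏ r ∈ Iio s, (v s + v r - η) / (v s + v r) := by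
  induction n with
  | zero => simp
  | succ n ih =>
    have hc : Function.Injective fun i : Fin n => v i.castSucc :=
      hv.comp (Fin.castSucc_injective n)
    have h0 : v (Fin.last n) ∉ univ.image fun i : Fin n => v i.castSucc := by
      simp only [mem_image, mem_univ, true_and, not_exists]
      exact fun i h => (Fin.castSucc_lt_last i).ne (hv h)
    have h1 : Iio (Fin.last n) = univ.map Fin.castSuccEmb := by
      ext a
      refine Fin.lastCases ?_ (fun i => ?_) a <;> simp
    rw [image_univ_castSucc, weight_insert η g h0, ih hc, Fin.prod_univ_castSucc,
      Fin.prod_univ_castSucc (fun s => ∏ r ∈ Iio s, (v s + v r - η) / (v s + v r)), h1, prod_map,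
      cS, prod_singleton, prod_image hc.injOn]
    simp only [← Fin.map_castSuccEmb_Iio, prod_map, Fin.castSuccEmb_apply]
    ring

variable {N : ℕ} {η ζ : ℂ} {ξ : Fin N → ℂ}

/-- The factor 2x + η does not see the sign and goes into the normalization of the boundary state;
the rest depends on x and its sign only through their product. -/
theorem Hcoef_eq {n : ℕ} (σ : Fin n → ℤˣ) (y : Fin n → ℂ)
    (h : Function.Injective fun i => sgn (σ i) * y i) :
    Hcoef η ξ ζ σ y = (∏ j, (2 * y j + η)) *
      weight η (boundaryFactor η ζ ξ) (univ.image fun i => sgn (σ i) * y i) := by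
  rw [weight_image η _ h, Hcoef, ← mul_assoc]
  congr 1
  rw [← prod_mul_distrib]
  refine prod_congr rfl fun j _ => ?_
  rw [boundaryFactor]
  rcases Int.units_eq_one_or (σ j) with hj | hj
  · rw [hj, sgn_one]; ring
  · rw [hj, sgn_neg_one, neg_one_mul, neg_one_mul, mul_neg, div_neg]; ring

theorem fProd_eq_fS {ι ι' : Type} [Fintype ι] [Fintype ι'] (η : ℂ) {x : ι → ℂ} {y : ι' → ℂ}
    (hx : Function.Injective x) (hy : Function.Injective y) :
    fProd η x y = fS η (univ.image x) (univ.image y) := by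
  rw [fProd, fS, prod_image hx.injOn]
  exact prod_congr rfl fun i _ => (prod_image hy.injOn).symm

theorem fFun_div_swap {x y : ℂ} (η : ℂ) (h : x ≠ y) :
    fFun η x y / fFun η y x = (y - x - η) / (y - x + η) := by
  have h1 : y - x ≠ 0 := sub_ne_zero.mpr h.symm
  rw [fFun, fFun, show x - y = -(y - x) by ring, div_neg, show -(y - x) + η = -(y - x - η) by ring,
    neg_div, neg_div, neg_div, neg_neg, div_div_div_cancel_right₀ h1]

theorem Mmat_eq {n : ℕ} {κ : ℂ} {x y : Fin n → ℂ} (hx : Function.Injective x)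
    (hy : Function.Injective y) (hne : ∀ k j, x k ≠ y j) (h : ∀ k j, y j - x k + η ≠ 0) :
    Mmat η κ x y = Matrix.of fun j k =>
      ent η 1 κ (univ.image x) (univ.image y) (y j) (x k) := by
  ext j k
  rw [Mmat, Matrix.of_apply, Matrix.of_apply, ent, ← prod_div_distrib, ← prod_div_distrib,
    ← image_erase hy, ← image_erase hx, prod_image hy.injOn, prod_image hx.injOn,
    ← mul_prod_erase univ _ (mem_univ k)]
  have e1 : ∏ l ∈ univ.erase j, fFun η (y l) (y j) / fFun η (y j) (y l) =
      ∏ l ∈ univ.erase j, (y j - y l - η) / (y j - y l + η) :=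
    prod_congr rfl fun l hl => fFun_div_swap η fun h => (mem_erase.mp hl).1 (hy h)
  have e2 : ∏ l ∈ univ.erase k, fFun η (y j) (x l) / fFun η (x l) (y j) =
      ∏ l ∈ univ.erase k, (x l - y j - η) / (x l - y j + η) :=
    prod_congr rfl fun l _ => fFun_div_swap η (hne l j).symm
  -- The factor l = k of the product over the columns turns r(y|x) into r(x|y), so that r(x|y) can
  -- be taken out of the whole entry.
  have e3 : rFun η (y j) (x k) * (fFun η (y j) (x k) / fFun η (x k) (y j)) = rFun η (x k) (y j) := by
    rw [fFun_div_swap η (hne k j).symm, rFun, rFun]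
    have h1 : x k - y j ≠ 0 := sub_ne_zero.mpr (hne k j)
    have h2 := h k j
    rw [show y j - x k + η = -(x k - y j - η) by ring] at h2 ⊢
    have h3 : x k - y j - η ≠ 0 := fun h => h2 (by rw [h, neg_zero])
    rw [show y j - x k = -(x k - y j) by ring]
    field_simp
  rw [e1, e2, mul_sub, mul_one, ← e3]
  ring

theorem Sbar_eq {n : ℕ} {κ : ℂ} {x y : Fin n → ℂ} (hx : Function.Injective x)
    (hy : Function.Injective y) (hne : ∀ k j, x k ≠ y j) (h : ∀ k j, y j - x k + η ≠ 0) :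
    Sbar η κ x y = SS η 1 κ (univ.image x) (univ.image y) := by
  rw [Sbar, Mmat_eq hx hy hne h, SS, normDetSet_eq _ hx hy rfl rfl, normDet, prod_image hx.injOn]
  have e : ∀ i, ∏ z ∈ univ.image y, (x i - z + η) = ∏ j, (x i - y j + η) := fun i =>
    prod_image hy.injOn
  simp only [e, vdm, Pi.neg_apply, neg_sub_neg]
  ring

theorem Rcoef_eq {n : ℕ} {ι ι' : Type} [Fintype ι] [Fintype ι'] (κ : ℂ) {xp : Fin n → ℂ}
    {xm : ι → ℂ} {yp : Fin n → ℂ} {ym : ι' → ℂ} (hx : Function.Injective (Sum.elim xp xm))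
    (hyp : Function.Injective yp) (hym : Function.Injective ym)
    (hne : ∀ k j, xp k ≠ yp j) (h : ∀ k j, yp j - xp k + η ≠ 0) (ha : ∀ i, aFun η ξ (xm i) ≠ 0) :
    Rcoef η κ ξ xp xm yp ym = Rpair η κ (aFun η ξ) (univ.image (Sum.elim xp xm)) (univ.image ym)
      (univ.image yp) (univ.image xp) := by
  have hxp : Function.Injective xp := hx.comp Sum.inl_injective
  have hxm : Function.Injective xm := hx.comp Sum.inr_injective
  have hsd : univ.image (Sum.elim xp xm) \ univ.image xp = univ.image xm := by
    ext a
    simp only [mem_sdiff, mem_image, mem_univ, true_and, Sum.exists, Sum.elim_inl, Sum.elim_inr]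
    constructor
    · rintro ⟨h1 | h1, h2⟩
      exacts [absurd h1 h2, h1]
    · rintro ⟨i, rfl⟩
      refine ⟨Or.inr ⟨i, rfl⟩, ?_⟩
      rintro ⟨k, hk⟩
      exact Sum.inl_ne_inr (hx (a₁ := Sum.inl k) (a₂ := Sum.inr i) hk)
  rw [Rcoef, Rpair, Sbar_eq hxp hyp hne h, hsd, tau, tau, tau, fProd_eq_fS η hym hyp,
    fProd_eq_fS η hxp hxm, fProd_eq_fS η hyp hx, fProd_eq_fS η hym hxp, prod_image hyp.injOn,
    prod_image hxp.injOn, Fintype.prod_sum_type]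
  simp only [Sum.elim_inl, Sum.elim_inr]
  congr 1
  have hP : ∏ i, aFun η ξ (xm i) ≠ 0 := prod_ne_zero_iff.mpr fun i _ => ha i
  generalize ∏ i, aFun η ξ (xm i) = P at *
  symm
  rw [div_mul_eq_mul_div, div_div, ← mul_div_mul_right _ _ hP]
  congr 1 <;> ring

end Families

/-! ### Assembly of the boundary action and the local spin operator. -/

section Main

variable {N M m : ℕ} {η ζ b : ℂ} {ξ : Fin N → ℂ}

theorem sgn_mul_cases (ε : ℤˣ) (x : ℂ) : sgn ε * x = x ∨ sgn ε * x = -x := by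
  rcases Int.units_eq_one_or ε with h | h
  · left; rw [h, sgn_one, one_mul]
  · right; rw [h, sgn_neg_one, neg_one_mul]

theorem SignFree.sgn_mul_injective {ι : Type*} {μ : ι → ℂ} {S : Finset ℂ} (hS : SignFree S)
    (hμS : ∀ i, μ i ∈ S) (hμ : Function.Injective μ) :
    Function.Injective fun p : ι × ℤˣ => sgn p.2 * μ p.1 := by
  rintro ⟨i, ε⟩ ⟨j, ε'⟩ h
  have hsum := hS _ (hμS i) _ (hμS j)
  have h0 : μ i ≠ 0 := fun h => hS _ (hμS i) _ (hμS i) (by rw [h, add_zero])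
  simp only at h
  rcases Int.units_eq_one_or ε with rfl | rfl <;> rcases Int.units_eq_one_or ε' with rfl | rfl <;>
    simp only [sgn_one, sgn_neg_one, one_mul, neg_one_mul] at h
  · rw [hμ h]
  · exact absurd (by rw [h, neg_add_cancel]) hsum
  · exact absurd (by rw [← h, add_neg_cancel]) hsum
  · rw [hμ (neg_injective h)]

theorem image_comp_orderEmbOfFin {k n : ℕ} (μ : Fin k → ℂ) (α : {s : Finset (Fin k) // s.card = n}) :
    (univ.image fun i => μ (α.1.orderEmbOfFin α.2 i)) = α.1.image μ := by
  have h := congrArg (image μ) (image_orderEmbOfFin_univ α.1 α.2)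
  rw [image_image] at h
  exact h

theorem GenericInhom.aFun_ne_zero (hξ : GenericInhom η ξ) (hη : η ≠ 0) (n : Fin N) :
    aFun η ξ (ξ n + η / 2) ≠ 0 := by
  refine prod_ne_zero_iff.mpr fun k _ h => ?_
  by_cases hnk : n = k
  · subst hnk; exact hη (by linear_combination h)
  · refine (hξ.2 n k hnk).1 ?_
    simp only [Set.mem_insert_iff, Set.mem_singleton_iff]
    right; left
    linear_combination h

theorem calR_eq {n : ℕ} (hη : η ≠ 0) (hξ : GenericInhom η ξ) (hm : m ≤ N) (κ : ℂ) {μ : Fin M → ℂ}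
    (hμ : Function.Injective μ) (hS : SignFree (univ.image μ))
    (hXS : ∀ x ∈ nodes hm η ξ, ∀ y ∈ plusMinus (univ.image μ), x ≠ y ∧ y - x + η ≠ 0)
    (α : {s : Finset (Fin M) // s.card = n}) (γ : {s : Finset (Fin m) // s.card = n}) :
    calR hm η ζ κ ξ μ α γ =
      (∏ x ∈ α.1.image μ, (2 * x + η)) / (∏ x ∈ γ.1.image (xi0 hm η ξ), (2 * x + η)) *
        Rsigned η ζ κ ξ (nodes hm η ξ) (univ.image μ) (α.1.image μ) (γ.1.image (xi0 hm η ξ)) := by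
  set y : Fin n → ℂ := fun i => μ (α.1.orderEmbOfFin α.2 i) with hy
  set x : Fin n → ℂ := fun i => xi0 hm η ξ (γ.1.orderEmbOfFin γ.2 i) with hx
  have hyi : Function.Injective y := hμ.comp (α.1.orderEmbOfFin α.2).injective
  have hxi : Function.Injective x := (hξ.xi0_injective hm).comp (γ.1.orderEmbOfFin γ.2).injective
  have hyim : univ.image y = α.1.image μ := image_comp_orderEmbOfFin μ α
  have hxim : univ.image x = γ.1.image (xi0 hm η ξ) := image_comp_orderEmbOfFin _ γ
  have hμS : ∀ j, μ j ∈ univ.image μ := fun j => mem_image_of_mem μ (mem_univ j)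
  have hpm : ∀ j ε, sgn ε * μ j ∈ plusMinus (univ.image μ) := by
    intro j ε
    rw [mem_plusMinus]
    rcases sgn_mul_cases ε (μ j) with h | h
    · rw [h]; exact Or.inl (hμS j)
    · rw [h, neg_neg]; exact Or.inr (hμS j)
  have hxX : ∀ k, x k ∈ nodes hm η ξ := fun k => mem_image_of_mem _ (mem_univ _)
  rw [← hyim, ← hxim, Rsigned, ← sum_signs hyi, mul_sum]
  rw [calR]
  refine sum_congr rfl fun σ _ => ?_
  have hσi : Function.Injective fun i => sgn (σ i) * y i := by
    intro i j h
    have := hS.sgn_mul_injective hμS hμ (a₁ := (α.1.orderEmbOfFin α.2 i, σ i))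
      (a₂ := (α.1.orderEmbOfFin α.2 j, σ j)) h
    exact (α.1.orderEmbOfFin α.2).injective (congrArg Prod.fst this)
  have h1 : (fun i => sgn 1 * x i) = x := funext fun i => by rw [sgn_one, one_mul]
  have hel : Function.Injective (Sum.elim x fun a : {a // a ∉ γ.1} => xi0 hm η ξ a.1) := by
    refine Function.Injective.sumElim hxi ((hξ.xi0_injective hm).comp Subtype.val_injective) ?_
    intro k a h
    exact a.2 ((hξ.xi0_injective hm h) ▸ orderEmbOfFin_mem γ.1 γ.2 k)
  have helim : univ.image (Sum.elim x fun a : {a // a ∉ γ.1} => xi0 hm η ξ a.1) =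
      nodes hm η ξ := by
    ext z
    simp only [nodes, mem_image, mem_univ, true_and, Sum.exists, Sum.elim_inl, Sum.elim_inr]
    constructor
    · rintro (⟨k, rfl⟩ | ⟨a, rfl⟩)
      exacts [⟨_, rfl⟩, ⟨_, rfl⟩]
    · rintro ⟨a, rfl⟩
      by_cases ha : a ∈ γ.1
      · have : a ∈ univ.image (γ.1.orderEmbOfFin γ.2) := by rwa [image_orderEmbOfFin_univ]
        obtain ⟨k, -, rfl⟩ := mem_image.mp this
        exact Or.inl ⟨k, rfl⟩
      · exact Or.inr ⟨⟨a, ha⟩, rfl⟩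
  have hymi : Function.Injective fun p : {j // j ∉ α.1} × ℤˣ => sgn p.2 * μ p.1.1 :=
    hS.sgn_mul_injective (μ := fun j : {j // j ∉ α.1} => μ j.1) (fun j => hμS j.1)
      (hμ.comp Subtype.val_injective)
  have hymim : (univ.image fun p : {j // j ∉ α.1} × ℤˣ => sgn p.2 * μ p.1.1) =
      plusMinus (univ.image μ \ univ.image y) := by
    have hmem : ∀ {w : ℂ}, w ∈ univ.image μ \ univ.image y ↔ ∃ j, j ∉ α.1 ∧ μ j = w := by
      intro w
      rw [hyim, mem_sdiff, mem_image, mem_image]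
      constructor
      · rintro ⟨⟨j, -, rfl⟩, h⟩
        exact ⟨j, fun hj => h ⟨j, hj, rfl⟩, rfl⟩
      · rintro ⟨j, hj, rfl⟩
        exact ⟨⟨j, mem_univ _, rfl⟩, fun ⟨i, hi, h⟩ => hj (hμ h ▸ hi)⟩
    ext z
    rw [mem_plusMinus, hmem, hmem, mem_image]
    constructor
    · rintro ⟨⟨j, ε⟩, -, rfl⟩
      rcases sgn_mul_cases ε (μ j) with h | h
      · exact Or.inl ⟨j, j.2, h.symm⟩
      · exact Or.inr ⟨j, j.2, by simp only [h, neg_neg]⟩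
    · rintro (⟨j, hj, rfl⟩ | ⟨j, hj, h⟩)
      · exact ⟨(⟨j, hj⟩, 1), mem_univ _, by simp [sgn_one]⟩
      · exact ⟨(⟨j, hj⟩, -1), mem_univ _, by simp [sgn_neg_one, h]⟩
  rw [← hy, ← hx, Hcoef_eq σ y hσi, Hcoef_eq (fun _ => 1) x (by rwa [h1]), h1,
    Rcoef_eq κ hel hσi hymi (fun k j => (hXS _ (hxX k) _ (hpm _ _)).1)
      (fun k j => (hXS _ (hxX k) _ (hpm _ _)).2) (fun a => hξ.aFun_ne_zero hη _), helim, hymim,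
    prod_image hyi.injOn, prod_image hxi.injOn, mul_div_mul_comm, mul_assoc]

theorem sum_fin_card {V : Type*} [AddCommMonoid V] {k l : ℕ}
    (T : Finset (Fin k) → Finset (Fin l) → V) (hT : ∀ α γ, α.card ≠ γ.card → T α γ = 0) :
    ∑ α, ∑ γ, T α γ = ∑ n ∈ range (min l k + 1), ∑ α : {s : Finset (Fin k) // s.card = n},
      ∑ γ : {s : Finset (Fin l) // s.card = n}, T α.1 γ.1 := by
  have h0 : ∀ (j n : ℕ) (F : Finset (Fin j) → V), ∑ α : {s : Finset (Fin j) // s.card = n}, F α.1 =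
      ∑ α, if α.card = n then F α else 0 := by
    intro j n F
    rw [← sum_filter]
    exact (sum_subtype (univ.filter fun s : Finset (Fin j) => s.card = n) (by simp) F).symm
  have h1 : ∀ n, ∑ α : {s : Finset (Fin k) // s.card = n},
      ∑ γ : {s : Finset (Fin l) // s.card = n}, T α.1 γ.1 =
      ∑ α, ∑ γ, if α.card = n ∧ γ.card = n then T α γ else 0 := by
    intro n
    rw [h0 k n fun α => ∑ γ : {s : Finset (Fin l) // s.card = n}, T α γ.1]
    refine sum_congr rfl fun α _ => ?_
    rw [h0 l n (T α)]
    by_cases hα : α.card = n <;> simp [hα]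
  rw [sum_congr rfl fun n _ => h1 n]
  symm
  rw [sum_comm]
  refine sum_congr rfl fun (α : Finset (Fin k)) _ => ?_
  rw [sum_comm]
  refine sum_congr rfl fun (γ : Finset (Fin l)) _ => ?_
  by_cases h : α.card = γ.card
  · rw [sum_eq_single α.card]
    · simp [h]
    · intro n _ hn
      rw [if_neg fun h' => hn h'.1.symm]
    · intro hn
      refine absurd (mem_range.mpr (Nat.lt_succ_of_le (le_min ?_ ?_))) hn
      · rw [h]; simpa using card_le_univ γ
      · simpa using card_le_univ α
  · rw [hT α γ h]
    simp

theorem signSum_eq_zero {V : Type*} [AddCommGroup V] {S : Finset ℂ} (hS : SignFree S)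
    {F : Finset ℂ → V} (h : ∀ Y, Y.card = S.card → F Y = 0) : signSum S F = 0 := by
  refine sum_eq_zero fun U hU => h _ ?_
  have hUS := mem_powerset.mp hU
  rw [signFlip, card_union_of_disjoint, card_image_of_injective _ neg_injective,
    card_sdiff_add_card_eq_card hUS]
  exact hS.disjoint_neg.mono sdiff_subset (image_subset_image hUS)

/-- Old and new boundary states have the same number M of parameters, so the constants (-1)^N/ζ
agree. The products of 2x + η account for the difference between `calR` and `Rsigned`. -/
theorem Qop_boundaryState (hη : η ≠ 0) (hζ : ζ ≠ 0) (hξ : GenericInhom η ξ) (hm : m ≤ N) (κ : ℂ)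
    (μ : Fin M → ℂ)
    (h0 : ∀ a : Fin m, 2 * ξ (Fin.castLE hm a) + η ≠ 0 ∧ ξ (Fin.castLE hm a) + ζ ≠ 0)
    (hμξ : GenericSpectral hm η ξ μ) :
    (Qop m hm κ).mulVec (boundaryState η ξ ζ b (List.ofFn μ)) =
      ∑ n ∈ range (min m M + 1), ∑ α : {s : Finset (Fin M) // s.card = n},
        ∑ γ : {s : Finset (Fin m) // s.card = n},
          calR hm η ζ κ ξ μ α γ • newState hm η ζ b ξ μ α.1 γ.1 := by
  obtain ⟨hμ0, hμ1, hμ2⟩ := hμξ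
  simp only [Set.mem_insert_iff, Set.mem_singleton_iff, not_or] at hμ1 hμ2
  have hξ2 := hξ.2
  simp only [Set.mem_insert_iff, Set.mem_singleton_iff, not_or] at hξ2
  have hμ : Function.Injective μ := by
    intro j k h
    by_contra hne
    exact (hμ1 j k hne).1.1 (sub_eq_zero.mpr h)
  have hxi := hξ.xi0_injective hm
  set S := univ.image μ with hSdef
  set X := nodes hm η ξ with hXdef
  have hS : SignFree S := by
    intro x hx y hy
    obtain ⟨j, -, rfl⟩ := mem_image.mp hx
    obtain ⟨k, -, rfl⟩ := mem_image.mp hy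
    by_cases hjk : j = k
    · subst hjk; rw [← two_mul]; exact mul_ne_zero two_ne_zero (hμ0 j)
    · exact (hμ1 j k hjk).2.1
  have hcast : ∀ {a a' : Fin m}, a ≠ a' → Fin.castLE hm a ≠ Fin.castLE hm a' := fun h h' =>
    h (Fin.castLE_injective hm h')
  have hXfree : SignFree X := by
    intro x hx y hy
    obtain ⟨a, -, rfl⟩ := mem_image.mp hx
    obtain ⟨a', -, rfl⟩ := mem_image.mp hy
    simp only [xi0]
    by_cases haa : a = a'
    · subst haa; exact fun h => (h0 a).1 (by linear_combination h)
    · exact fun h => (hξ2 _ _ (hcast haa)).2.2.1 (by linear_combination h)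
  have hpm : ∀ {y}, y ∈ plusMinus S → ∃ j ε, y = sgn ε * μ j := by
    intro y hy
    rcases mem_plusMinus.mp hy with h | h <;> obtain ⟨j, -, hj⟩ := mem_image.mp h
    · exact ⟨j, 1, by rw [sgn_one, one_mul, hj]⟩
    · exact ⟨j, -1, by rw [sgn_neg_one, hj, neg_one_mul, neg_neg]⟩
  have hX : ∀ x ∈ X, ∀ x' ∈ X, x ≠ x' → x - x' + η ≠ 0 := by
    intro x hx y hy hne
    obtain ⟨a, -, rfl⟩ := mem_image.mp hx
    obtain ⟨a', -, rfl⟩ := mem_image.mp hy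
    have haa : a ≠ a' := fun h => hne (by rw [h])
    simp only [xi0]
    exact fun h => (hξ2 _ _ (hcast haa)).1.2.1 (by linear_combination h)
  have hXS : ∀ x ∈ X, ∀ y ∈ plusMinus S, x ≠ y ∧ x - y + η ≠ 0 ∧ y - x + η ≠ 0 := by
    intro x hx y hy
    obtain ⟨a, -, rfl⟩ := mem_image.mp hx
    obtain ⟨j, ε, rfl⟩ := hpm hy
    obtain ⟨e1, e2, e3⟩ := hμ2 j a ε
    exact ⟨Ne.symm e1, fun h => e3 (by linear_combination -h), fun h => e2 (by linear_combination h)⟩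
  have hSS : ∀ y ∈ plusMinus S, ∀ y' ∈ plusMinus S, y ≠ y' → y + y' ≠ 0 → y - y' + η ≠ 0 := by
    intro y hy y' hy' hne hadd h
    obtain ⟨j, ε, rfl⟩ := hpm hy
    obtain ⟨k, ε', rfl⟩ := hpm hy'
    -- Two signs of the same parameter give either equal elements or elements with sum zero, both
    -- excluded; this is why no condition on 2μ = ±η is needed.
    have hjk : j ≠ k := by
      rintro rfl
      rcases sgn_mul_cases ε (μ j) with e | e <;> rcases sgn_mul_cases ε' (μ j) with e' | e' <;>
        rw [e, e'] at hne hadd <;> simp at hne hadd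
    obtain ⟨⟨-, e1, e2⟩, -, e3, e4⟩ := hμ1 j k hjk
    rcases sgn_mul_cases ε (μ j) with e | e <;> rcases sgn_mul_cases ε' (μ k) with e' | e' <;>
      rw [e, e'] at h
    · exact e1 (by linear_combination h)
    · exact e3 (by linear_combination h)
    · exact e4 (by linear_combination -h)
    · exact e2 (by linear_combination -h)
  -- The one-particle weight of -x contains d(x), which vanishes at x = ξ^(0).
  have hg : ∀ x ∈ X, boundaryFactor η ζ ξ (-x) = 0 := by
    intro x hx
    obtain ⟨a, -, rfl⟩ := mem_image.mp hx
    rw [boundaryFactor, dFun, prod_eq_zero (mem_univ (Fin.castLE hm a)), zero_mul, zero_div]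
    rw [xi0]; ring
  have h2X : ∀ x ∈ X, 2 * x + η ≠ 0 := by
    intro x hx
    obtain ⟨a, -, rfl⟩ := mem_image.mp hx
    have := hξ.1 (Fin.castLE hm a)
    simp only [Set.mem_insert_iff, Set.mem_singleton_iff, not_or] at this
    rw [xi0]
    exact fun h => this.2.1 (by linear_combination (1 / 2 : ℂ) * h)
  -- At ξ^(0) the factors are, up to sign, ξ_a + ξ_n + η (which is 2ξ_a + η for n = a) and ξ_a + ζ;
  -- the pair numerators are ξ_a + ξ_a'.
  have hw : ∀ K ⊆ X, weight η (boundaryFactor η ζ ξ) K ≠ 0 := by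
    intro K hK
    refine mul_ne_zero (prod_ne_zero_iff.mpr fun x hx => ?_) (prod_ne_zero_iff.mpr fun e he => ?_)
    · obtain ⟨a, -, rfl⟩ := mem_image.mp (hK hx)
      refine div_ne_zero (mul_ne_zero (prod_ne_zero_iff.mpr fun n _ => ?_) ?_) ?_
      · rw [xi0]
        by_cases hn : Fin.castLE hm a = n
        · subst hn; exact fun h => (h0 a).1 (by linear_combination -h)
        · exact fun h => (hξ2 _ _ hn).2.2.1 (by linear_combination -h)
      · rw [xi0]; exact fun h => (h0 a).2 (by linear_combination h)
      · rw [two_mul]; exact hXfree _ (hK hx) _ (hK hx)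
    · obtain ⟨heK, hcard⟩ := mem_powersetCard.mp he
      obtain ⟨x, y, hxy, rfl⟩ := card_eq_two.mp hcard
      have hx := hK (heK (mem_insert_self _ _))
      have hy := hK (heK (mem_insert_of_mem (mem_singleton_self _)))
      rw [sum_pair hxy]
      refine div_ne_zero ?_ (hXfree x hx y hy)
      obtain ⟨a, -, rfl⟩ := mem_image.mp hx
      obtain ⟨a', -, rfl⟩ := mem_image.mp hy
      have haa : a ≠ a' := fun h => hxy (by rw [h])
      simp only [xi0]
      exact fun h => (hξ2 _ _ (hcast haa)).2.1 (by linear_combination h)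
  have hSlist : (List.ofFn μ).toFinset = S := by ext z; simp [hSdef, eq_comm]
  rw [boundaryState_eq hη hζ (List.nodup_ofFn.mpr hμ) (hSlist ▸ hS), hSlist, Matrix.mulVec_smul,
    Qop_signedState hη hξ hm κ hS hX hXS hSS hg hw, List.length_ofFn]
  have hre : ∀ F : Finset ℂ → Finset ℂ → (Fin N → Fin 2) → ℂ,
      ∑ α ∈ S.powerset, ∑ K ∈ X.powerset, F α K =
        ∑ α : Finset (Fin M), ∑ γ : Finset (Fin m), F (α.image μ) (γ.image (xi0 hm η ξ)) := by
    intro F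
    rw [hSdef, powerset_image, sum_image (image_injective hμ).injOn, powerset_univ]
    refine sum_congr rfl fun α _ => ?_
    rw [hXdef, nodes, powerset_image, sum_image (image_injective hxi).injOn, powerset_univ]
  rw [hre, sum_fin_card _ ?_, smul_sum]
  · refine sum_congr rfl fun n _ => ?_
    rw [smul_sum]
    refine sum_congr rfl fun α _ => ?_
    rw [smul_sum]
    refine sum_congr rfl fun γ _ => ?_
    set A := α.1.image μ with hA
    set K := γ.1.image (xi0 hm η ξ) with hK
    have hAS : A ⊆ S := image_subset_image (subset_univ _)
    have hKX : K ⊆ X := image_subset_image (subset_univ _)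
    have hSA : S \ A = α.1ᶜ.image μ := by
      rw [hSdef, hA, ← image_sdiff _ _ hμ, compl_eq_univ_sdiff]
    have hSX : Disjoint S X := by
      rw [disjoint_left]
      exact fun y hy hy' => (hXS y hy' y (mem_plusMinus.mpr (Or.inl hy))).1 rfl
    have hSAK : Disjoint (S \ A) K := hSX.mono sdiff_subset hKX
    have hl : (((α.1)ᶜ.sort (· ≤ ·)).map μ ++ (γ.1.sort (· ≤ ·)).map (xi0 hm η ξ)).toFinset =
        (S \ A) ∪ K := by
      rw [hSA]; ext z; simp [hK]
    have hlen : (((α.1)ᶜ.sort (· ≤ ·)).map μ ++ (γ.1.sort (· ≤ ·)).map (xi0 hm η ξ)).length = M := by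
      have := card_le_univ α.1
      rw [α.2, Fintype.card_fin] at this
      simp [card_compl, α.2, γ.2, this]
    have hnd : (((α.1)ᶜ.sort (· ≤ ·)).map μ ++ (γ.1.sort (· ≤ ·)).map (xi0 hm η ξ)).Nodup := by
      rw [List.nodup_append']
      refine ⟨(sort_nodup _ _).map hμ, (sort_nodup _ _).map hxi, ?_⟩
      intro z hz hz'
      rw [List.mem_map] at hz hz'
      obtain ⟨j, -, rfl⟩ := hz
      obtain ⟨a, -, ha⟩ := hz'
      exact disjoint_left.mp hSX (mem_image_of_mem μ (mem_univ j))
        (ha ▸ mem_image_of_mem _ (mem_univ a))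
    have hfree : SignFree ((S \ A) ∪ K) := by
      have hmix : ∀ x ∈ S, ∀ k ∈ X, x + k ≠ 0 := by
        intro x hx k hk h
        exact (hXS k hk (-x) (mem_plusMinus.mpr (Or.inr (by rwa [neg_neg])))).1
          (by linear_combination h)
      intro x hx y hy
      rcases mem_union.mp hx with hx | hx <;> rcases mem_union.mp hy with hy | hy
      · exact hS x (sdiff_subset hx) y (sdiff_subset hy)
      · exact hmix x (sdiff_subset hx) y (hKX hy)
      · rw [add_comm]; exact hmix y (sdiff_subset hy) x (hKX hx)
      · exact hXfree x (hKX hx) y (hKX hy)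
    rw [newState, boundaryState_eq hη hζ hnd (hl ▸ hfree), hl, hlen, smul_smul, smul_smul,
      calR_eq hη hξ hm κ hμ hS (fun x hx y hy => ⟨(hXS x hx y hy).1, (hXS x hx y hy).2.2⟩)]
    congr 1
    rw [prod_union hSAK, ← prod_sdiff hAS]
    have hKne : ∏ x ∈ K, (2 * x + η) ≠ 0 := prod_ne_zero_iff.mpr fun x hx => h2X x (hKX hx)
    rw [← hA, ← hK, ← hSdef, ← hXdef]
    field_simp
  -- Changing signs keeps the number of elements, so for sets of different sizes every determinant
  -- in the sign sum is zero.
  · intro α γ hne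
    refine smul_eq_zero_of_left (signSum_eq_zero (hS.mono (image_subset_image (subset_univ _)))
      fun J hJ => ?_) _
    rw [Rpair, SS_of_card_ne, mul_zero, mul_zero]
    rw [hJ, card_image_of_injective _ hμ, card_image_of_injective _ hxi]
    exact hne.symm

theorem Qop_succ {a : ℕ} (ha : a + 1 ≤ N) (κ : ℂ) :
    Qop (a + 1) ha κ = Qop a (Nat.le_of_succ_le ha) κ * siteOp ⟨a, ha⟩ !![1, 0; 0, κ] := by
  rw [Qop, Qop, List.ofFn_succ', List.concat_eq_append, List.prod_append, List.prod_singleton]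
  rfl

theorem siteOp_diag (n : Fin N) (x y : ℂ) :
    siteOp n !![x, 0; 0, y] = Matrix.diagonal fun s => if s n = 0 then x else y := by
  ext s t
  by_cases hst : s = t
  · subst hst
    rw [Matrix.diagonal_apply_eq, siteOp, Matrix.of_apply, if_pos fun _ _ => rfl]
    generalize s n = i
    fin_cases i <;> simp
  · rw [Matrix.diagonal_apply_ne _ hst, siteOp, Matrix.of_apply]
    split_ifs with h
    · have hn : s n ≠ t n := fun hn => hst (funext fun k => by
        by_cases hk : k = n
        · rw [hk, hn]
        · exact h k hk)
      revert hn
      generalize s n = i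
      generalize t n = j
      fin_cases i <;> fin_cases j <;> simp
    · rfl

theorem Qop_eq_diagonal {k : ℕ} (hk : k ≤ N) (κ : ℂ) :
    Qop k hk κ = Matrix.diagonal fun s => ∏ a : Fin k, if s (Fin.castLE hk a) = 0 then 1 else κ := by
  induction k with
  | zero => simp [Qop]
  | succ k ih =>
    rw [Qop_succ, ih, siteOp_diag, Matrix.diagonal_mul_diagonal]
    congr 1
    funext s
    rw [Fin.prod_univ_castSucc]
    rfl

/-- The local spin operator in terms of the quasi-local operators. -/
theorem siteOp_pauliZ (a : Fin N) :
    siteOp a pauliZ = 1 + (2 : ℂ) • (QopDeriv a.1 a.2.le - QopDeriv (a.1 + 1) a.2) := by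
  rw [pauliZ, siteOp_diag]
  ext s t
  rw [Matrix.add_apply, Matrix.smul_apply, Matrix.sub_apply, QopDeriv, QopDeriv, Matrix.of_apply,
    Matrix.of_apply]
  by_cases hst : s = t
  · subst hst
    simp only [Qop_eq_diagonal, Matrix.diagonal_apply_eq, Matrix.one_apply_eq]
    set P : ℂ → ℂ := fun κ => ∏ i : Fin a.1, if s (Fin.castLE a.2.le i) = 0 then 1 else κ with hP
    have hsucc : (fun κ : ℂ => ∏ i : Fin (a.1 + 1),
        if s (Fin.castLE a.2 i) = 0 then (1 : ℂ) else κ) =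
        fun κ => P κ * if s a = 0 then 1 else κ := by
      funext κ
      rw [Fin.prod_univ_castSucc]
      rfl
    have hd : DifferentiableAt ℂ P 1 := by
      rw [hP]
      refine DifferentiableAt.fun_finsetProd fun i _ => ?_
      by_cases h : s (Fin.castLE a.2.le i) = 0
      · exact (differentiableAt_const (1 : ℂ)).congr_of_eventuallyEq (.of_forall fun _ => if_pos h)
      · exact differentiableAt_id.congr_of_eventuallyEq (.of_forall fun _ => if_neg h)
    have h1 : P 1 = 1 := by simp [hP]
    rw [hsucc]
    by_cases hs : s a = 0
    · simp [hs]
    · simp only [hs, if_false]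
      -- Since P(1) = 1, a down spin at the new site raises the derivative at 1 by exactly one.
      have h2 : deriv (fun κ => P κ * κ) 1 = deriv P 1 * 1 + P 1 * 1 := by
        have := (hd.hasDerivAt.mul (hasDerivAt_id (1 : ℂ))).deriv
        rw [show (fun κ => P κ * κ) = P * id from rfl]
        simpa using this
      rw [h2, h1, smul_eq_mul]
      ring
  · simp [Qop_eq_diagonal, Matrix.diagonal_apply_ne _ hst, Matrix.one_apply_ne hst]

end Main

end OpenXXX

end

theorem mainTheorem7 (N : ℕ) (η ζ b : ℂ) (hη : η ≠ 0) (hζ : ζ ≠ 0)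
    (ξ : Fin N → ℂ) (hξ : OpenXXX.GenericInhom η ξ) :
    (∀ (M m : ℕ) (hm : m ≤ N) (κ : ℂ) (μ : Fin M → ℂ),
      (∀ a : Fin m, 2 * ξ (Fin.castLE hm a) + η ≠ 0 ∧ ξ (Fin.castLE hm a) + ζ ≠ 0) →
      OpenXXX.GenericSpectral hm η ξ μ →
      (OpenXXX.Qop m hm κ).mulVec (OpenXXX.boundaryState η ξ ζ b (List.ofFn μ)) =
        ∑ n ∈ Finset.range (min m M + 1),
          ∑ α : {s : Finset (Fin M) // s.card = n},
            ∑ γ : {s : Finset (Fin m) // s.card = n},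
              OpenXXX.calR hm η ζ κ ξ μ α γ • OpenXXX.newState hm η ζ b ξ μ α.1 γ.1) ∧
    (∀ a : Fin N,
      OpenXXX.siteOp a OpenXXX.pauliZ =
        1 + (2 : ℂ) • (OpenXXX.QopDeriv a.1 a.2.le - OpenXXX.QopDeriv (a.1 + 1) a.2)) := by
  refine ⟨fun M m hm κ μ h0 hμ => ?_, OpenXXX.siteOp_pauliZ⟩
  exact OpenXXX.Qop_boundaryState hη hζ hξ hm κ μ h0 hμ
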